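/- **Setting.** Let $N\ge 0$ be an integer, and let $\mathbf c_1,\dots,\mathbf c_N\in\mathbb R^3$ and $0<a_j<b_j$ be such that the closed balls $B_{b_j}(\mathbf c_j)$ of center $\mathbf c_j$ and radius $b_j$ are pairwise at positive distance. For each $j$ let $g_j\in C^2([0,b_j])$ satisfy $g_j(0)=a_j$, $g_j(b_j)=b_j$ and $g_j'>0$ on $[0,b_j]$. Put $K_j=\{|\mathbf x-\mathbf c_j|\le a_j\}$ (the cloaked objects), $K=\bigcup_j K_j$, $\Omega=\mathbb R^3\setminus K$, $\Omega_0=\mathbb R^3\setminus\{\mathbf c_1,\dots,\mathbf c_N\}$, and let $f:\Omega_0\to\Omega$ be the bijection $$f(\mathbf y)=\mathbf c_j+g_j(|\mathbf y-\mathbf c_j|)\,\frac{\mathbf y-\mathbf c_j}{|\mathbf y-\mathbf c_j|}\ \text{ if } |\mathbf y-\mathbf c_j|\le b_j,\qquad f(\mathbf y)=\mathbf y\ \text{ otherwise},$$ with Jacobian matrix $A(\mathbf y)=(\partial x^\lambda/\partial y^{\lambda'})$ and $\Delta=\det A$ (defined off the spheres $|\mathbf y-\mathbf c_j|=b_j$).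 Let $\varepsilon_0,\mu_0$ be constant positive definite Hermitian $3\times3$ matrices, and let the permittivity and the permeability in $\Omega$ be $$\varepsilon(\mathbf x)=\Delta(\mathbf y)^{-1}A(\mathbf y)\,\varepsilon_0\,A(\mathbf y)^{T},\qquad \mu(\mathbf x)=\Delta(\mathbf y)^{-1}A(\mathbf y)\,\mu_0\,A(\mathbf y)^{T},\qquad \mathbf x=f(\mathbf y).$$ In each $K_j$ let the permittivity $\varepsilon_j$ and the permeability $\mu_j$ be measurable fields of positive definite Hermitian matrices, bounded above on $K_j$ by a constant, and whose determinants are bounded below by a positive constant on every compact subset of the interior of $K_j$. For $S=\Omega$ with $(\varepsilon_S,\mu_S)=(\varepsilon,\mu)$, or $S=K_j$ with $(\varepsilon_S,\mu_S)=(\varepsilon_j,\mu_j)$, let $\mathcal H_S$ be the Hilbert space of pairs $(\mathbf E,\mathbf H)$ of measurable $\mathbb C^3$-valued fields on $S$ of finite energy, with the inner product $$\big((\mathbf E,\mathbf H),(\mathbf E',\mathbf H')\big)_S=\int_S\big(\overline{\mathbf E'}\cdot\varepsilon_S\mathbf E+\overline{\mathbf H'}\cdot\mu_S\mathbf H\big)\,d\mathbf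 x ,$$ and let $a_S$ be the operator in $\mathcal H_S$ $$a_S(\mathbf E,\mathbf H)=i\,\big(\varepsilon_S^{-1}\,\nabla\times\mathbf H,\;-\mu_S^{-1}\,\nabla\times\mathbf E\big)$$ whose domain consists of the $C^1$ fields with compact support in the interior of $S$. Put $\mathcal H_K=\bigoplus_{j=1}^N\mathcal H_{K_j}$, $a_K=\bigoplus_{j=1}^N a_{K_j}$, and $a=a_\Omega\oplus a_K$ in $\mathcal H=\mathcal H_\Omega\oplus\mathcal H_K$. **Theorem.** The operator $a_\Omega$ has exactly one self-adjoint extension $A_\Omega$ in $\mathcal H_\Omega$, and for every self-adjoint extension $A$ of $a$ in $\mathcal H$ there is a self-adjoint extension $A_K$ of $a_K$ in $\mathcal H_K$ such that $$A=A_\Omega\oplus A_K .$$ -/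

import Mathlib

noncomputable section

open MeasureTheory Set
open scoped ENNReal ComplexOrder ComplexConjugate

namespace Cloaking

/-- Euclidean three-space. -/
abbrev R3 := EuclideanSpace ℝ (Fin 3)

/-- The space of values of a (complex) electric or magnetic field. -/
abbrev C3 := EuclideanSpace ℂ (Fin 3)

/-- Complex `3 × 3` matrices (values of permittivities and permeabilities). -/
abbrev Mat3 := Matrix (Fin 3) (Fin 3) ℂ

/-! ### Matrix-weighted `L²` spaces -/

/-- The sesquilinear energy density `∑ conj (v_l) W^{l n} w_n`, i.e. `⟨v, W w⟩` in `ℂ³`; it is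
conjugate-linear in the first argument, as in Mathlib. -/
def density (W : Mat3) (v w : C3) : ℂ := ∑ l, ∑ n, conj (v l) * W l n * w n

/-- The operator `v ↦ W v` on `ℂ³`. -/
abbrev op (W : Mat3) : C3 →L[ℂ] C3 := Matrix.toEuclideanCLM (n := Fin 3) (𝕜 := ℂ) W

theorem density_eq_inner (W : Mat3) (v w : C3) : density W v w = inner ℂ v (op W w) := by
  rw [EuclideanSpace.inner_eq_star_dotProduct]
  simp only [density, Matrix.ofLp_toEuclideanCLM, dotProduct, Matrix.mulVec, Pi.star_apply,
    Finset.sum_mul, RCLike.star_def]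
  exact Finset.sum_congr rfl fun l _ => Finset.sum_congr rfl fun n _ => by ring

/-- A material tensor on `S ⊆ ℝ³`: a measurable field of matrices, positive definite almost
everywhere on `S`, and bounded above and below on the compact subsets of the interior of `S`. -/
structure Weight (S : Set R3) where
  mat : R3 → Mat3
  aemeasurable : ∀ i j, AEMeasurable (fun x => mat x i j) (volume.restrict S)
  posDef : ∀ᵐ x ∂(volume.restrict S), (mat x).PosDef
  locBdd : ∀ Q : Set R3, IsCompact Q → Q ⊆ interior S → ∃ m M : ℝ, 0 < m ∧
    ∀ᵐ x ∂(volume.restrict Q), ∀ v : C3,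
      m * ‖v‖ ^ 2 ≤ (density (mat x) v v).re ∧ (density (mat x) v v).re ≤ M * ‖v‖ ^ 2

theorem op_nonneg {W : Mat3} (h : W.PosDef) : 0 ≤ op W := by
  rw [ContinuousLinearMap.nonneg_iff_isPositive, ContinuousLinearMap.isPositive_iff']
  refine ⟨?_, fun v => ?_⟩
  · rw [IsSelfAdjoint, ← map_star]
    exact congrArg _ h.isHermitian
  · rw [← inner_conj_symm, ← density_eq_inner]
    have := h.posSemidef
    rw [Matrix.posSemidef_iff_dotProduct_mulVec] at this
    have h2 := this.2 v.ofLp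
    have h3 : star v.ofLp ⬝ᵥ W.mulVec v.ofLp = density W v v := by
      rw [density_eq_inner, EuclideanSpace.inner_eq_star_dotProduct, dotProduct_comm]
      simp
    rw [h3] at h2
    rw [Complex.conj_eq_iff_im.2 (Complex.nonneg_iff.1 h2).2.symm]
    exact h2

theorem aemeasurable_op {S : Set R3} {W : R3 → Mat3}
    (h : ∀ i j, AEMeasurable (fun x => W x i j) (volume.restrict S)) :
    AEMeasurable (fun x => op (W x)) (volume.restrict S) := by
  have : (fun x => op (W x)) = fun x => ∑ i, ∑ j, (W x i j) • op (Matrix.single i j 1) := by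
    funext x
    have h1 : W x = ∑ i, ∑ j, (W x i j) • Matrix.single i j (1 : ℂ) := by
      conv_lhs => rw [Matrix.matrix_eq_sum_single (W x)]
      simp only [Matrix.smul_single, smul_eq_mul, mul_one]
    conv_lhs => rw [h1]
    simp only [op, map_sum, map_smul]
  rw [this]
  refine Finset.aemeasurable_fun_sum _ fun i _ => Finset.aemeasurable_fun_sum _ fun j _ => ?_
  exact (h i j).smul_const _

theorem op_inv_mul {W : Mat3} (h : W.PosDef) : op W⁻¹ * op W = 1 := by
  rw [← map_mul, Matrix.nonsing_inv_mul _ ((Matrix.isUnit_iff_isUnit_det _).1 h.isUnit), map_one]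

theorem op_mul_inv {W : Mat3} (h : W.PosDef) : op W * op W⁻¹ = 1 := by
  rw [← map_mul, Matrix.mul_nonsing_inv _ ((Matrix.isUnit_iff_isUnit_det _).1 h.isUnit), map_one]

/-- The square root of a material tensor, used only to establish the Hilbert space structure. -/
def Weight.root {S : Set R3} (W : Weight S) (x : R3) : C3 →L[ℂ] C3 := CFC.sqrt (op (W.mat x))

namespace Weight

variable {S : Set R3} (W : Weight S)

theorem aemeasurable_root : AEMeasurable W.root (volume.restrict S) := by
  classical
  have hm : Measurable ({a : C3 →L[ℂ] C3 | 0 ≤ a}.piecewise CFC.sqrt 0) :=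
    ContinuousOn.measurable_piecewise CFC.continuousOn_sqrt continuousOn_const
      (isClosed_Ici (a := (0 : C3 →L[ℂ] C3))).measurableSet
  refine (hm.comp_aemeasurable (aemeasurable_op W.aemeasurable)).congr ?_
  filter_upwards [W.posDef] with x hx
  exact Set.piecewise_eq_of_mem _ _ _ (op_nonneg hx)

theorem aemeasurable_op_inv :
    AEMeasurable (fun x => op (W.mat x)⁻¹) (volume.restrict S) := by
  classical
  have hm : Measurable ({a : C3 →L[ℂ] C3 | IsUnit a}.piecewise Ring.inverse 0) := by
    refine ContinuousOn.measurable_piecewise (fun a ha => ?_) continuousOn_const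
      Units.isOpen.measurableSet
    obtain ⟨u, rfl⟩ := ha
    exact (NormedRing.inverse_continuousAt u).continuousWithinAt
  refine (hm.comp_aemeasurable (aemeasurable_op W.aemeasurable)).congr ?_
  filter_upwards [W.posDef] with x hx
  let u : (C3 →L[ℂ] C3)ˣ := ⟨op (W.mat x), op (W.mat x)⁻¹, op_mul_inv hx, op_inv_mul hx⟩
  have hu : IsUnit (op (W.mat x)) := ⟨u, rfl⟩
  simp only [Function.comp]
  rw [Set.piecewise_eq_of_mem {a : C3 →L[ℂ] C3 | IsUnit a} _ _ hu]
  exact Ring.inverse_unit u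

theorem inner_root {x : R3} (hx : (W.mat x).PosDef) (v w : C3) :
    inner ℂ (W.root x v) (W.root x w) = density (W.mat x) v w := by
  have h0 : 0 ≤ W.root x := CFC.sqrt_nonneg (op (W.mat x))
  have h1 : IsSelfAdjoint (W.root x) :=
    ((ContinuousLinearMap.nonneg_iff_isPositive _).1 h0).isSelfAdjoint
  rw [density_eq_inner, ← ContinuousLinearMap.adjoint_inner_right,
    ← ContinuousLinearMap.star_eq_adjoint, h1.star_eq, ← mul_apply_eq_comp]
  rw [show W.root x * W.root x = op (W.mat x) from CFC.sqrt_mul_sqrt_self _ (op_nonneg hx)]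

theorem root_inv {x : R3} (hx : (W.mat x).PosDef) (v : C3) :
    W.root x (op (W.mat x)⁻¹ (W.root x v)) = v := by
  have h0 : W.root x * W.root x = op (W.mat x) := CFC.sqrt_mul_sqrt_self _ (op_nonneg hx)
  have h1 : (W.root x * (op (W.mat x)⁻¹ * W.root x)) = 1 := by
    have ha : op (W.mat x)⁻¹ * W.root x * W.root x = 1 := by
      rw [mul_assoc, h0, op_inv_mul hx]
    have hb : W.root x * (W.root x * op (W.mat x)⁻¹) = 1 := by
      rw [← mul_assoc, h0, op_mul_inv hx]
    have hc : op (W.mat x)⁻¹ * W.root x = W.root x * op (W.mat x)⁻¹ :=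
      left_inv_eq_right_inv ha hb
    rw [hc, hb]
  exact DFunLike.congr_fun h1 v

theorem aestronglyMeasurable_apply {T : R3 → C3 →L[ℂ] C3}
    (hT : AEMeasurable T (volume.restrict S)) {f : R3 → C3}
    (hf : AEStronglyMeasurable f (volume.restrict S)) :
    AEStronglyMeasurable (fun x => T x (f x)) (volume.restrict S) :=
  isBoundedBilinearMap_apply.continuous.comp_aestronglyMeasurable
    (hT.aestronglyMeasurable.prodMk hf)

/-- A field has finite energy iff its image under the square root is square integrable. -/
theorem integrable_density_iff {f : R3 → C3}
    (hf : AEStronglyMeasurable f (volume.restrict S)) :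
    Integrable (fun x => density (W.mat x) (f x) (f x)) (volume.restrict S) ↔
      MemLp (fun x => W.root x (f x)) 2 (volume.restrict S) := by
  rw [memLp_two_iff_integrable_sq_norm (aestronglyMeasurable_apply W.aemeasurable_root hf)]
  have h : (fun x => density (W.mat x) (f x) (f x)) =ᵐ[volume.restrict S]
      fun x => ((‖W.root x (f x)‖ ^ 2 : ℝ) : ℂ) := by
    filter_upwards [W.posDef] with x hx
    rw [← W.inner_root hx, inner_self_eq_norm_sq_to_K]
    norm_cast
  rw [integrable_congr h]
  exact ⟨fun h => h.re, fun h => h.ofReal⟩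

/-- Finite-energy fields: (classes of) measurable fields on `S` that are square integrable with the
weight `W`. -/
def finiteEnergy : Submodule ℂ (R3 →ₘ[volume.restrict S] C3) where
  carrier := {f | Integrable (fun x => density (W.mat x) (f x) (f x)) (volume.restrict S)}
  zero_mem' := by
    have h : (fun x => density (W.mat x) ((0 : R3 →ₘ[volume.restrict S] C3) x)
        ((0 : R3 →ₘ[volume.restrict S] C3) x)) =ᵐ[volume.restrict S] fun _ => 0 := by
      filter_upwards [AEEqFun.coeFn_zero (α := R3) (β := C3) (μ := volume.restrict S)] with x hx
      rw [hx]; simp [density]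
    exact (integrable_congr h).2 (integrable_zero _ _ _)
  add_mem' := by
    intro f g hf hg
    simp only [Set.mem_ofPred_eq] at hf hg ⊢
    rw [W.integrable_density_iff (AEEqFun.aestronglyMeasurable _)] at hf hg ⊢
    refine (memLp_congr_ae ?_).2 (hf.add hg)
    filter_upwards [AEEqFun.coeFn_add f g] with x hx
    simp [hx]
  smul_mem' := by
    intro c f hf
    simp only [Set.mem_ofPred_eq] at hf ⊢
    rw [W.integrable_density_iff (AEEqFun.aestronglyMeasurable _)] at hf ⊢
    refine (memLp_congr_ae ?_).2 (hf.const_smul c)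
    filter_upwards [AEEqFun.coeFn_smul c f] with x hx
    simp [hx]

/-- The Hilbert space of finite-energy fields on `S` with the weight `W`. -/
def L2 : Type := W.finiteEnergy

namespace L2

instance : AddCommGroup W.L2 := Submodule.addCommGroup W.finiteEnergy
instance : Module ℂ W.L2 := Submodule.module W.finiteEnergy

variable {W}

/-- The underlying field (defined up to null sets of `S`). -/
def field (f : W.L2) : R3 → C3 := f.1

theorem aesm (f : W.L2) : AEStronglyMeasurable f.field (volume.restrict S) :=
  AEEqFun.aestronglyMeasurable _

theorem memLp_root (f : W.L2) :
    MemLp (fun x => W.root x (f.field x)) 2 (volume.restrict S) :=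
  (W.integrable_density_iff f.aesm).1 f.2

theorem ext {f g : W.L2} (h : f.field =ᵐ[volume.restrict S] g.field) : f = g :=
  Subtype.ext (AEEqFun.ext h)

theorem field_add (f g : W.L2) :
    (f + g).field =ᵐ[volume.restrict S] fun x => f.field x + g.field x :=
  AEEqFun.coeFn_add f.1 g.1

theorem field_smul (c : ℂ) (f : W.L2) :
    (c • f).field =ᵐ[volume.restrict S] fun x => c • f.field x :=
  AEEqFun.coeFn_smul c f.1

variable (W) in
/-- A finite-energy measurable field, as an element of the Hilbert space. -/
def mk (f : R3 → C3) (hf : AEStronglyMeasurable f (volume.restrict S))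
    (hi : Integrable (fun x => density (W.mat x) (f x) (f x)) (volume.restrict S)) : W.L2 :=
  ⟨AEEqFun.mk f hf, by
    refine (integrable_congr ?_).2 hi
    filter_upwards [AEEqFun.coeFn_mk f hf] with x hx
    rw [hx]⟩

theorem field_mk {f : R3 → C3} (hf : AEStronglyMeasurable f (volume.restrict S))
    (hi : Integrable (fun x => density (W.mat x) (f x) (f x)) (volume.restrict S)) :
    (mk W f hf hi).field =ᵐ[volume.restrict S] f := AEEqFun.coeFn_mk f hf

variable (W) in
/-- Multiplication by the square root of the weight, onto the unweighted `L²` space. -/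
def rootEquiv : W.L2 ≃ₗ[ℂ] Lp C3 2 (volume.restrict S) :=
  LinearEquiv.ofBijective
    { toFun := fun f => f.memLp_root.toLp _
      map_add' := fun f g => by
        rw [← MemLp.toLp_add, MemLp.toLp_eq_toLp_iff]
        filter_upwards [field_add f g] with x hx
        simp [hx]
      map_smul' := fun c f => by
        rw [RingHom.id_apply, ← MemLp.toLp_const_smul, MemLp.toLp_eq_toLp_iff]
        filter_upwards [field_smul c f] with x hx
        simp [hx] }
    ⟨fun f g h => by
      have h' := (MemLp.toLp_eq_toLp_iff f.memLp_root g.memLp_root).1 h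
      refine ext ?_
      filter_upwards [h', W.posDef] with x hx hp
      have h0 : W.root x * W.root x = op (W.mat x) := CFC.sqrt_mul_sqrt_self _ (op_nonneg hp)
      have ha : op (W.mat x)⁻¹ * W.root x * W.root x = 1 := by
        rw [mul_assoc, h0, op_inv_mul hp]
      have hb := congrArg (op (W.mat x)⁻¹ * W.root x) hx
      rw [← mul_apply_eq_comp, ← mul_apply_eq_comp, ha] at hb
      exact hb, fun h => by
      have hm : AEStronglyMeasurable (fun x => op (W.mat x)⁻¹ (W.root x (h x)))
          (volume.restrict S) :=
        aestronglyMeasurable_apply W.aemeasurable_op_inv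
          (aestronglyMeasurable_apply W.aemeasurable_root (Lp.aestronglyMeasurable h))
      have he : (fun x => W.root x (op (W.mat x)⁻¹ (W.root x (h x)))) =ᵐ[volume.restrict S] h := by
        filter_upwards [W.posDef] with x hp
        exact W.root_inv hp _
      have hi := (W.integrable_density_iff hm).2 ((memLp_congr_ae he).2 (Lp.memLp h))
      refine ⟨mk W _ hm hi, ?_⟩
      refine Lp.ext ?_
      refine (MemLp.coeFn_toLp (mk W _ hm hi).memLp_root).trans ?_
      filter_upwards [he, field_mk hm hi] with x hx hx'
      rw [hx', hx]⟩

theorem rootEquiv_coe (f : W.L2) :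
    rootEquiv W f =ᵐ[volume.restrict S] fun x => W.root x (f.field x) :=
  MemLp.coeFn_toLp f.memLp_root

/-- The inner product is `∫_S ∑ conj (f_l) W^{l n} g_n dx`. -/
def energyInner (f g : W.L2) : ℂ := ∫ x in S, density (W.mat x) (f.field x) (g.field x)

theorem energyInner_eq (f g : W.L2) : energyInner f g = inner ℂ (rootEquiv W f) (rootEquiv W g) := by
  rw [MeasureTheory.L2.inner_def, energyInner]
  refine integral_congr_ae ?_
  filter_upwards [rootEquiv_coe f, rootEquiv_coe g, W.posDef] with x hf hg hp
  rw [hf, hg, W.inner_root hp]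

variable (W) in
/-- The inner product axioms. -/
@[reducible] def core : InnerProductSpace.Core ℂ W.L2 where
  inner := energyInner
  conj_inner_symm f g := by rw [energyInner_eq, energyInner_eq, inner_conj_symm]
  re_inner_nonneg f := by rw [energyInner_eq]; exact inner_self_nonneg
  add_left f g h := by rw [energyInner_eq, energyInner_eq, energyInner_eq, map_add, inner_add_left]
  smul_left f g c := by rw [energyInner_eq, energyInner_eq, map_smul, inner_smul_left]
  definite f h := by
    rw [energyInner_eq, inner_self_eq_zero] at h
    exact (rootEquiv W).map_eq_zero_iff.1 h

instance : NormedAddCommGroup W.L2 := @InnerProductSpace.Core.toNormedAddCommGroup ℂ _ _ _ _ (core W)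
instance : InnerProductSpace ℂ W.L2 := InnerProductSpace.ofCore (core W).toCore

theorem inner_apply (f g : W.L2) :
    inner ℂ f g = ∫ x in S, density (W.mat x) (f.field x) (g.field x) := rfl

instance : CompleteSpace W.L2 := by
  let e : W.L2 ≃ₗᵢ[ℂ] Lp C3 2 (volume.restrict S) :=
    (rootEquiv W).isometryOfInner fun f g => (energyInner_eq f g).symm
  exact e.symm.toIsometryEquiv.completeSpace_iff.1 inferInstance

end L2

end Weight

/-! ### The Maxwell operator of a medium on test fields -/

/-- The `ℂ³`-valued `C¹` fields with compact support in `O`. -/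
def testFields (O : Set R3) : Submodule ℂ (R3 → C3) where
  carrier := {φ | ContDiff ℝ 1 φ ∧ HasCompactSupport φ ∧ tsupport φ ⊆ O}
  zero_mem' := ⟨contDiff_const, HasCompactSupport.zero, by simp [tsupport]⟩
  add_mem' := fun {f g} hf hg => ⟨hf.1.add hg.1, hf.2.1.add hg.2.1,
    (tsupport_add f g).trans (Set.union_subset hf.2.2 hg.2.2)⟩
  smul_mem' := fun c f hf => ⟨contDiff_const.smul hf.1, hf.2.1.smul_left (f := fun _ => c),
    (tsupport_smul_subset_right (fun _ => c) f).trans hf.2.2⟩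

/-- The partial derivative `∂_k φ_l`. -/
def partialDeriv (φ : R3 → C3) (k l : Fin 3) (x : R3) : ℂ :=
  fderiv ℝ φ x (EuclideanSpace.single k 1) l

/-- The curl `∇ × φ`. -/
def curl (φ : R3 → C3) (x : R3) : C3 :=
  !₂[partialDeriv φ 1 2 x - partialDeriv φ 2 1 x,
     partialDeriv φ 2 0 x - partialDeriv φ 0 2 x,
     partialDeriv φ 0 1 x - partialDeriv φ 1 0 x]

section curl

variable {O : Set R3}

theorem curl_add {φ ψ : R3 → C3} (hφ : φ ∈ testFields O) (hψ : ψ ∈ testFields O) :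
    curl (φ + ψ) = curl φ + curl ψ := by
  funext x
  have h := fderiv_add ((hφ.1.differentiable one_ne_zero) x) ((hψ.1.differentiable one_ne_zero) x)
  ext i
  fin_cases i <;> simp [curl, partialDeriv, h] <;> ring

theorem curl_smul {φ : R3 → C3} (c : ℂ) (hφ : φ ∈ testFields O) :
    curl (c • φ) = c • curl φ := by
  funext x
  have h := fderiv_const_smul ((hφ.1.differentiable one_ne_zero) x) c
  ext i
  fin_cases i <;> simp [curl, partialDeriv, h] <;> ring

theorem continuous_curl {φ : R3 → C3} (hφ : φ ∈ testFields O) : Continuous (curl φ) := by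
  have h : ∀ k l, Continuous (partialDeriv φ k l) := fun k l => by
    have h1 := (hφ.1.continuous_fderiv one_ne_zero).clm_apply
      (continuous_const (y := (EuclideanSpace.single k 1 : R3)))
    exact (PiLp.continuous_apply 2 (fun _ : Fin 3 => ℂ) l).comp h1
  refine (PiLp.continuous_toLp 2 _).comp (continuous_pi fun i => ?_)
  fin_cases i
  · exact (h 1 2).sub (h 2 1)
  · exact (h 2 0).sub (h 0 2)
  · exact (h 0 1).sub (h 1 0)

theorem curl_eq_zero {φ : R3 → C3} {x : R3} (hx : x ∉ tsupport φ) : curl φ x = 0 := by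
  have h : fderiv ℝ φ x = 0 := fderiv_of_notMem_tsupport ℝ hx
  ext i
  fin_cases i <;> simp [curl, partialDeriv, h]

end curl

namespace Weight

variable {S : Set R3} (W : Weight S)

theorem integrable_of_bounded {Q : Set R3} (hQ : IsCompact Q) (hQS : Q ⊆ interior S) {f : R3 → C3}
    (hf : AEStronglyMeasurable f (volume.restrict S)) (h0 : ∀ x, x ∉ Q → f x = 0) {C : ℝ}
    (hC : ∀ᵐ x ∂(volume.restrict Q), ‖f x‖ ≤ C) :
    Integrable (fun x => density (W.mat x) (f x) (f x)) (volume.restrict S) := by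
  rw [W.integrable_density_iff hf]
  obtain ⟨m, M, hm, hb⟩ := W.locBdd Q hQ hQS
  have hQS' : Q ⊆ S := hQS.trans interior_subset
  have hr : (volume.restrict S).restrict Q = volume.restrict Q := by
    rw [Measure.restrict_restrict hQ.measurableSet, Set.inter_eq_left.2 hQS']
  have hind : (fun x => W.root x (f x)) = Q.indicator fun x => W.root x (f x) := by
    funext x
    by_cases hx : x ∈ Q
    · rw [Set.indicator_of_mem hx]
    · rw [Set.indicator_of_notMem hx, h0 x hx, map_zero]
  have hms := aestronglyMeasurable_apply W.aemeasurable_root hf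
  rw [hind, memLp_indicator_iff_restrict hQ.measurableSet, hr]
  have : IsFiniteMeasure (volume.restrict Q) := ⟨by
    rw [Measure.restrict_apply_univ]; exact hQ.measure_lt_top⟩
  refine MemLp.of_bound (hms.mono_measure (Measure.restrict_mono hQS' le_rfl))
    (Real.sqrt (|M| * C ^ 2)) ?_
  have hp : ∀ᵐ x ∂(volume.restrict Q), (W.mat x).PosDef :=
    ae_restrict_of_ae_restrict_of_subset hQS' W.posDef
  filter_upwards [hC, hb, hp] with x h1 h2 h3
  refine Real.le_sqrt_of_sq_le ?_
  have h4 : ‖W.root x (f x)‖ ^ 2 = (density (W.mat x) (f x) (f x)).re := by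
    rw [← W.inner_root h3, inner_self_eq_norm_sq_to_K]
    norm_cast
  rw [h4]
  calc _ ≤ M * ‖f x‖ ^ 2 := (h2 (f x)).2
    _ ≤ |M| * ‖f x‖ ^ 2 := by gcongr; exact le_abs_self M
    _ ≤ |M| * C ^ 2 := by gcongr

theorem exists_bound_inv {Q : Set R3} (hQ : IsCompact Q) (hQS : Q ⊆ interior S) :
    ∃ R : ℝ, 0 ≤ R ∧ ∀ᵐ x ∂(volume.restrict Q), ∀ v : C3, ‖op (W.mat x)⁻¹ v‖ ≤ R * ‖v‖ := by
  obtain ⟨m, M, hm, hb⟩ := W.locBdd Q hQ hQS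
  refine ⟨m⁻¹, by positivity, ?_⟩
  have hp : ∀ᵐ x ∂(volume.restrict Q), (W.mat x).PosDef :=
    ae_restrict_of_ae_restrict_of_subset (hQS.trans interior_subset) W.posDef
  filter_upwards [hb, hp] with x h1 h2 v
  set u := op (W.mat x)⁻¹ v with hu
  have h3 : op (W.mat x) u = v := DFunLike.congr_fun (op_mul_inv h2) v
  have h4 := (h1 u).1
  rw [density_eq_inner, h3] at h4
  have h5 : m * ‖u‖ ^ 2 ≤ ‖u‖ * ‖v‖ := h4.trans (re_inner_le_norm (𝕜 := ℂ) u v)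
  rcases (norm_nonneg u).eq_or_lt with h6 | h6
  · rw [← h6]; positivity
  · rw [inv_mul_eq_div, le_div_iff₀ hm]
    nlinarith

theorem integrable_testField {φ : R3 → C3} (hφ : φ ∈ testFields (interior S)) :
    Integrable (fun x => density (W.mat x) (φ x) (φ x)) (volume.restrict S) := by
  obtain ⟨C, hC⟩ := hφ.2.1.exists_bound_of_continuous hφ.1.continuous
  exact W.integrable_of_bounded hφ.2.1 hφ.2.2 hφ.1.continuous.aestronglyMeasurable
    (fun x hx => image_eq_zero_of_notMem_tsupport hx) (Filter.Eventually.of_forall hC)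

theorem aesm_inv_curl {φ : R3 → C3} (hφ : φ ∈ testFields (interior S)) :
    AEStronglyMeasurable (fun x => op (W.mat x)⁻¹ (curl φ x)) (volume.restrict S) :=
  aestronglyMeasurable_apply W.aemeasurable_op_inv (continuous_curl hφ).aestronglyMeasurable

theorem integrable_inv_curl {φ : R3 → C3} (hφ : φ ∈ testFields (interior S)) :
    Integrable (fun x => density (W.mat x) (op (W.mat x)⁻¹ (curl φ x))
      (op (W.mat x)⁻¹ (curl φ x))) (volume.restrict S) := by
  obtain ⟨C, hC⟩ := (hφ.2.1 : IsCompact _).exists_bound_of_continuousOn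
    (continuous_curl hφ).continuousOn
  obtain ⟨R, hR, hb⟩ := W.exists_bound_inv hφ.2.1 hφ.2.2
  refine W.integrable_of_bounded (C := R * C) hφ.2.1 hφ.2.2 (W.aesm_inv_curl hφ)
    (fun x hx => by rw [curl_eq_zero hx, map_zero]) ?_
  have hmem := ae_restrict_mem (μ := (volume : Measure R3)) (hφ.2.1 : IsCompact _).measurableSet
  filter_upwards [hb, hmem] with x h1 h2
  exact (h1 _).trans (by gcongr; exact hC x h2)

/-- A test field as an element of the weighted space. -/
def embed : testFields (interior S) →ₗ[ℂ] W.L2 where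
  toFun φ := L2.mk W φ.1 φ.2.1.continuous.aestronglyMeasurable (W.integrable_testField φ.2)
  map_add' _ _ := rfl
  map_smul' _ _ := rfl

/-- The field `W⁻¹ (∇ × φ)`, with `W⁻¹` the pointwise inverse matrix. -/
def invCurl : testFields (interior S) →ₗ[ℂ] W.L2 where
  toFun φ := L2.mk W (fun x => op (W.mat x)⁻¹ (curl φ.1 x)) (W.aesm_inv_curl φ.2)
    (W.integrable_inv_curl φ.2)
  map_add' φ ψ := by
    refine L2.ext ?_
    refine (L2.field_mk _ _).trans (Filter.EventuallyEq.symm ((L2.field_add _ _).trans ?_))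
    filter_upwards [L2.field_mk (W.aesm_inv_curl φ.2) (W.integrable_inv_curl φ.2),
      L2.field_mk (W.aesm_inv_curl ψ.2) (W.integrable_inv_curl ψ.2)] with x h1 h2
    rw [h1, h2, Submodule.coe_add, curl_add φ.2 ψ.2, Pi.add_apply, map_add]
  map_smul' c φ := by
    refine L2.ext ?_
    refine (L2.field_mk _ _).trans (Filter.EventuallyEq.symm ((L2.field_smul _ _).trans ?_))
    filter_upwards [L2.field_mk (W.aesm_inv_curl φ.2) (W.integrable_inv_curl φ.2)] with x h1
    rw [h1, Submodule.coe_smul, curl_smul c φ.2, Pi.smul_apply, map_smul, RingHom.id_apply]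

theorem embed_injective : Function.Injective W.embed := by
  rw [← LinearMap.ker_eq_bot, LinearMap.ker_eq_bot']
  intro φ h
  have h1 : φ.1 =ᵐ[volume.restrict S] fun _ => 0 :=
    (L2.field_mk φ.2.1.continuous.aestronglyMeasurable (W.integrable_testField φ.2)).symm.trans
      (by
        have : (W.embed φ).field = (0 : W.L2).field := by rw [h]
        exact (Filter.EventuallyEq.of_eq this).trans AEEqFun.coeFn_zero)
  have h2 := Measure.eqOn_open_of_ae_eq
    (ae_restrict_of_ae_restrict_of_subset interior_subset h1) isOpen_interior
    φ.2.1.continuous.continuousOn continuousOn_const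
  refine Subtype.ext (funext fun x => ?_)
  by_cases hx : x ∈ interior S
  · exact h2 hx
  · exact image_eq_zero_of_notMem_tsupport fun h => hx (φ.2.2.2 h)

end Weight

section Maxwell

variable {S : Set R3} (ε μ : Weight S)

/-- The Hilbert space `L²(S; ε) ⊕ L²(S; μ)` of pairs `(E, H)` of finite energy on `S`. -/
abbrev Energy := WithLp 2 (ε.L2 × μ.L2)

/-- Pairs `(E, H)` of `C¹` fields with compact support in the interior of `S`. -/
abbrev TestPairs (S : Set R3) := testFields (interior S) × testFields (interior S)

/-- Test pairs as elements of the energy space. -/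
def embedPair : TestPairs S →ₗ[ℂ] Energy ε μ :=
  (WithLp.linearEquiv 2 ℂ (ε.L2 × μ.L2)).symm.toLinearMap ∘ₗ (ε.embed.prodMap μ.embed)

/-- The Maxwell expression `(E, H) ↦ i (ε⁻¹ ∇ × H, - μ⁻¹ ∇ × E)`. -/
def maxwellExpr : TestPairs S →ₗ[ℂ] Energy ε μ :=
  (WithLp.linearEquiv 2 ℂ (ε.L2 × μ.L2)).symm.toLinearMap ∘ₗ
    (Complex.I • (ε.invCurl ∘ₗ LinearMap.snd ℂ _ _)).prod
      (Complex.I • (-(μ.invCurl ∘ₗ LinearMap.fst ℂ _ _)))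

theorem embedPair_injective : Function.Injective (embedPair ε μ) :=
  (WithLp.linearEquiv 2 ℂ (ε.L2 × μ.L2)).symm.injective.comp
    (ε.embed_injective.prodMap μ.embed_injective)

/-- The Maxwell operator of the medium `(ε, μ)` on `S`: the operator
`(E, H) ↦ i (ε⁻¹ ∇ × H, - μ⁻¹ ∇ × E)` in the energy space, with domain the `C¹` pairs with compact
support in the interior of `S`. -/
def maxwell : Energy ε μ →ₗ.[ℂ] Energy ε μ where
  domain := LinearMap.range (embedPair ε μ)
  toFun := maxwellExpr ε μ ∘ₗ
    (LinearEquiv.ofInjective (embedPair ε μ) (embedPair_injective ε μ)).symm.toLinearMap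

theorem maxwell_apply (p : TestPairs S) :
    maxwell ε μ ⟨embedPair ε μ p, LinearMap.mem_range_self _ p⟩ = maxwellExpr ε μ p := by
  change maxwellExpr ε μ ((LinearEquiv.ofInjective (embedPair ε μ) (embedPair_injective ε μ)).symm
    ⟨embedPair ε μ p, LinearMap.mem_range_self _ p⟩) = _
  congr 1
  rw [LinearEquiv.symm_apply_eq]
  rfl

end Maxwell

/-! ### Orthogonal direct sums of unbounded operators -/

section DirectSum

variable {E F : Type*} [NormedAddCommGroup E] [InnerProductSpace ℂ E] [NormedAddCommGroup F]
  [InnerProductSpace ℂ F]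

/-- The direct sum `A ⊕ B`, with domain `D(A) ⊕ D(B)`. -/
def oplus (A : E →ₗ.[ℂ] E) (B : F →ₗ.[ℂ] F) : WithLp 2 (E × F) →ₗ.[ℂ] WithLp 2 (E × F) where
  domain :=
    { carrier := {u | u.fst ∈ A.domain ∧ u.snd ∈ B.domain}
      zero_mem' := ⟨A.domain.zero_mem, B.domain.zero_mem⟩
      add_mem' := fun hu hv => ⟨A.domain.add_mem hu.1 hv.1, B.domain.add_mem hu.2 hv.2⟩
      smul_mem' := fun c _ hu => ⟨A.domain.smul_mem c hu.1, B.domain.smul_mem c hu.2⟩ }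
  toFun :=
    { toFun := fun u => WithLp.toLp 2 (A ⟨u.1.fst, u.2.1⟩, B ⟨u.1.snd, u.2.2⟩)
      map_add' := fun u v => by
        rw [← WithLp.toLp_add, Prod.mk_add_mk, ← LinearPMap.map_add, ← LinearPMap.map_add]
        rfl
      map_smul' := fun c u => by
        rw [RingHom.id_apply, ← WithLp.toLp_smul, Prod.smul_mk, ← LinearPMap.map_smul,
          ← LinearPMap.map_smul]
        rfl }

variable {ι : Type*} [Fintype ι] {G : ι → Type*} [∀ j, NormedAddCommGroup (G j)]
  [∀ j, InnerProductSpace ℂ (G j)]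

/-- The direct sum `⊕_j A_j` of finitely many operators, with domain `⊕_j D(A_j)`. -/
def bigOplus (A : ∀ j, G j →ₗ.[ℂ] G j) : PiLp 2 G →ₗ.[ℂ] PiLp 2 G where
  domain :=
    { carrier := {u | ∀ j, u j ∈ (A j).domain}
      zero_mem' := fun j => (A j).domain.zero_mem
      add_mem' := fun hu hv j => (A j).domain.add_mem (hu j) (hv j)
      smul_mem' := fun c _ hu j => (A j).domain.smul_mem c (hu j) }
  toFun :=
    { toFun := fun u => WithLp.toLp 2 fun j => A j ⟨u.1 j, u.2 j⟩
      map_add' := fun u v => by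
        rw [← WithLp.toLp_add]
        congr 1
        funext j
        exact LinearPMap.map_add (A j) ⟨u.1 j, u.2 j⟩ ⟨v.1 j, v.2 j⟩
      map_smul' := fun c u => by
        rw [RingHom.id_apply, ← WithLp.toLp_smul]
        congr 1
        funext j
        exact LinearPMap.map_smul (A j) c ⟨u.1 j, u.2 j⟩ }

end DirectSum

/-! ### Spherical cloaks and their transformation media -/

/-- `g` is a cloaking function on `[0, b]`: it is `C²` on `[0, b]` (one-sided at the endpoints),
`g 0 = a`, `g b = b`, and `g' > 0` on `[0, b]`. -/
structure IsCloakingFunction (a b : ℝ) (g : ℝ → ℝ) : Prop where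
  contDiffOn : ContDiffOn ℝ 2 g (Icc 0 b)
  map_zero : g 0 = a
  map_b : g b = b
  deriv_pos : ∀ ρ ∈ Icc 0 b, 0 < derivWithin g (Icc 0 b) ρ

/-- `N` spherical cloaks: centers `c j`, radii `0 < a j < b j`, cloaking functions `g j`; the closed
balls of center `c j` and radius `b j` are at positive distance from each other, which for balls of
`ℝ³` means that the distance of the centers exceeds the sum of the radii. -/
structure CloakGeometry (N : ℕ) where
  c : Fin N → R3
  a : Fin N → ℝ
  b : Fin N → ℝ
  g : Fin N → ℝ → ℝ
  a_pos : ∀ j, 0 < a j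
  a_lt_b : ∀ j, a j < b j
  cloaking : ∀ j, IsCloakingFunction (a j) (b j) (g j)
  separated : ∀ j l, j ≠ l → b j + b l < dist (c j) (c l)

namespace CloakGeometry

variable {N : ℕ} (G : CloakGeometry N)

/-- The space `ℝ³` with the centers of the cloaks removed. -/
def Ω₀ : Set R3 := {y | ∀ j, y ≠ G.c j}

/-- The `j`-th cloaked object. -/
def K (j : Fin N) : Set R3 := Metric.closedBall (G.c j) (G.a j)

/-- The exterior of the cloaked objects. -/
def Ω : Set R3 := (⋃ j, G.K j)ᶜ

open Classical in
/-- The transformation `y ↦ x(y)` from `Ω₀` to `Ω`: it is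
`c j + g j (|y - c j|) (y - c j) / |y - c j|` in the closed ball of center `c j` and radius `b j`, and
the identity outside of these balls. -/
def map (y : R3) : R3 :=
  if h : ∃ j, y ∈ Metric.closedBall (G.c j) (G.b j) then
    G.c h.choose + (G.g h.choose ‖y - G.c h.choose‖ / ‖y - G.c h.choose‖) • (y - G.c h.choose)
  else y

/-- The inverse `x ↦ y(x)`, from `Ω` to `Ω₀`. -/
def inv : R3 → R3 := Function.invFunOn G.map G.Ω₀

/-- The Jacobian matrix `∂ x^l / ∂ y^m`. -/
def jacobian (y : R3) : Matrix (Fin 3) (Fin 3) ℝ :=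
  Matrix.of fun l m => fderiv ℝ G.map y (EuclideanSpace.single m 1) l

/-- The transformed material tensor `Δ(y)⁻¹ A(y) M₀ A(y)ᵀ` at `y = y(x)`, where `A` is the Jacobian
matrix and `Δ` its determinant. -/
def transform (M₀ : Mat3) (x : R3) : Mat3 :=
  (G.jacobian (G.inv x)).det⁻¹ •
    ((G.jacobian (G.inv x)).map Complex.ofReal * M₀ *
      ((G.jacobian (G.inv x)).map Complex.ofReal).transpose)

end CloakGeometry

namespace IsCloakingFunction

variable {a b : ℝ} {g : ℝ → ℝ}

theorem continuousOn (h : IsCloakingFunction a b g) : ContinuousOn g (Icc 0 b) :=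
  h.contDiffOn.continuousOn

theorem continuousOn_deriv (h : IsCloakingFunction a b g) (hb : 0 < b) :
    ContinuousOn (derivWithin g (Icc 0 b)) (Icc 0 b) :=
  h.contDiffOn.continuousOn_derivWithin (uniqueDiffOn_Icc hb) (by norm_num)

theorem strictMonoOn (h : IsCloakingFunction a b g) : StrictMonoOn g (Icc 0 b) := by
  refine strictMonoOn_of_deriv_pos (convex_Icc 0 b) h.continuousOn fun x hx => ?_
  rw [interior_Icc] at hx
  rw [← derivWithin_of_mem_nhds (Icc_mem_nhds hx.1 hx.2)]
  exact h.deriv_pos x (Ioo_subset_Icc_self hx)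

theorem hasDerivAt (h : IsCloakingFunction a b g) {ρ : ℝ} (hρ : ρ ∈ Ioo 0 b) :
    HasDerivAt g (derivWithin g (Icc 0 b) ρ) ρ :=
  (((h.contDiffOn.differentiableOn (by norm_num)) ρ
    (Ioo_subset_Icc_self hρ)).hasDerivWithinAt).hasDerivAt (Icc_mem_nhds hρ.1 hρ.2)

theorem mem_Ioc (h : IsCloakingFunction a b g) {ρ : ℝ} (hρ : ρ ∈ Ioc 0 b) : g ρ ∈ Ioc a b := by
  have hb : 0 < b := hρ.1.trans_le hρ.2
  refine ⟨?_, ?_⟩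
  · rw [← h.map_zero]
    exact h.strictMonoOn (left_mem_Icc.2 hb.le) (Ioc_subset_Icc_self hρ) hρ.1
  · conv_rhs => rw [← h.map_b]
    exact h.strictMonoOn.monotoneOn (Ioc_subset_Icc_self hρ) (right_mem_Icc.2 hb.le) hρ.2

end IsCloakingFunction

/-- `A = α (1 - n nᵀ) + γ n nᵀ` for a unit vector `n` and numbers `α, γ` in `[1/D, D]`. -/
def IsRadial (A : Matrix (Fin 3) (Fin 3) ℝ) (D : ℝ) : Prop :=
  ∃ (α γ : ℝ) (n : R3), n 0 ^ 2 + n 1 ^ 2 + n 2 ^ 2 = 1 ∧ D⁻¹ ≤ α ∧ α ≤ D ∧ D⁻¹ ≤ γ ∧ γ ≤ D ∧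
    ∀ i k, A i k = (if i = k then α else 0) + (γ - α) * n i * n k

theorem exists_bound_of_pos {f : ℝ → ℝ} {R : Set ℝ} (hR : IsCompact R) (hf : ContinuousOn f R)
    (h0 : ∀ r ∈ R, 0 < f r) : ∃ D, 1 ≤ D ∧ ∀ r ∈ R, D⁻¹ ≤ f r ∧ f r ≤ D := by
  obtain ⟨C₁, h₁⟩ := hR.exists_bound_of_continuousOn hf
  obtain ⟨C₂, h₂⟩ := hR.exists_bound_of_continuousOn (hf.inv₀ fun r hr => (h0 r hr).ne')
  refine ⟨max 1 (max C₁ C₂), le_max_left _ _, fun r hr => ⟨?_, ?_⟩⟩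
  · rw [inv_le_comm₀ (by positivity) (h0 r hr)]
    exact (le_abs_self _).trans ((h₂ r hr).trans (by simp))
  · exact (le_abs_self _).trans ((h₁ r hr).trans (by simp))

theorem exists_bound_density {W : Mat3} (h : W.PosDef) : ∃ m M : ℝ, 0 < m ∧ 0 < M ∧ ∀ v : C3,
    m * ‖v‖ ^ 2 ≤ (density W v v).re ∧ (density W v v).re ≤ M * ‖v‖ ^ 2 := by
  have hpos : ∀ v : C3, v ≠ 0 → 0 < (density W v v).re := by
    intro v hv
    have h1 := (Matrix.posDef_iff_dotProduct_mulVec.1 h).2 (x := v.ofLp) (by simpa using hv)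
    have h3 : star v.ofLp ⬝ᵥ W.mulVec v.ofLp = density W v v := by
      rw [density_eq_inner, EuclideanSpace.inner_eq_star_dotProduct, dotProduct_comm]
      simp
    rw [h3] at h1
    exact (Complex.pos_iff.1 h1).1
  have hc : Continuous fun v : C3 => (density W v v).re := by
    simp only [density_eq_inner]
    exact Complex.continuous_re.comp (continuous_id.inner (op W).continuous)
  have hS : IsCompact (Metric.sphere (0 : C3) 1) := isCompact_sphere _ _
  have hne : (Metric.sphere (0 : C3) 1).Nonempty := NormedSpace.sphere_nonempty.2 zero_le_one
  obtain ⟨v₁, hv₁, h₁⟩ := hS.exists_isMinOn hne hc.continuousOn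
  obtain ⟨v₂, hv₂, h₂⟩ := hS.exists_isMaxOn hne hc.continuousOn
  have e₁ : v₁ ≠ 0 := by rintro rfl; simp at hv₁
  have e₂ : v₂ ≠ 0 := by rintro rfl; simp at hv₂
  refine ⟨_, _, hpos v₁ e₁, hpos v₂ e₂, fun v => ?_⟩
  by_cases hv : v = 0
  · subst hv; simp [density]
  have hn : 0 < ‖v‖ := norm_pos_iff.2 hv
  set u : C3 := ((‖v‖⁻¹ : ℝ) : ℂ) • v with hu
  have hu1 : u ∈ Metric.sphere (0 : C3) 1 := by
    simp [hu, norm_smul, hn.ne']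
  have hvu : v = ((‖v‖ : ℝ) : ℂ) • u := by
    rw [hu, smul_smul, ← Complex.ofReal_mul, mul_inv_cancel₀ hn.ne', Complex.ofReal_one, one_smul]
  have hd : (density W v v).re = ‖v‖ ^ 2 * (density W u u).re := by
    conv_lhs => rw [hvu]
    rw [density_eq_inner, map_smul, inner_smul_left, inner_smul_right, Complex.conj_ofReal,
      ← mul_assoc, ← Complex.ofReal_mul, Complex.re_ofReal_mul, ← density_eq_inner, sq]
  rw [hd, mul_comm _ (‖v‖ ^ 2), mul_comm _ (‖v‖ ^ 2)]
  have k₁ : (density W v₁ v₁).re ≤ (density W u u).re := h₁ hu1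
  have k₂ : (density W u u).re ≤ (density W v₂ v₂).re := h₂ hu1
  exact ⟨mul_le_mul_of_nonneg_left k₁ (by positivity),
    mul_le_mul_of_nonneg_left k₂ (by positivity)⟩

namespace IsRadial

variable {A : Matrix (Fin 3) (Fin 3) ℝ} {D : ℝ}

theorem mono (h : IsRadial A D) (hD : 1 ≤ D) {D' : ℝ} (h' : D ≤ D') : IsRadial A D' := by
  obtain ⟨α, γ, n, hn, h1, h2, h3, h4, h5⟩ := h
  have h6 : D'⁻¹ ≤ D⁻¹ := by gcongr
  exact ⟨α, γ, n, hn, h6.trans h1, h2.trans h', h6.trans h3, h4.trans h', h5⟩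

theorem det_bounds (h : IsRadial A D) (hD : 1 ≤ D) : D⁻¹ ^ 3 ≤ A.det ∧ A.det ≤ D ^ 3 := by
  obtain ⟨α, γ, n, hn, h1, h2, h3, h4, h5⟩ := h
  have hd : A.det = α ^ 2 * γ := by
    rw [Matrix.det_fin_three]
    simp only [h5]
    simp
    linear_combination (α ^ 2 * (γ - α)) * hn
  have hD0 : 0 < D⁻¹ := by positivity
  have hα : 0 < α := hD0.trans_le h1
  have hγ : 0 < γ := hD0.trans_le h3
  rw [hd, pow_succ, pow_succ D]
  exact ⟨by gcongr, by gcongr⟩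

theorem norm_bounds (h : IsRadial A D) (hD : 1 ≤ D) (v : C3) :
    D⁻¹ ^ 2 * ‖v‖ ^ 2 ≤ ‖op (A.map Complex.ofReal).transpose v‖ ^ 2 ∧
      ‖op (A.map Complex.ofReal).transpose v‖ ^ 2 ≤ D ^ 2 * ‖v‖ ^ 2 := by
  obtain ⟨α, γ, n, hn, h1, h2, h3, h4, h5⟩ := h
  have hD0 : 0 < D⁻¹ := by positivity
  have hα : 0 < α := hD0.trans_le h1
  have hγ : 0 < γ := hD0.trans_le h3
  set p := n 0 * (v 0).re + n 1 * (v 1).re + n 2 * (v 2).re with hp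
  set q := n 0 * (v 0).im + n 1 * (v 1).im + n 2 * (v 2).im with hq
  have hv : ‖v‖ ^ 2 = ((v 0).re ^ 2 + (v 1).re ^ 2 + (v 2).re ^ 2) +
      ((v 0).im ^ 2 + (v 1).im ^ 2 + (v 2).im ^ 2) := by
    rw [EuclideanSpace.norm_sq_eq, Fin.sum_univ_three]
    simp only [← Complex.normSq_eq_norm_sq, Complex.normSq_apply]
    ring
  have hAi : ∀ i, op (A.map Complex.ofReal).transpose v i = ∑ k, (A k i : ℂ) * v k := fun i => by
    simp [Matrix.mulVec, dotProduct]
  have hre : ∀ i, (op (A.map Complex.ofReal).transpose v i).re =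
      α * (v i).re + (γ - α) * n i * p := fun i => by
    rw [hAi, Fin.sum_univ_three, Complex.add_re, Complex.add_re, Complex.re_ofReal_mul,
      Complex.re_ofReal_mul, Complex.re_ofReal_mul, h5, h5, h5, hp]
    fin_cases i <;> simp <;> ring
  have him : ∀ i, (op (A.map Complex.ofReal).transpose v i).im =
      α * (v i).im + (γ - α) * n i * q := fun i => by
    rw [hAi, Fin.sum_univ_three, Complex.add_im, Complex.add_im, Complex.im_ofReal_mul,
      Complex.im_ofReal_mul, Complex.im_ofReal_mul, h5, h5, h5, hq]
    fin_cases i <;> simp <;> ring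
  have hAv : ‖op (A.map Complex.ofReal).transpose v‖ ^ 2 =
      α ^ 2 * ‖v‖ ^ 2 + (γ ^ 2 - α ^ 2) * (p ^ 2 + q ^ 2) := by
    rw [hv, EuclideanSpace.norm_sq_eq, Fin.sum_univ_three]
    simp only [← Complex.normSq_eq_norm_sq, Complex.normSq_apply, hre, him]
    have e1 : n 0 * (v 0).re + n 1 * (v 1).re + n 2 * (v 2).re = p := hp.symm
    have e2 : n 0 * (v 0).im + n 1 * (v 1).im + n 2 * (v 2).im = q := hq.symm
    clear_value p q
    linear_combination (2 * α * (γ - α) * p) * e1 + (2 * α * (γ - α) * q) * e2 + ((γ - α) ^ 2 * (p ^ 2 + q ^ 2)) * hn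
  have hcs : ∀ x y z : ℝ, (n 0 * x + n 1 * y + n 2 * z) ^ 2 ≤ x ^ 2 + y ^ 2 + z ^ 2 := by
    intro x y z
    have : x ^ 2 + y ^ 2 + z ^ 2 - (n 0 * x + n 1 * y + n 2 * z) ^ 2 =
        (n 0 * y - n 1 * x) ^ 2 + (n 0 * z - n 2 * x) ^ 2 + (n 1 * z - n 2 * y) ^ 2 := by
      linear_combination (-(x ^ 2 + y ^ 2 + z ^ 2)) * hn
    linarith [sq_nonneg (n 0 * y - n 1 * x), sq_nonneg (n 0 * z - n 2 * x),
      sq_nonneg (n 1 * z - n 2 * y)]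
  have hpq : p ^ 2 + q ^ 2 ≤ ‖v‖ ^ 2 := by
    rw [hv]; exact add_le_add (hcs _ _ _) (hcs _ _ _)
  have hpq0 : 0 ≤ p ^ 2 + q ^ 2 := by positivity
  have a1 : D⁻¹ ^ 2 ≤ α ^ 2 := by gcongr
  have a2 : α ^ 2 ≤ D ^ 2 := by gcongr
  have a3 : D⁻¹ ^ 2 ≤ γ ^ 2 := by gcongr
  have a4 : γ ^ 2 ≤ D ^ 2 := by gcongr
  rw [hAv]
  clear_value p q
  generalize p ^ 2 + q ^ 2 = s at *
  generalize ‖v‖ ^ 2 = t at *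
  constructor
  · nlinarith [mul_nonneg (sub_nonneg.2 a1) (sub_nonneg.2 hpq), mul_nonneg (sub_nonneg.2 a3) hpq0]
  · nlinarith [mul_nonneg (sub_nonneg.2 a2) (sub_nonneg.2 hpq), mul_nonneg (sub_nonneg.2 a4) hpq0]

theorem posDef (h : IsRadial A D) (hD : 1 ≤ D) {M₀ : Mat3} (hM : M₀.PosDef) :
    (A.det⁻¹ • (A.map Complex.ofReal * M₀ * (A.map Complex.ofReal).transpose)).PosDef := by
  have hd : 0 < A.det := lt_of_lt_of_le (by positivity) (h.det_bounds hD).1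
  have ht : (A.map Complex.ofReal).transpose = (A.map Complex.ofReal).conjTranspose := by
    ext i k; simp
  have hu : IsUnit (A.map Complex.ofReal) := by
    rw [Matrix.isUnit_iff_isUnit_det]
    have : (A.map Complex.ofReal).det = ((A.det : ℝ) : ℂ) :=
      (RingHom.map_det Complex.ofRealHom A).symm
    rw [this]
    exact (Complex.ofReal_ne_zero.2 hd.ne').isUnit
  rw [ht]
  exact (hM.mul_mul_conjTranspose_same (Matrix.vecMul_injective_of_isUnit hu)).smul
    (inv_pos.2 hd)

theorem density_transform (A : Matrix (Fin 3) (Fin 3) ℝ) (M₀ : Mat3) (v : C3) :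
    (density (A.det⁻¹ • (A.map Complex.ofReal * M₀ * (A.map Complex.ofReal).transpose)) v v).re =
      A.det⁻¹ * (density M₀ (op (A.map Complex.ofReal).transpose v)
        (op (A.map Complex.ofReal).transpose v)).re := by
  have ht : star (A.map Complex.ofReal).transpose = A.map Complex.ofReal := by
    rw [Matrix.star_eq_conjTranspose]; ext i k; simp
  have hs : op (A.map Complex.ofReal) =
      ContinuousLinearMap.adjoint (op (A.map Complex.ofReal).transpose) := by
    rw [← ContinuousLinearMap.star_eq_adjoint, ← map_star, ht]
  have h1 : A.det⁻¹ • (A.map Complex.ofReal * M₀ * (A.map Complex.ofReal).transpose) =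
      ((A.det⁻¹ : ℝ) : ℂ) • (A.map Complex.ofReal * M₀ * (A.map Complex.ofReal).transpose) := by
    ext i k; simp
  rw [h1, density_eq_inner, density_eq_inner, op, map_smul, map_mul, map_mul,
    smul_apply, inner_smul_right, Complex.re_ofReal_mul,
    mul_apply_eq_comp, mul_apply_eq_comp]
  rw [show Matrix.toEuclideanCLM (n := Fin 3) (𝕜 := ℂ) (A.map Complex.ofReal) = _ from hs,
    ContinuousLinearMap.adjoint_inner_right]

theorem density_bounds (h : IsRadial A D) (hD : 1 ≤ D) {M₀ : Mat3} {m M : ℝ} (hm : 0 < m)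
    (hM : 0 < M)
    (hb : ∀ v : C3, m * ‖v‖ ^ 2 ≤ (density M₀ v v).re ∧ (density M₀ v v).re ≤ M * ‖v‖ ^ 2)
    (v : C3) :
    (D⁻¹ ^ 3 * (m * D⁻¹ ^ 2)) * ‖v‖ ^ 2 ≤
      (density (A.det⁻¹ • (A.map Complex.ofReal * M₀ * (A.map Complex.ofReal).transpose)) v v).re ∧
    (density (A.det⁻¹ • (A.map Complex.ofReal * M₀ * (A.map Complex.ofReal).transpose)) v v).re ≤
      (D ^ 3 * (M * D ^ 2)) * ‖v‖ ^ 2 := by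
  have hD0 : 0 < D := by linarith
  obtain ⟨d1, d2⟩ := h.det_bounds hD
  have hd : 0 < A.det := lt_of_lt_of_le (by positivity) d1
  obtain ⟨n1, n2⟩ := h.norm_bounds hD v
  obtain ⟨b1, b2⟩ := hb (op (A.map Complex.ofReal).transpose v)
  have e1 : D⁻¹ ^ 3 ≤ A.det⁻¹ := by rw [inv_pow]; gcongr
  have e2 : A.det⁻¹ ≤ D ^ 3 := by
    rw [inv_le_comm₀ hd (by positivity), ← inv_pow]; exact d1
  rw [density_transform]
  constructor
  · rw [mul_assoc, mul_assoc]
    have : m * (D⁻¹ ^ 2 * ‖v‖ ^ 2) ≤ _ := (mul_le_mul_of_nonneg_left n1 hm.le).trans b1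
    exact mul_le_mul e1 this (by positivity) (by positivity)
  · rw [mul_assoc, mul_assoc]
    have h1 : _ ≤ M * (D ^ 2 * ‖v‖ ^ 2) := b2.trans (mul_le_mul_of_nonneg_left n2 hM.le)
    have h0 : 0 ≤ (density M₀ (op (A.map Complex.ofReal).transpose v)
        (op (A.map Complex.ofReal).transpose v)).re := le_trans (by positivity) b1
    exact mul_le_mul e2 h1 h0 (by positivity)

end IsRadial

namespace CloakGeometry

variable {N : ℕ} (G : CloakGeometry N)

theorem b_pos (j : Fin N) : 0 < G.b j := (G.a_pos j).trans (G.a_lt_b j)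

theorem eq_of_mem_ball {j l : Fin N} {y : R3} (h : y ∈ Metric.closedBall (G.c j) (G.b j))
    (h' : y ∈ Metric.closedBall (G.c l) (G.b l)) : j = l := by
  by_contra hne
  have h1 := dist_triangle_left (G.c j) (G.c l) y
  have h2 := G.separated j l hne
  rw [Metric.mem_closedBall] at h h'
  linarith

theorem map_of_mem {j : Fin N} {y : R3} (h : y ∈ Metric.closedBall (G.c j) (G.b j)) :
    G.map y = G.c j + (G.g j ‖y - G.c j‖ / ‖y - G.c j‖) • (y - G.c j) := by
  have hex : ∃ j, y ∈ Metric.closedBall (G.c j) (G.b j) := ⟨j, h⟩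
  have hj : hex.choose = j := G.eq_of_mem_ball hex.choose_spec h
  rw [map, dif_pos hex, hj]

theorem map_of_notMem {y : R3} (h : ∀ j, y ∉ Metric.closedBall (G.c j) (G.b j)) :
    G.map y = y := by
  rw [map, dif_neg (not_exists.2 h)]

theorem norm_mem {j : Fin N} {y : R3} (hy : y ∈ G.Ω₀)
    (h : y ∈ Metric.closedBall (G.c j) (G.b j)) : ‖y - G.c j‖ ∈ Ioc 0 (G.b j) :=
  ⟨norm_pos_iff.2 (sub_ne_zero.2 (hy j)), by rwa [Metric.mem_closedBall, dist_eq_norm] at h⟩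

theorem norm_map {j : Fin N} {y : R3} (hy : y ∈ G.Ω₀)
    (h : y ∈ Metric.closedBall (G.c j) (G.b j)) :
    ‖G.map y - G.c j‖ = G.g j ‖y - G.c j‖ := by
  have h1 := G.norm_mem hy h
  have h2 := ((G.cloaking j).mem_Ioc h1).1
  have h3 := G.a_pos j
  rw [G.map_of_mem h, add_sub_cancel_left, norm_smul, Real.norm_of_nonneg
    (div_nonneg (by linarith) h1.1.le), div_mul_cancel₀ _ h1.1.ne']

theorem map_mem_ball_iff {j : Fin N} {y : R3} (hy : y ∈ G.Ω₀) :
    G.map y ∈ Metric.closedBall (G.c j) (G.b j) ↔ y ∈ Metric.closedBall (G.c j) (G.b j) := by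
  have key : ∀ l, y ∈ Metric.closedBall (G.c l) (G.b l) →
      G.map y ∈ Metric.closedBall (G.c l) (G.b l) := fun l h => by
    rw [Metric.mem_closedBall, dist_eq_norm, G.norm_map hy h]
    exact ((G.cloaking l).mem_Ioc (G.norm_mem hy h)).2
  refine ⟨fun h => ?_, key j⟩
  by_cases hex : ∃ l, y ∈ Metric.closedBall (G.c l) (G.b l)
  · obtain ⟨l, hl⟩ := hex
    rwa [G.eq_of_mem_ball h (key l hl)]
  · rwa [G.map_of_notMem (not_exists.1 hex)] at h

theorem mem_Ω_iff {x : R3} : x ∈ G.Ω ↔ ∀ j, G.a j < ‖x - G.c j‖ := by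
  simp [Ω, K, dist_eq_norm]

theorem isOpen_Ω : IsOpen G.Ω :=
  (isClosed_iUnion_of_finite fun _ => Metric.isClosed_closedBall).isOpen_compl

theorem measurableSet_Ω₀ : MeasurableSet G.Ω₀ := by
  have : G.Ω₀ = (⋃ j, {G.c j})ᶜ := by ext; simp [Ω₀, eq_comm]
  rw [this]
  exact (MeasurableSet.iUnion fun _ => measurableSet_singleton _).compl

theorem injOn_map : InjOn G.map G.Ω₀ := by
  intro y hy z hz h
  by_cases hex : ∃ l, y ∈ Metric.closedBall (G.c l) (G.b l)
  · obtain ⟨l, hl⟩ := hex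
    have hl' := (G.map_mem_ball_iff hz).1 (h ▸ (G.map_mem_ball_iff hy).2 hl)
    have hn : G.g l ‖y - G.c l‖ = G.g l ‖z - G.c l‖ := by
      rw [← G.norm_map hy hl, ← G.norm_map hz hl', h]
    have hy1 := G.norm_mem hy hl
    have hn' := (G.cloaking l).strictMonoOn.injOn (Ioc_subset_Icc_self hy1)
      (Ioc_subset_Icc_self (G.norm_mem hz hl')) hn
    rw [G.map_of_mem hl, G.map_of_mem hl', ← hn'] at h
    have h0 : G.g l ‖y - G.c l‖ / ‖y - G.c l‖ ≠ 0 :=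
      (div_pos ((G.a_pos l).trans ((G.cloaking l).mem_Ioc hy1).1) hy1.1).ne'
    exact sub_left_injective (smul_right_injective R3 h0 (add_left_cancel h))
  · have h1 := not_exists.1 hex
    have h2 : ∀ l, z ∉ Metric.closedBall (G.c l) (G.b l) := fun l hl =>
      h1 l ((G.map_mem_ball_iff hy).1 (h ▸ (G.map_mem_ball_iff hz).2 hl))
    rwa [G.map_of_notMem h1, G.map_of_notMem h2] at h

theorem map_mem_Ω {y : R3} (hy : y ∈ G.Ω₀) : G.map y ∈ G.Ω := by
  rw [mem_Ω_iff]
  intro j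
  by_cases h : y ∈ Metric.closedBall (G.c j) (G.b j)
  · rw [G.norm_map hy h]
    exact ((G.cloaking j).mem_Ioc (G.norm_mem hy h)).1
  · rw [← G.map_mem_ball_iff hy, Metric.mem_closedBall, dist_eq_norm, not_le] at h
    exact (G.a_lt_b j).trans h

theorem exists_map_eq {x : R3} (hx : x ∈ G.Ω) : ∃ y ∈ G.Ω₀, G.map y = x := by
  rw [mem_Ω_iff] at hx
  by_cases hex : ∃ l, x ∈ Metric.closedBall (G.c l) (G.b l)
  · obtain ⟨l, hl⟩ := hex
    have hl' := hl
    rw [Metric.mem_closedBall, dist_eq_norm] at hl'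
    have hr : 0 < ‖x - G.c l‖ := (G.a_pos l).trans (hx l)
    have hiv := intermediate_value_Icc (G.b_pos l).le (G.cloaking l).continuousOn
    rw [(G.cloaking l).map_zero, (G.cloaking l).map_b] at hiv
    obtain ⟨ρ, hρ, hg⟩ := hiv ⟨(hx l).le, hl'⟩
    have hρ0 : 0 < ρ := by
      refine hρ.1.lt_of_ne fun h => ?_
      rw [← h, (G.cloaking l).map_zero] at hg
      exact (hx l).ne hg
    set y : R3 := G.c l + (ρ / ‖x - G.c l‖) • (x - G.c l) with hy
    have hyc : y - G.c l = (ρ / ‖x - G.c l‖) • (x - G.c l) := by rw [hy, add_sub_cancel_left]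
    have hyn : ‖y - G.c l‖ = ρ := by
      rw [hyc, norm_smul, Real.norm_of_nonneg (by positivity), div_mul_cancel₀ _ hr.ne']
    have hyb : y ∈ Metric.closedBall (G.c l) (G.b l) := by
      rw [Metric.mem_closedBall, dist_eq_norm, hyn]; exact hρ.2
    refine ⟨y, fun j hj => ?_, ?_⟩
    · have hjl : j = l := G.eq_of_mem_ball (y := y)
        (by rw [hj]; exact Metric.mem_closedBall_self (G.b_pos j).le) hyb
      subst hjl
      rw [hj, sub_self, norm_zero] at hyn
      exact hρ0.ne hyn
    · rw [G.map_of_mem hyb, hyn, hg, hyc, smul_smul, div_mul_div_cancel₀ hρ0.ne',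
        div_self hr.ne', one_smul, add_sub_cancel]
  · refine ⟨x, fun j hj => hex ⟨j, ?_⟩, G.map_of_notMem (not_exists.1 hex)⟩
    rw [hj]; exact Metric.mem_closedBall_self (G.b_pos j).le

theorem inv_mem {x : R3} (hx : x ∈ G.Ω) : G.inv x ∈ G.Ω₀ :=
  Function.invFunOn_mem (G.exists_map_eq hx)

theorem map_inv {x : R3} (hx : x ∈ G.Ω) : G.map (G.inv x) = x :=
  Function.invFunOn_eq (G.exists_map_eq hx)

theorem measurable_map : Measurable G.map := by
  classical
  let gE : Fin N → ℝ → ℝ := fun j => IccExtend (G.b_pos j).le ((Icc 0 (G.b j)).domRestrict (G.g j))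
  have hgE : ∀ j, Continuous (gE j) := fun j =>
    (G.cloaking j).continuousOn.domRestrict.Icc_extend'
  have heq : G.map = fun y => y + ∑ j, (Metric.closedBall (G.c j) (G.b j)).indicator
      (fun y => G.c j + (gE j ‖y - G.c j‖ / ‖y - G.c j‖) • (y - G.c j) - y) y := by
    funext y
    by_cases hex : ∃ l, y ∈ Metric.closedBall (G.c l) (G.b l)
    · obtain ⟨l, hl⟩ := hex
      rw [Finset.sum_eq_single l, Set.indicator_of_mem hl, G.map_of_mem hl]
      · have hm : ‖y - G.c l‖ ∈ Icc 0 (G.b l) :=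
          ⟨norm_nonneg _, by rwa [Metric.mem_closedBall, dist_eq_norm] at hl⟩
        have : gE l ‖y - G.c l‖ = G.g l ‖y - G.c l‖ := IccExtend_of_mem _ _ hm
        rw [this]; abel
      · intro j _ hj
        exact Set.indicator_of_notMem (fun h => hj (G.eq_of_mem_ball h hl)) _
      · intro h; exact absurd (Finset.mem_univ l) h
    · have h1 := not_exists.1 hex
      rw [G.map_of_notMem h1, Finset.sum_eq_zero, add_zero]
      exact fun j _ => Set.indicator_of_notMem (h1 j) _
  rw [heq]
  refine measurable_id.add (Finset.measurable_fun_sum _ fun j _ => ?_)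
  refine Measurable.indicator ?_ Metric.isClosed_closedBall.measurableSet
  have h1 : Measurable fun y : R3 => gE j ‖y - G.c j‖ :=
    ((hgE j).comp (by fun_prop : Continuous fun y : R3 => ‖y - G.c j‖)).measurable
  have h2 : Measurable fun y : R3 => ‖y - G.c j‖ := by fun_prop
  exact (((h1.div h2).smul (by fun_prop : Measurable fun y : R3 => y - G.c j)).const_add _).sub
    measurable_id

theorem aemeasurable_inv : AEMeasurable G.inv (volume.restrict G.Ω) := by
  refine aemeasurable_restrict_of_measurable_subtype G.isOpen_Ω.measurableSet ?_
  intro s hs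
  have himg : (fun x : G.Ω => G.inv x) ⁻¹' s = Subtype.val ⁻¹' (G.map '' (s ∩ G.Ω₀)) := by
    ext x
    simp only [Set.mem_preimage, Set.mem_image]
    constructor
    · intro h
      exact ⟨G.inv x, ⟨h, G.inv_mem x.2⟩, G.map_inv x.2⟩
    · rintro ⟨y, ⟨hy, hy0⟩, hyx⟩
      have : G.inv x = y := G.injOn_map (G.inv_mem x.2) hy0 ((G.map_inv x.2).trans hyx.symm)
      rwa [this]
  rw [himg]
  exact measurable_subtype_coe ((hs.inter G.measurableSet_Ω₀).image_of_measurable_injOn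
    G.measurable_map (G.injOn_map.mono Set.inter_subset_right))

theorem measurable_jacobian (l m : Fin 3) : Measurable fun y => G.jacobian y l m := by
  have h : Measurable fun y => fderiv ℝ G.map y (EuclideanSpace.single m 1) :=
    measurable_fderiv_apply_const ℝ G.map _
  exact (PiLp.continuous_apply 2 (fun _ : Fin 3 => ℝ) l).measurable.comp h

theorem aemeasurable_transform (M₀ : Mat3) (l m : Fin 3) :
    AEMeasurable (fun x => G.transform M₀ x l m) (volume.restrict G.Ω) := by
  have hJ := G.measurable_jacobian
  have hd : Measurable fun y => (G.jacobian y).det⁻¹ := by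
    simp only [Matrix.det_fin_three]
    fun_prop
  have h : Measurable fun y => ((G.jacobian y).det⁻¹ • ((G.jacobian y).map Complex.ofReal * M₀ *
      ((G.jacobian y).map Complex.ofReal).transpose)) l m := by
    simp only [Matrix.smul_apply, Matrix.mul_apply, Matrix.transpose_apply, Matrix.map_apply]
    fun_prop
  exact h.comp_aemeasurable G.aemeasurable_inv

theorem isRadial_of_notMem {y : R3} (h : ∀ j, y ∉ Metric.closedBall (G.c j) (G.b j)) :
    IsRadial (G.jacobian y) 1 := by
  have hopen : IsOpen (⋃ j, Metric.closedBall (G.c j) (G.b j))ᶜ :=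
    (isClosed_iUnion_of_finite fun _ => Metric.isClosed_closedBall).isOpen_compl
  have heq : G.map =ᶠ[nhds y] id := by
    filter_upwards [hopen.mem_nhds (by simpa using h)] with z hz
    exact G.map_of_notMem (by simpa using hz)
  refine ⟨1, 1, EuclideanSpace.single 0 1, by simp, by simp, le_rfl, by simp, le_rfl, ?_⟩
  intro i k
  simp [jacobian, heq.fderiv_eq]

theorem isRadial_of_mem {j : Fin N} {y : R3} (hy : y ∈ G.Ω₀)
    (h : y ∈ Metric.ball (G.c j) (G.b j)) {D : ℝ}
    (h1 : D⁻¹ ≤ G.g j ‖y - G.c j‖ / ‖y - G.c j‖) (h2 : G.g j ‖y - G.c j‖ / ‖y - G.c j‖ ≤ D)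
    (h3 : D⁻¹ ≤ derivWithin (G.g j) (Icc 0 (G.b j)) ‖y - G.c j‖)
    (h4 : derivWithin (G.g j) (Icc 0 (G.b j)) ‖y - G.c j‖ ≤ D) :
    IsRadial (G.jacobian y) D := by
  set ρ := ‖y - G.c j‖ with hρ
  set α := G.g j ρ / ρ with hα
  set γ := derivWithin (G.g j) (Icc 0 (G.b j)) ρ with hγ
  have hρ0 : 0 < ρ := norm_pos_iff.2 (sub_ne_zero.2 (hy j))
  have hρb : ρ < G.b j := by rwa [Metric.mem_ball, dist_eq_norm] at h
  have heq : G.map =ᶠ[nhds y]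
      fun z => G.c j + (G.g j ‖z - G.c j‖ / ‖z - G.c j‖) • (z - G.c j) := by
    filter_upwards [Metric.isOpen_ball.mem_nhds h] with z hz
    exact G.map_of_mem (Metric.ball_subset_closedBall hz)
  have hsub : HasFDerivAt (fun z : R3 => z - G.c j) (ContinuousLinearMap.id ℝ R3) y :=
    (hasFDerivAt_id y).sub_const _
  have hnorm : HasFDerivAt (fun z : R3 => ‖z - G.c j‖) (ρ⁻¹ • innerSL ℝ (y - G.c j)) y := by
    have h5 := hsub.norm_sq.sqrt (by positivity)
    simp only [Real.sqrt_sq (norm_nonneg _), ← hρ] at h5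
    refine h5.congr_fderiv ?_
    ext v
    simp [Real.sqrt_sq hρ0.le]
    field_simp
  have hg : HasDerivAt (fun r => G.g j r / r) ((γ * ρ - G.g j ρ * 1) / ρ ^ 2) ρ :=
    ((G.cloaking j).hasDerivAt ⟨hρ0, hρb⟩).div (hasDerivAt_id ρ) hρ0.ne'
  have hcomp := (hg.comp_hasFDerivAt y hnorm).smul hsub
  have hfd : fderiv ℝ G.map y = _ := heq.fderiv_eq.trans (hcomp.const_add (G.c j)).fderiv
  refine ⟨α, γ, ρ⁻¹ • (y - G.c j), ?_, h1, h2, h3, h4, ?_⟩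
  · have h6 : ρ ^ 2 = (y - G.c j) 0 ^ 2 + (y - G.c j) 1 ^ 2 + (y - G.c j) 2 ^ 2 := by
      rw [hρ, EuclideanSpace.norm_sq_eq, Fin.sum_univ_three]
      simp only [Real.norm_eq_abs, sq_abs]
    simp only [PiLp.smul_apply, smul_eq_mul, mul_pow]
    rw [← mul_add, ← mul_add, ← h6, ← mul_pow, inv_mul_cancel₀ hρ0.ne', one_pow]
  · intro i k
    simp only [jacobian, Matrix.of_apply, hfd]
    simp [← hρ, ← hα, EuclideanSpace.inner_single_right]
    rw [hα]
    field_simp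

/-- Almost every point of `Ω` lies on no sphere `|x - c j| = b j`. -/
theorem ae_regular : ∀ᵐ x ∂(volume : Measure R3), ∀ j, x ∉ Metric.sphere (G.c j) (G.b j) := by
  rw [ae_all_iff]
  intro j
  exact measure_eq_zero_iff_ae_notMem.1 (Measure.addHaar_sphere volume (G.c j) (G.b j))

theorem exists_radial {Q : Set R3} (hQ : IsCompact Q) (hQΩ : Q ⊆ G.Ω) :
    ∃ D : ℝ, 1 ≤ D ∧ ∀ x ∈ Q, (∀ j, x ∉ Metric.sphere (G.c j) (G.b j)) →
      IsRadial (G.jacobian (G.inv x)) D := by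
  have key : ∀ j, ∃ D : ℝ, 1 ≤ D ∧ ∀ x ∈ Q, x ∈ Metric.ball (G.c j) (G.b j) →
      IsRadial (G.jacobian (G.inv x)) D := by
    intro j
    set P : Set ℝ := (fun x => ‖x - G.c j‖) '' Q with hP
    have hPc : IsCompact P := hQ.image (by fun_prop)
    set R : Set ℝ := Icc 0 (G.b j) ∩ G.g j ⁻¹' P with hR
    have hRc : IsCompact R := isCompact_Icc.of_isClosed_subset
      ((G.cloaking j).continuousOn.preimage_isClosed_of_isClosed isClosed_Icc hPc.isClosed)
      Set.inter_subset_left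
    have hR0 : ∀ r ∈ R, r ∈ Ioc 0 (G.b j) := by
      rintro r ⟨hr, x, hx, hxr⟩
      refine ⟨hr.1.lt_of_ne fun h => ?_, hr.2⟩
      have h1 := G.mem_Ω_iff.1 (hQΩ hx) j
      rw [← h, (G.cloaking j).map_zero] at hxr
      exact h1.ne hxr.symm
    obtain ⟨D₁, hD₁, h₁⟩ := exists_bound_of_pos (f := fun r => G.g j r / r) hRc
      (((G.cloaking j).continuousOn.mono Set.inter_subset_left).div continuousOn_id
        fun r hr => (hR0 r hr).1.ne')
      fun r hr => div_pos ((G.a_pos j).trans ((G.cloaking j).mem_Ioc (hR0 r hr)).1) (hR0 r hr).1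
    obtain ⟨D₂, hD₂, h₂⟩ := exists_bound_of_pos (f := derivWithin (G.g j) (Icc 0 (G.b j))) hRc
      (((G.cloaking j).continuousOn_deriv (G.b_pos j)).mono Set.inter_subset_left)
      fun r hr => (G.cloaking j).deriv_pos r hr.1
    refine ⟨max D₁ D₂, hD₁.trans (le_max_left _ _), fun x hx hxb => ?_⟩
    have hy := G.inv_mem (hQΩ hx)
    have hm := G.map_inv (hQΩ hx)
    have hyb : G.inv x ∈ Metric.closedBall (G.c j) (G.b j) := by
      rw [← G.map_mem_ball_iff hy, hm]; exact Metric.ball_subset_closedBall hxb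
    have hn := G.norm_map hy hyb
    rw [hm] at hn
    have hnm := G.norm_mem hy hyb
    have hr : ‖G.inv x - G.c j‖ ∈ R := ⟨Ioc_subset_Icc_self hnm, x, hx, hn⟩
    have hyb' : G.inv x ∈ Metric.ball (G.c j) (G.b j) := by
      rw [Metric.mem_ball, dist_eq_norm]
      refine hnm.2.lt_of_ne fun h => ?_
      rw [h, (G.cloaking j).map_b] at hn
      rw [Metric.mem_ball, dist_eq_norm] at hxb
      exact hxb.ne hn
    have i₁ : (max D₁ D₂)⁻¹ ≤ D₁⁻¹ := by gcongr; exact le_max_left _ _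
    have i₂ : (max D₁ D₂)⁻¹ ≤ D₂⁻¹ := by gcongr; exact le_max_right _ _
    exact G.isRadial_of_mem hy hyb' (i₁.trans (h₁ _ hr).1) ((h₁ _ hr).2.trans (le_max_left _ _))
      (i₂.trans (h₂ _ hr).1) ((h₂ _ hr).2.trans (le_max_right _ _))
  choose D hD h using key
  have hpos : ∀ j, 0 ≤ D j := fun j => zero_le_one.trans (hD j)
  have h1D : 1 ≤ 1 + ∑ j, D j := le_add_of_nonneg_right (Finset.sum_nonneg fun j _ => hpos j)
  refine ⟨1 + ∑ j, D j, h1D, fun x hx hxs => ?_⟩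
  by_cases hex : ∃ j, x ∈ Metric.closedBall (G.c j) (G.b j)
  · obtain ⟨j, hj⟩ := hex
    have hb : x ∈ Metric.ball (G.c j) (G.b j) :=
      lt_of_le_of_ne hj fun h' => hxs j h'
    refine (h j x hx hb).mono (hD j) ?_
    have := Finset.single_le_sum (f := D) (fun i _ => hpos i) (Finset.mem_univ j)
    linarith
  · refine (G.isRadial_of_notMem fun j hj => hex ⟨j, ?_⟩).mono le_rfl h1D
    rwa [← G.map_mem_ball_iff (G.inv_mem (hQΩ hx)), G.map_inv (hQΩ hx)] at hj

/-- The transformed tensor as a weight on `Ω`. -/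
def exteriorWeight (M₀ : Mat3) (hM₀ : M₀.PosDef) : Weight G.Ω where
  mat := G.transform M₀
  aemeasurable := G.aemeasurable_transform M₀
  posDef := by
    filter_upwards [ae_restrict_of_ae G.ae_regular,
      ae_restrict_mem G.isOpen_Ω.measurableSet] with x hx hxΩ
    obtain ⟨D, hD, h⟩ := G.exists_radial (isCompact_singleton (x := x)) (by simpa using hxΩ)
    exact (h x rfl hx).posDef hD hM₀
  locBdd := by
    intro Q hQ hQΩ
    have hQΩ' := hQΩ.trans interior_subset
    obtain ⟨D, hD, h⟩ := G.exists_radial hQ hQΩ'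
    obtain ⟨m, M, hm, hM, hb⟩ := exists_bound_density hM₀
    refine ⟨D⁻¹ ^ 3 * (m * D⁻¹ ^ 2), D ^ 3 * (M * D ^ 2), by positivity, ?_⟩
    filter_upwards [ae_restrict_of_ae G.ae_regular,
      ae_restrict_mem hQ.measurableSet] with x hx hxQ
    exact (h x hxQ hx).density_bounds hD hm hM hb

end CloakGeometry

/-! ### Media inside the cloaked objects -/

/-- An admissible permittivity or permeability on a cloaked object `S`: a measurable field of
positive definite matrices with `M x ≤ C` on `S`, whose determinant is bounded below by a positive
constant on every compact subset of the interior of `S`. -/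
structure IsInteriorTensor (S : Set R3) (M : R3 → Mat3) : Prop where
  aemeasurable : ∀ i j, AEMeasurable (fun x => M x i j) (volume.restrict S)
  posDef : ∀ x ∈ S, (M x).PosDef
  bounded : ∃ C : ℝ, ∀ x ∈ S, ((C : ℂ) • (1 : Mat3) - M x).PosSemidef
  det_lower : ∀ Q : Set R3, IsCompact Q → Q ⊆ interior S →
    ∃ CQ : ℝ, 0 < CQ ∧ ∀ x ∈ Q, CQ < (M x).det.re

theorem density_nonneg {W : Mat3} (h : W.PosSemidef) (v : C3) : 0 ≤ (density W v v).re := by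
  have h1 := (Matrix.posSemidef_iff_dotProduct_mulVec.1 h).2 v.ofLp
  have h3 : star v.ofLp ⬝ᵥ W.mulVec v.ofLp = density W v v := by
    rw [density_eq_inner, EuclideanSpace.inner_eq_star_dotProduct, dotProduct_comm]
    simp
  rw [h3] at h1
  exact (Complex.nonneg_iff.1 h1).1

theorem density_sub (V W : Mat3) (v : C3) : density (V - W) v v = density V v v - density W v v := by
  simp only [density_eq_inner, op, map_sub, sub_apply, inner_sub_right]

theorem density_smul_one (r : ℝ) (v : C3) :
    (density ((r : ℂ) • (1 : Mat3)) v v).re = r * ‖v‖ ^ 2 := by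
  rw [density_eq_inner, op, map_smul, map_one, smul_apply, inner_smul_right,
    Complex.re_ofReal_mul, one_apply_eq_self, inner_self_eq_norm_sq_to_K]
  norm_cast

open scoped MatrixOrder in
/-- If `0 < W ≤ C` and `det W ≥ d > 0`, then `W ≥ d / C²`. -/
theorem density_lower {W : Mat3} (h : W.PosDef) {C d : ℝ} (hC : 0 < C)
    (hW : ((C : ℂ) • (1 : Mat3) - W).PosSemidef) (hd : d ≤ W.det.re) (v : C3) :
    d / C ^ 2 * ‖v‖ ^ 2 ≤ (density W v v).re := by
  have e : ∀ r : ℝ, algebraMap ℝ Mat3 r = (r : ℂ) • (1 : Mat3) := fun r => by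
    rw [Algebra.algebraMap_eq_smul_one]; ext i k; simp
  have hs := h.isHermitian.spectrum_real_eq_range_eigenvalues
  have hsa : IsSelfAdjoint W := h.isHermitian
  have hup : ∀ i, h.isHermitian.eigenvalues i ≤ C := by
    have h1 : W ≤ algebraMap ℝ Mat3 C := by rw [Matrix.le_iff, e]; exact hW
    intro i
    exact (le_algebraMap_iff_spectrum_le (p := IsSelfAdjoint) hsa).1 h1 _ (hs ▸ Set.mem_range_self i)
  have hpos : ∀ i, 0 < h.isHermitian.eigenvalues i := h.eigenvalues_pos
  have hdet : W.det.re = h.isHermitian.eigenvalues 0 * h.isHermitian.eigenvalues 1 *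
      h.isHermitian.eigenvalues 2 := by
    rw [h.isHermitian.det_eq_prod_eigenvalues, Fin.prod_univ_three]
    norm_cast
  have hlow : ∀ i, d / C ^ 2 ≤ h.isHermitian.eigenvalues i := by
    intro i
    rw [div_le_iff₀ (by positivity)]
    refine hd.trans ?_
    rw [hdet]
    have k : ∀ p q r : Fin 3, h.isHermitian.eigenvalues p * (h.isHermitian.eigenvalues q *
        h.isHermitian.eigenvalues r) ≤ h.isHermitian.eigenvalues p * C ^ 2 := fun p q r => by
      rw [sq]
      exact mul_le_mul_of_nonneg_left (mul_le_mul (hup q) (hup r) (hpos r).le hC.le) (hpos p).le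
    fin_cases i
    · exact (by ring_nf : _ = _).le.trans (k 0 1 2)
    · exact (by ring_nf : _ = _).le.trans (k 1 0 2)
    · exact (by ring_nf : _ = _).le.trans (k 2 0 1)
  have h2 : algebraMap ℝ Mat3 (d / C ^ 2) ≤ W := by
    rw [algebraMap_le_iff_le_spectrum (p := IsSelfAdjoint) hsa, hs]
    rintro _ ⟨i, rfl⟩
    exact hlow i
  rw [Matrix.le_iff, e] at h2
  have h3 := density_nonneg h2 v
  rw [density_sub, Complex.sub_re, density_smul_one] at h3
  linarith

/-- An admissible tensor as a weight. -/
def IsInteriorTensor.weight {S : Set R3} (hS : MeasurableSet S) {M : R3 → Mat3}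
    (h : IsInteriorTensor S M) : Weight S where
  mat := M
  aemeasurable := h.aemeasurable
  posDef := (ae_restrict_mem hS).mono h.posDef
  locBdd := by
    intro Q hQ hQS
    obtain ⟨C, hC⟩ := h.bounded
    obtain ⟨d, hd, hdet⟩ := h.det_lower Q hQ hQS
    refine ⟨d / (max C 1) ^ 2, C, by positivity, ?_⟩
    filter_upwards [ae_restrict_mem hQ.measurableSet] with x hx v
    have hxS := interior_subset (hQS hx)
    refine ⟨density_lower (h.posDef x hxS) (by positivity) ?_ (hdet x hx).le v, ?_⟩
    · have h1 : ((max C 1 : ℝ) : ℂ) • (1 : Mat3) - M x =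
          ((C : ℂ) • (1 : Mat3) - M x) + (((max C 1 - C : ℝ) : ℝ) : ℂ) • (1 : Mat3) := by
        push_cast; module
      rw [h1]
      refine (hC x hxS).add (Matrix.PosSemidef.one.smul ?_)
      exact Complex.zero_le_real.2 (sub_nonneg.2 (le_max_left _ _))
    · have h3 := density_nonneg (hC x hxS) v
      rw [density_sub, Complex.sub_re, density_smul_one] at h3
      linarith

/-! ### The whole system -/

/-- Spherical cloaks made of transformation media, obtained from a homogeneous medium with constant
permittivity `ε₀` and permeability `μ₀`, together with media `εK j`, `μK j` inside the cloaked
objects. -/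
structure CloakedSystem (N : ℕ) extends CloakGeometry N where
  ε₀ : Mat3
  μ₀ : Mat3
  ε₀_posDef : ε₀.PosDef
  μ₀_posDef : μ₀.PosDef
  εK : Fin N → R3 → Mat3
  μK : Fin N → R3 → Mat3
  εK_tensor : ∀ j, IsInteriorTensor (toCloakGeometry.K j) (εK j)
  μK_tensor : ∀ j, IsInteriorTensor (toCloakGeometry.K j) (μK j)

namespace CloakedSystem

variable {N : ℕ} (Y : CloakedSystem N)

theorem measurableSet_K (j : Fin N) : MeasurableSet (Y.K j) :=
  Metric.isClosed_closedBall.measurableSet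

/-- The permittivity in `Ω`. -/
def εΩ : Weight Y.Ω := Y.exteriorWeight Y.ε₀ Y.ε₀_posDef

/-- The permeability in `Ω`. -/
def μΩ : Weight Y.Ω := Y.exteriorWeight Y.μ₀ Y.μ₀_posDef

/-- The permittivity in the `j`-th cloaked object. -/
def εIn (j : Fin N) : Weight (Y.K j) := (Y.εK_tensor j).weight (Y.measurableSet_K j)

/-- The permeability in the `j`-th cloaked object. -/
def μIn (j : Fin N) : Weight (Y.K j) := (Y.μK_tensor j).weight (Y.measurableSet_K j)

/-- The Hilbert space of finite-energy fields in `Ω`. -/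
abbrev HΩ := Energy Y.εΩ Y.μΩ

/-- The Hilbert space of finite-energy fields in the cloaked objects. -/
abbrev HK := PiLp 2 fun j => Energy (Y.εIn j) (Y.μIn j)

/-- The Hilbert space of finite-energy fields in the whole of space. -/
abbrev H := WithLp 2 (Y.HΩ × Y.HK)

/-- The Maxwell operator in `Ω`, on `C¹` fields with compact support in `Ω`. -/
def aΩ : Y.HΩ →ₗ.[ℂ] Y.HΩ := maxwell Y.εΩ Y.μΩ

/-- The Maxwell operator in the cloaked objects, on `C¹` fields with compact support in their
interiors. -/
def aK : Y.HK →ₗ.[ℂ] Y.HK := bigOplus fun j => maxwell (Y.εIn j) (Y.μIn j)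

/-- The full Maxwell operator `a_Ω ⊕ a_K`. -/
def aFull : Y.H →ₗ.[ℂ] Y.H := oplus Y.aΩ Y.aK

end CloakedSystem

/-- `A` is a self-adjoint extension of `a`. -/
def IsSelfAdjointExtension {E : Type*} [NormedAddCommGroup E] [InnerProductSpace ℂ E]
    [CompleteSpace E] (a A : E →ₗ.[ℂ] E) : Prop :=
  IsSelfAdjoint A ∧ a ≤ A

end Cloaking

end

open Cloaking

/-!
The exterior operator `a_Ω` is essentially self-adjoint, and the rest is abstract: if the adjoint
`a_Ω†` is symmetric, it is the only self-adjoint extension of `a_Ω`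
(`isSelfAdjointExtension_adjoint`), and a self-adjoint extension `A` of `a_Ω ⊕ a_K` acts on first
components by `a_Ω†` and contains `a_Ω† ⊕ 0`, hence is `a_Ω† ⊕ A_K` with a self-adjoint `A_K`
(`exists_eq_oplus`). By `adjoint_isFormalAdjoint_self`, the adjoint is symmetric once the
deficiency spaces are trivial, that is, once `a_Ω† (E, H) = ± i (E, H)` implies `(E, H) = 0`.

Such a pair solves `∇ × H = s ε E` and `∇ × E = -s μ H` weakly in `Ω`, with `s = ± 1`. Pulled back as
one-forms under the transformation `f : Ω₀ → Ω`, the fields solve the same equations with the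
constant tensors `ε₀` and `μ₀`, and their energy is unchanged; in particular they are square
integrable over `ℝ³` (`CloakGeometry.memLp_pullback`). Three points need an argument.

* `f` is not differentiable at the spheres `|y - c j| = b j`, so a test field on `Ω₀` does not
  transform to a `C¹` test field on `Ω`. The inverse of `f` is replaced by the identity near the
  spheres; since it differs from the identity there by the order of the distance to the sphere, these
  smooth approximations have bounded derivatives, and dominated convergence gives the equations in
  `Ω₀` (`HasWeakCurl.comp_map`).
* The equations hold in `Ω₀`, the complement of finitely many points, with no condition imposed at
  these points. But a cutoff at scale `δ` has a gradient of order `δ⁻¹` on a set of volume of order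
  `δ³`, so that points are negligible for square integrable fields
  (`CloakGeometry.hasWeakCurl_univ`).
* In the whole space, mollification reduces to smooth square integrable solutions, for which
  integration by parts yields `s ∫ (⟨E, ε₀ E⟩ + ⟨H, μ₀ H⟩) = 0` (`HasWeakCurl.ae_eq_zero`).
-/

noncomputable section

open MeasureTheory Set
open scoped ENNReal ComplexOrder ComplexConjugate

namespace Cloaking

/-! ### Symmetric operators with trivial deficiency spaces -/

section Abstract

open Filter Topology

open scoped LinearPMap

variable {E : Type*} [NormedAddCommGroup E] [InnerProductSpace ℂ E]

variable {F : Type*} [NormedAddCommGroup F] [InnerProductSpace ℂ F]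

/-- The part of an operator in `E ⊕ F` that lives on the second summand. -/
def sndPart (A : WithLp 2 (E × F) →ₗ.[ℂ] WithLp 2 (E × F)) : F →ₗ.[ℂ] F where
  domain := A.domain.comap ((WithLp.linearEquiv 2 ℂ (E × F)).symm.toLinearMap ∘ₗ
    LinearMap.inr ℂ E F)
  toFun := LinearMap.snd ℂ E F ∘ₗ (WithLp.linearEquiv 2 ℂ (E × F)).toLinearMap ∘ₗ A.toFun ∘ₗ
    LinearMap.restrict ((WithLp.linearEquiv 2 ℂ (E × F)).symm.toLinearMap ∘ₗ
      LinearMap.inr ℂ E F) (fun _ h => h)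

theorem sndPart_apply (A : WithLp 2 (E × F) →ₗ.[ℂ] WithLp 2 (E × F)) (v : (sndPart A).domain) :
    sndPart A v = (A ⟨WithLp.toLp 2 (0, (v : F)), v.2⟩).snd := rfl

theorem norm_apply_add_I_smul_sq {a : E →ₗ.[ℂ] E} (hs : a.IsFormalAdjoint a) (v : a.domain) :
    ‖a v + Complex.I • (v : E)‖ ^ 2 = ‖a v‖ ^ 2 + ‖(v : E)‖ ^ 2 := by
  have h : (inner ℂ (a v) (v : E)).im = 0 := by
    have h1 := hs v v
    rw [← inner_conj_symm (v : E)] at h1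
    exact Complex.conj_eq_iff_im.1 h1.symm
  rw [@norm_add_sq ℂ, inner_smul_right, norm_smul]
  simp [h]

variable [CompleteSpace E]

/-- If `ker (a† - i)` is trivial, the range of `a + i` is dense. -/
theorem dense_range_add_I {a : E →ₗ.[ℂ] E} (hd : Dense (a.domain : Set E))
    (h : ∀ u : a†.domain, a† u = Complex.I • (u : E) → (u : E) = 0) :
    Dense (LinearMap.range (a.toFun + Complex.I • a.domain.subtype) : Set E) := by
  rw [Submodule.dense_iff_topologicalClosure_eq_top, Submodule.topologicalClosure_eq_top_iff,
    Submodule.eq_bot_iff]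
  intro w hw
  have h1 : ∀ v : a.domain, inner ℂ (Complex.I • w) (v : E) = inner ℂ w (a v) := fun v => by
    have h2 := (Submodule.mem_orthogonal' _ _).1 hw _ ⟨v, rfl⟩
    change inner ℂ w (a v + Complex.I • (v : E)) = 0 at h2
    rw [inner_add_right, inner_smul_right] at h2
    rw [inner_smul_left, Complex.conj_I]
    linear_combination -h2
  exact h ⟨w, a.mem_adjoint_domain_of_exists w ⟨_, h1⟩⟩ (LinearPMap.adjoint_apply_eq hd _ h1)

/-- If both deficiency spaces of a symmetric operator `a` are trivial, the graph of `a†` lies in the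
closure of the graph of `a`: approximate `(a† + i) u` by elements `(a + i) v n`, which
`norm_apply_add_I_smul_sq` forces to converge separately. -/
theorem exists_seq_tendsto_adjoint {a : E →ₗ.[ℂ] E} (hd : Dense (a.domain : Set E))
    (hs : a.IsFormalAdjoint a)
    (hp : ∀ u : a†.domain, a† u = Complex.I • (u : E) → (u : E) = 0)
    (hm : ∀ u : a†.domain, a† u = -Complex.I • (u : E) → (u : E) = 0) (u : a†.domain) :
    ∃ v : ℕ → a.domain, Tendsto (fun n => (v n : E)) atTop (𝓝 u) ∧
      Tendsto (fun n => a (v n)) atTop (𝓝 (a† u)) := by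
  obtain ⟨w, hw, hwl⟩ := mem_closure_iff_seq_limit.1
    (dense_range_add_I hd hp (a† u + Complex.I • (u : E)))
  choose v hv using hw
  have hv' : ∀ n, w n = a (v n) + Complex.I • (v n : E) := fun n => (hv n).symm
  have hle : ∀ n m, dist (v n : E) (v m) ≤ dist (w n) (w m) := fun n m => by
    have h1 := norm_apply_add_I_smul_sq hs (v n - v m)
    have h2 : w n - w m = a (v n - v m) + Complex.I • ((v n - v m : a.domain) : E) := by
      rw [hv', hv', LinearPMap.map_sub, Submodule.coe_sub]; module
    rw [dist_eq_norm, dist_eq_norm, h2]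
    refine le_of_sq_le_sq ?_ (norm_nonneg _)
    rw [h1]
    exact le_add_of_nonneg_left (sq_nonneg _)
  have hc : CauchySeq fun n => (v n : E) := by
    rw [Metric.cauchySeq_iff]
    intro ε hε
    obtain ⟨K, hK⟩ := Metric.cauchySeq_iff.1 hwl.cauchySeq ε hε
    exact ⟨K, fun m hm n hn => (hle m n).trans_lt (hK m hm n hn)⟩
  obtain ⟨x, hx⟩ := cauchySeq_tendsto_of_complete hc
  have ha : Tendsto (fun n => a (v n)) atTop (𝓝 (a† u + Complex.I • (u : E) - Complex.I • x)) := by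
    have := hwl.sub (hx.const_smul Complex.I)
    refine this.congr fun n => ?_
    rw [hv']; abel
  have h1 : ∀ y : a.domain,
      inner ℂ (a† u + Complex.I • (u : E) - Complex.I • x) (y : E) = inner ℂ x (a y) := fun y =>
    tendsto_nhds_unique (ha.inner tendsto_const_nhds)
      ((hx.inner tendsto_const_nhds).congr fun n => (hs _ _).symm)
  set x' : a†.domain := ⟨x, a.mem_adjoint_domain_of_exists x ⟨_, h1⟩⟩ with hx'
  have h2 : a† x' = a† u + Complex.I • (u : E) - Complex.I • x :=
    LinearPMap.adjoint_apply_eq hd x' h1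
  have h3 := hm (u - x') (by
    rw [LinearPMap.map_sub, h2, Submodule.coe_sub]
    module)
  have h4 : (u : E) = x := sub_eq_zero.1 h3
  rw [← h4] at hx ha
  exact ⟨v, hx, by simpa using ha⟩

/-- A symmetric operator with trivial deficiency spaces has a symmetric adjoint. -/
theorem adjoint_isFormalAdjoint_self {a : E →ₗ.[ℂ] E} (hd : Dense (a.domain : Set E))
    (hs : a.IsFormalAdjoint a)
    (hp : ∀ u : a†.domain, a† u = Complex.I • (u : E) → (u : E) = 0)
    (hm : ∀ u : a†.domain, a† u = -Complex.I • (u : E) → (u : E) = 0) :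
    a†.IsFormalAdjoint a† := fun u w => by
  obtain ⟨v, h1, h2⟩ := exists_seq_tendsto_adjoint hd hs hp hm u
  exact tendsto_nhds_unique (h2.inner tendsto_const_nhds)
    ((h1.inner tendsto_const_nhds).congr fun n =>
      ((LinearPMap.adjoint_isFormalAdjoint hd).symm _ _).symm)

theorem adjoint_le_adjoint {a b : E →ₗ.[ℂ] E} (hd : Dense (a.domain : Set E)) (h : a ≤ b) :
    b† ≤ a† := by
  have hdb : Dense (b.domain : Set E) := hd.mono h.1
  refine LinearPMap.IsFormalAdjoint.le_adjoint hd fun x y => ?_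
  rw [h.2 (y := ⟨x, h.1 x.2⟩) rfl]
  exact (LinearPMap.adjoint_isFormalAdjoint hdb).symm ⟨x, h.1 x.2⟩ y

/-- If `a` and `a†` are symmetric, then `a†` is the only self-adjoint extension of `a`. -/
theorem isSelfAdjointExtension_adjoint {a : E →ₗ.[ℂ] E} (hd : Dense (a.domain : Set E))
    (hs : a.IsFormalAdjoint a) (hs' : a†.IsFormalAdjoint a†) :
    IsSelfAdjointExtension a a† ∧ ∀ b : E →ₗ.[ℂ] E, IsSelfAdjointExtension a b → b = a† := by
  have hle : a ≤ a† := hs.le_adjoint hd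
  have hd' : Dense (a†.domain : Set E) := hd.mono hle.1
  have h1 : a†† = a† := le_antisymm (adjoint_le_adjoint hd hle) (hs'.le_adjoint hd')
  refine ⟨⟨h1, hle⟩, fun b hb => ?_⟩
  have h2 : b† = b := hb.1
  have h3 : b ≤ a† := h2 ▸ adjoint_le_adjoint hd hb.2
  refine le_antisymm h3 ?_
  have h4 := adjoint_le_adjoint (hd.mono hb.2.1) h3
  rwa [h1, h2] at h4

variable [CompleteSpace F]

/-- If `a` is essentially self-adjoint, every self-adjoint extension `A` of `a ⊕ b` splits: the first
component of `A u` is `a† u.fst`, and `A` contains `a† ⊕ 0`. -/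
theorem exists_eq_oplus {a : E →ₗ.[ℂ] E} {b : F →ₗ.[ℂ] F} (hd : Dense (a.domain : Set E))
    (hs' : a†.IsFormalAdjoint a†) {A : WithLp 2 (E × F) →ₗ.[ℂ] WithLp 2 (E × F)}
    (hA : IsSelfAdjointExtension (oplus a b) A) :
    ∃ B : F →ₗ.[ℂ] F, IsSelfAdjointExtension b B ∧ A = oplus a† B := by
  have hAd : Dense (A.domain : Set (WithLp 2 (E × F))) := hA.1.dense_domain
  have hAA : A† = A := hA.1
  have hAs : A.IsFormalAdjoint A := by
    have := LinearPMap.adjoint_isFormalAdjoint hAd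
    rwa [hAA] at this
  have hmem : ∀ u w, (∀ v : A.domain, inner ℂ w (v : WithLp 2 (E × F)) = inner ℂ u (A v)) →
      ∃ h : u ∈ A.domain, A ⟨u, h⟩ = w := fun u w h => by
    have h1 : u ∈ A†.domain := A.mem_adjoint_domain_of_exists u ⟨w, h⟩
    have h2 := LinearPMap.adjoint_apply_eq hAd ⟨u, h1⟩ h
    have h3 : A† ≤ A := hAA.le
    exact ⟨h3.1 h1, (h3.2 (x := ⟨u, h1⟩) rfl).symm.trans h2⟩
  -- the first component of `A u` is `a† u.fst`
  have hfst : ∀ u : A.domain, ∃ h : (u : WithLp 2 (E × F)).fst ∈ a†.domain,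
      a† ⟨_, h⟩ = (A u).fst := fun u => by
    have h1 : ∀ x : a.domain, inner ℂ (A u).fst (x : E) =
        inner ℂ (u : WithLp 2 (E × F)).fst (a x) := fun x => by
      have hx : WithLp.toLp 2 ((x : E), (0 : F)) ∈ (oplus a b).domain := ⟨x.2, b.domain.zero_mem⟩
      have h2 := hAs u ⟨_, hA.2.1 hx⟩
      rw [← hA.2.2 (x := ⟨_, hx⟩) (y := ⟨_, hA.2.1 hx⟩) rfl] at h2
      have h3 : oplus a b ⟨_, hx⟩ = WithLp.toLp 2 (a x, 0) := by
        change WithLp.toLp 2 (a ⟨x, _⟩, b ⟨0, _⟩) = _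
        have h4 : b ⟨0, b.domain.zero_mem⟩ = 0 := LinearPMap.map_zero b
        rw [h4]
      rw [h3] at h2
      simpa [WithLp.prod_inner_apply] using h2
    exact ⟨a.mem_adjoint_domain_of_exists _ ⟨_, h1⟩, LinearPMap.adjoint_apply_eq hd _ h1⟩
  -- `A` extends `a† ⊕ 0`
  have hinl : ∀ x : a†.domain, ∃ h : WithLp.toLp 2 ((x : E), (0 : F)) ∈ A.domain,
      A ⟨_, h⟩ = WithLp.toLp 2 (a† x, 0) := fun x => by
    refine hmem _ _ fun v => ?_
    obtain ⟨h1, h2⟩ := hfst v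
    have h3 := hs' x ⟨_, h1⟩
    rw [h2] at h3
    simpa [WithLp.prod_inner_apply] using h3
  have hinr : ∀ u : A.domain, WithLp.toLp 2 ((0 : E), (u : WithLp 2 (E × F)).snd) ∈ A.domain :=
    fun u => by
    obtain ⟨h1, -⟩ := hfst u
    obtain ⟨h2, -⟩ := hinl ⟨_, h1⟩
    have h3 := A.domain.sub_mem u.2 h2
    convert h3 using 1
    refine (WithLp.equiv 2 (E × F)).injective (Prod.ext ?_ ?_) <;> simp
  have happ : ∀ (x : a†.domain) (y : (sndPart A).domain),
      ∃ h : WithLp.toLp 2 ((x : E), (y : F)) ∈ A.domain,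
        A ⟨_, h⟩ = WithLp.toLp 2 (a† x, sndPart A y) := fun x y => by
    obtain ⟨h1, h2⟩ := hinl x
    have h3 : WithLp.toLp 2 ((0 : E), (y : F)) ∈ A.domain := y.2
    have h4 : WithLp.toLp 2 ((x : E), (y : F)) =
        WithLp.toLp 2 ((x : E), (0 : F)) + WithLp.toLp 2 ((0 : E), (y : F)) := by
      rw [← WithLp.toLp_add, Prod.mk_add_mk, add_zero, zero_add]
    refine ⟨h4 ▸ A.domain.add_mem h1 h3, ?_⟩
    have h5 : A ⟨_, h4 ▸ A.domain.add_mem h1 h3⟩ = A ⟨_, h1⟩ + A ⟨_, h3⟩ := by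
      rw [← LinearPMap.map_add]
      congr 1
      exact Subtype.ext h4
    obtain ⟨h6, h7⟩ := hfst ⟨_, h3⟩
    have h8 : a† ⟨_, h6⟩ = 0 := LinearPMap.map_zero a†
    rw [h5, h2]
    refine (WithLp.equiv 2 (E × F)).injective (Prod.ext ?_ ?_)
    · simpa [← h7] using h8
    · simp [sndPart_apply]
  have heq : A = oplus a† (sndPart A) := by
    refine LinearPMap.ext (Submodule.ext fun u =>
      ⟨fun hu => ⟨(hfst ⟨u, hu⟩).1, hinr ⟨u, hu⟩⟩, fun hu => (happ ⟨_, hu.1⟩ ⟨_, hu.2⟩).1⟩) ?_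
    intro u _ hu'
    exact (happ ⟨_, hu'.1⟩ ⟨_, hu'.2⟩).2
  have hBd : Dense ((sndPart A).domain : Set F) := by
    have h1 : DenseRange fun u : WithLp 2 (E × F) => u.snd :=
      Function.Surjective.denseRange fun y => ⟨WithLp.toLp 2 (0, y), rfl⟩
    have hcont : Continuous fun u : WithLp 2 (E × F) => u.snd :=
      continuous_snd.comp (WithLp.prod_continuous_ofLp 2 E F)
    refine (h1.dense_image hcont hAd).mono ?_
    rintro _ ⟨u, hu, rfl⟩
    exact hinr ⟨u, hu⟩
  have hBs : (sndPart A).IsFormalAdjoint (sndPart A) := fun x y => by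
    have h := hAs ⟨_, x.2⟩ ⟨_, y.2⟩
    rw [sndPart_apply, sndPart_apply]
    simpa [WithLp.prod_inner_apply] using h
  have hle : (sndPart A)† ≤ sndPart A := by
    refine ⟨fun y hy => ?_, fun y z hyz => ?_⟩
    · refine (hmem (WithLp.toLp 2 (0, y)) (WithLp.toLp 2 (0, (sndPart A)† ⟨y, hy⟩)) fun v => ?_).1
      have h1 := LinearPMap.adjoint_isFormalAdjoint hBd ⟨y, hy⟩ ⟨_, hinr v⟩
      have h2 : (A v).snd = sndPart A ⟨_, hinr v⟩ := by
        obtain ⟨h3, h4⟩ := happ ⟨_, (hfst v).1⟩ ⟨_, hinr v⟩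
        have h5 : A v = _ := h4
        have h6 := congrArg WithLp.snd h5
        exact h6
      rw [WithLp.prod_inner_apply, WithLp.prod_inner_apply, inner_zero_left, inner_zero_left,
        zero_add, zero_add]
      exact h1.trans (congrArg (inner ℂ y) h2.symm)
    · have h1 : ∀ x : (sndPart A).domain, inner ℂ (sndPart A z) (x : F) =
          inner ℂ (y : F) (sndPart A x) := fun x => by rw [hBs, hyz]
      exact LinearPMap.adjoint_apply_eq hBd _ h1
  refine ⟨sndPart A, ⟨le_antisymm hle (hBs.le_adjoint hBd), fun y hy => ?_, ?_⟩, heq⟩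
  · exact hA.2.1 (x := WithLp.toLp 2 (0, y)) ⟨a.domain.zero_mem, hy⟩
  · intro y z hyz
    have hx : WithLp.toLp 2 ((0 : E), (y : F)) ∈ (oplus a b).domain := ⟨a.domain.zero_mem, y.2⟩
    have h1 := hA.2.2 (x := ⟨_, hx⟩) (y := ⟨_, hA.2.1 hx⟩) rfl
    have h2 : b y = (oplus a b ⟨_, hx⟩).snd := rfl
    rw [h2, h1, sndPart_apply]
    congr 2
    exact Subtype.ext (congrArg (fun t : F => WithLp.toLp 2 ((0 : E), t)) hyz)

end Abstract

/-! ### Integration by parts for the curl -/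

section CurlParts

theorem inner_C3 (v w : C3) :
    inner ℂ v w = conj (v 0) * w 0 + conj (v 1) * w 1 + conj (v 2) * w 2 := by
  rw [PiLp.inner_apply, Fin.sum_univ_three]
  simp only [RCLike.inner_apply, mul_comm]

theorem continuous_partialDeriv {φ : R3 → C3} (hφ : ContDiff ℝ 1 φ) (k l : Fin 3) :
    Continuous (partialDeriv φ k l) :=
  (PiLp.continuous_apply 2 (fun _ : Fin 3 => ℂ) l).comp
    ((hφ.continuous_fderiv one_ne_zero).clm_apply continuous_const)

theorem continuous_coord {φ : R3 → C3} (hφ : Continuous φ) (l : Fin 3) :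
    Continuous fun x => φ x l :=
  (PiLp.continuous_apply 2 (fun _ : Fin 3 => ℂ) l).comp hφ

theorem continuous_curl_of_contDiff {φ : R3 → C3} (hφ : ContDiff ℝ 1 φ) : Continuous (curl φ) := by
  refine (PiLp.continuous_toLp 2 _).comp (continuous_pi fun i => ?_)
  have h := continuous_partialDeriv hφ
  fin_cases i
  · exact (h 1 2).sub (h 2 1)
  · exact (h 2 0).sub (h 0 2)
  · exact (h 0 1).sub (h 1 0)

/-- The real bilinear form `(v, w) ↦ conj (v l) * w m` on `ℂ³`. -/
def conjCoordMul (l m : Fin 3) : C3 →L[ℝ] C3 →L[ℝ] ℂ :=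
  (ContinuousLinearMap.mul ℝ ℂ).bilinearComp
    (Complex.conjCLE.toContinuousLinearMap ∘L
      (EuclideanSpace.proj l : C3 →L[ℂ] ℂ).restrictScalars ℝ)
    ((EuclideanSpace.proj m : C3 →L[ℂ] ℂ).restrictScalars ℝ)

theorem conjCoordMul_apply (l m : Fin 3) (v w : C3) : conjCoordMul l m v w = conj (v l) * w m := rfl

variable {φ U : R3 → C3}

theorem integrable_conj_mul_left (hφ : Continuous φ) (hc : HasCompactSupport φ) {u : R3 → ℂ}
    (hu : Continuous u) (l : Fin 3) : Integrable fun x => conj (φ x l) * u x := by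
  refine Continuous.integrable_of_hasCompactSupport
    ((Complex.continuous_conj.comp (continuous_coord hφ l)).mul hu) ?_
  refine hc.mono fun x hx h => hx ?_
  simp only [h, PiLp.zero_apply, map_zero, zero_mul]

theorem integrable_conj_partialDeriv_mul (hφ : ContDiff ℝ 1 φ) (hc : HasCompactSupport φ)
    {u : R3 → ℂ} (hu : Continuous u) (k l : Fin 3) :
    Integrable fun x => conj (partialDeriv φ k l x) * u x := by
  refine Continuous.integrable_of_hasCompactSupport
    ((Complex.continuous_conj.comp (continuous_partialDeriv hφ k l)).mul hu) ?_
  refine hc.mono' fun x hx => ?_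
  by_contra h
  refine hx ?_
  simp only [partialDeriv, fderiv_of_notMem_tsupport ℝ h, zero_apply, PiLp.zero_apply, map_zero,
    zero_mul]

theorem integral_conj_partialDeriv_mul (hφ : ContDiff ℝ 1 φ) (hc : HasCompactSupport φ)
    (hU : ContDiff ℝ 1 U) (k l m : Fin 3) :
    ∫ x, conj (partialDeriv φ k l x) * U x m = -∫ x, conj (φ x l) * partialDeriv U k m x := by
  have h := integral_bilinear_fderiv_right_eq_neg_left_of_integrable (μ := (volume : Measure R3))
    (f := φ) (g := U) (v := EuclideanSpace.single k 1) (B := conjCoordMul l m)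
    (integrable_conj_partialDeriv_mul hφ hc (continuous_coord hU.continuous m) k l)
    (integrable_conj_mul_left hφ.continuous hc (continuous_partialDeriv hU k m) l)
    (integrable_conj_mul_left hφ.continuous hc (continuous_coord hU.continuous m) l)
    (fun x _ => hφ.differentiable one_ne_zero x) (fun x _ => hU.differentiable one_ne_zero x)
  simp only [conjCoordMul_apply] at h
  rw [eq_neg_iff_add_eq_zero, add_comm, ← eq_neg_iff_add_eq_zero]
  exact h

/-- The curl is a symmetric operator. -/
theorem integral_inner_curl (hφ : ContDiff ℝ 1 φ) (hc : HasCompactSupport φ)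
    (hU : ContDiff ℝ 1 U) :
    ∫ x, inner ℂ (curl φ x) (U x) = ∫ x, inner ℂ (φ x) (curl U x) := by
  have i1 : ∀ k l m, Integrable fun x => conj (partialDeriv φ k l x) * U x m := fun k l m =>
    integrable_conj_partialDeriv_mul hφ hc (continuous_coord hU.continuous m) k l
  have i2 : ∀ k l m, Integrable fun x => conj (φ x l) * partialDeriv U k m x := fun k l m =>
    integrable_conj_mul_left hφ.continuous hc (continuous_partialDeriv hU k m) l
  have e1 : ∀ x, inner ℂ (curl φ x) (U x) =
      (conj (partialDeriv φ 1 2 x) * U x 0 - conj (partialDeriv φ 2 1 x) * U x 0) +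
      (conj (partialDeriv φ 2 0 x) * U x 1 - conj (partialDeriv φ 0 2 x) * U x 1) +
      (conj (partialDeriv φ 0 1 x) * U x 2 - conj (partialDeriv φ 1 0 x) * U x 2) := fun x => by
    rw [inner_C3]; simp [curl]; ring
  have e2 : ∀ x, inner ℂ (φ x) (curl U x) =
      (conj (φ x 0) * partialDeriv U 1 2 x - conj (φ x 0) * partialDeriv U 2 1 x) +
      (conj (φ x 1) * partialDeriv U 2 0 x - conj (φ x 1) * partialDeriv U 0 2 x) +
      (conj (φ x 2) * partialDeriv U 0 1 x - conj (φ x 2) * partialDeriv U 1 0 x) := fun x => by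
    rw [inner_C3]; simp [curl]; ring
  simp only [e1, e2]
  have hsum : ∀ {f₁ f₂ f₃ f₄ f₅ f₆ : R3 → ℂ}, Integrable f₁ → Integrable f₂ → Integrable f₃ →
      Integrable f₄ → Integrable f₅ → Integrable f₆ →
      ∫ x, ((f₁ x - f₂ x) + (f₃ x - f₄ x) + (f₅ x - f₆ x)) =
        ((∫ x, f₁ x) - ∫ x, f₂ x) + ((∫ x, f₃ x) - ∫ x, f₄ x) + ((∫ x, f₅ x) - ∫ x, f₆ x) := by
    intro f₁ f₂ f₃ f₄ f₅ f₆ h₁ h₂ h₃ h₄ h₅ h₆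
    rw [← integral_sub h₁ h₂, ← integral_sub h₃ h₄, ← integral_sub h₅ h₆]
    exact (integral_add ((h₁.sub h₂).add (h₃.sub h₄)) (h₅.sub h₆)).trans
      (congrArg (· + _) (integral_add (h₁.sub h₂) (h₃.sub h₄)))
  rw [hsum (i1 1 2 0) (i1 2 1 0) (i1 2 0 1) (i1 0 2 1) (i1 0 1 2) (i1 1 0 2),
    hsum (i2 1 0 2) (i2 2 0 1) (i2 2 1 0) (i2 0 1 2) (i2 0 2 1) (i2 1 2 0)]
  simp only [integral_conj_partialDeriv_mul hφ hc hU]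
  ring

end CurlParts

/-- `V` is the weak curl of `U` in `O`, tested against the `C¹` fields with compact support in
`O`. -/
def HasWeakCurl (O : Set R3) (U V : R3 → C3) : Prop :=
  ∀ φ ∈ testFields O, ∫ x in O, inner ℂ (curl φ x) (U x) = ∫ x in O, inner ℂ (φ x) (V x)

/-! ### Fields of finite energy are locally square integrable -/

namespace Weight

variable {S : Set R3} (W : Weight S)

theorem inner_op_left {M : Mat3} (h : M.PosDef) (v w : C3) :
    inner ℂ (op M v) w = inner ℂ v (op M w) := by
  have h1 : IsSelfAdjoint (op M) :=
    ((ContinuousLinearMap.nonneg_iff_isPositive _).1 (op_nonneg h)).isSelfAdjoint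
  rw [← ContinuousLinearMap.adjoint_inner_right, ← ContinuousLinearMap.star_eq_adjoint, h1.star_eq]

theorem norm_root_sq {x : R3} (hx : (W.mat x).PosDef) (v : C3) :
    ‖W.root x v‖ ^ 2 = (density (W.mat x) v v).re := by
  rw [← W.inner_root hx, inner_self_eq_norm_sq_to_K]
  norm_cast

theorem root_root {x : R3} (hx : (W.mat x).PosDef) (v : C3) :
    W.root x (W.root x v) = op (W.mat x) v := by
  have h0 : W.root x * W.root x = op (W.mat x) := CFC.sqrt_mul_sqrt_self _ (op_nonneg hx)
  exact DFunLike.congr_fun h0 v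

variable {Q : Set R3} {W}

theorem memLp_root_restrict (hQS : Q ⊆ S) (u : W.L2) :
    MemLp (fun x => W.root x (u.field x)) 2 (volume.restrict Q) :=
  u.memLp_root.mono_measure (Measure.restrict_mono hQS le_rfl)

theorem memLp_field (hQ : IsCompact Q) (hQS : Q ⊆ interior S) (u : W.L2) :
    MemLp u.field 2 (volume.restrict Q) := by
  have hQS' := hQS.trans interior_subset
  obtain ⟨m, M, hm, hb⟩ := W.locBdd Q hQ hQS
  refine (memLp_root_restrict hQS' u).of_le_mul (c := (Real.sqrt m)⁻¹)
    (u.aesm.mono_measure (Measure.restrict_mono hQS' le_rfl)) ?_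
  filter_upwards [hb, ae_restrict_of_ae_restrict_of_subset hQS' W.posDef] with x h1 h2
  rw [inv_mul_eq_div, le_div_iff₀ (Real.sqrt_pos.2 hm)]
  refine le_of_sq_le_sq ?_ (norm_nonneg _)
  rw [mul_pow, Real.sq_sqrt hm.le, W.norm_root_sq h2, mul_comm]
  exact (h1 _).1

theorem memLp_op_field (hQ : IsCompact Q) (hQS : Q ⊆ interior S) (u : W.L2) :
    MemLp (fun x => op (W.mat x) (u.field x)) 2 (volume.restrict Q) := by
  have hQS' := hQS.trans interior_subset
  obtain ⟨m, M, hm, hb⟩ := W.locBdd Q hQ hQS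
  refine (memLp_root_restrict hQS' u).of_le_mul (c := Real.sqrt |M|)
    ((aestronglyMeasurable_apply (aemeasurable_op W.aemeasurable) u.aesm).mono_measure
      (Measure.restrict_mono hQS' le_rfl)) ?_
  filter_upwards [hb, ae_restrict_of_ae_restrict_of_subset hQS' W.posDef] with x h1 h2
  refine le_of_sq_le_sq ?_ (by positivity)
  rw [← W.root_root h2, W.norm_root_sq h2, mul_pow, Real.sq_sqrt (abs_nonneg M)]
  exact (h1 _).2.trans (by gcongr; exact le_abs_self M)

theorem locallyIntegrableOn_of_memLp {O : Set R3} (hO : IsOpen O) {f : R3 → C3}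
    (h : ∀ Q, IsCompact Q → Q ⊆ O → MemLp f 2 (volume.restrict Q)) :
    LocallyIntegrableOn f O volume := by
  rw [locallyIntegrableOn_iff hO.isLocallyClosed]
  intro Q hQO hQ
  have : IsFiniteMeasure (volume.restrict Q) := ⟨by
    rw [Measure.restrict_apply_univ]; exact hQ.measure_lt_top⟩
  exact (h Q hQ hQO).integrable one_le_two

theorem inner_embed (φ : testFields (interior S)) (u : W.L2) :
    inner ℂ (W.embed φ) u = ∫ x in S, inner ℂ (φ.1 x) (op (W.mat x) (u.field x)) := by
  rw [L2.inner_apply]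
  refine integral_congr_ae ?_
  filter_upwards [L2.field_mk φ.2.1.continuous.aestronglyMeasurable (W.integrable_testField φ.2)]
    with x hx
  rw [density_eq_inner]
  exact congrArg (inner ℂ · _) hx

theorem inner_invCurl (φ : testFields (interior S)) (u : W.L2) :
    inner ℂ (W.invCurl φ) u = ∫ x in S, inner ℂ (curl φ.1 x) (u.field x) := by
  rw [L2.inner_apply]
  refine integral_congr_ae ?_
  filter_upwards [L2.field_mk (W.aesm_inv_curl φ.2) (W.integrable_inv_curl φ.2), W.posDef]
    with x hx hp
  have h : op (W.mat x) (op (W.mat x)⁻¹ (curl φ.1 x)) = curl φ.1 x :=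
    DFunLike.congr_fun (op_mul_inv hp) _
  rw [density_eq_inner, ← inner_op_left hp, show (W.invCurl φ).field x = _ from hx, h]

theorem inner_invCurl_embed (φ ψ : testFields (interior S)) :
    inner ℂ (W.invCurl φ) (W.embed ψ) = ∫ x, inner ℂ (curl φ.1 x) (ψ.1 x) := by
  rw [inner_invCurl]
  refine Eq.trans (integral_congr_ae ?_)
    (setIntegral_eq_integral_of_forall_compl_eq_zero (s := S) fun x hx => ?_)
  · filter_upwards [L2.field_mk ψ.2.1.continuous.aestronglyMeasurable
      (W.integrable_testField ψ.2)] with x hx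
    exact congrArg (inner ℂ (curl φ.1 x)) hx
  · rw [image_eq_zero_of_notMem_tsupport fun h => hx (interior_subset (ψ.2.2.2 h)),
      inner_zero_right]

/-- A finite-energy field on an open set orthogonal to all test fields vanishes. -/
theorem eq_zero_of_inner_embed (hS : IsOpen S) {u : W.L2} (h : ∀ φ, inner ℂ (W.embed φ) u = 0) :
    u = 0 := by
  have hS' := hS.interior_eq
  have key : ∀ i : Fin 3, ∀ᵐ x ∂volume, x ∈ S → op (W.mat x) (u.field x) i = 0 := by
    intro i
    refine hS.ae_eq_zero_of_integral_contDiff_smul_eq_zero ?_ fun g hg hgc hgS => ?_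
    · have h1 : LocallyIntegrableOn (fun x => op (W.mat x) (u.field x)) S volume :=
        locallyIntegrableOn_of_memLp hS fun Q hQ hQS => memLp_op_field hQ (hS'.symm ▸ hQS) u
      intro x hx
      obtain ⟨t, ht, hi⟩ := h1 x hx
      exact ⟨t, ht, (EuclideanSpace.proj i : C3 →L[ℂ] ℂ).integrable_comp hi⟩
    · let φ : R3 → C3 := fun x => EuclideanSpace.single i ((g x : ℝ) : ℂ)
      have hφ0 : ∀ x, g x = 0 → φ x = 0 := fun x hx => by simp [φ, hx]
      have hsub : tsupport φ ⊆ tsupport g := closure_mono fun x hx h0 => hx (hφ0 x h0)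
      have hφ : φ ∈ testFields (interior S) := by
        refine ⟨?_, hgc.mono fun x hx h0 => hx (hφ0 x h0), hS'.symm ▸ hsub.trans hgS⟩
        have : φ = fun x => g x • (EuclideanSpace.single i 1 : C3) := by
          funext x
          ext k
          simp [φ]
        rw [this]
        exact (hg.of_le (mod_cast le_top)).smul contDiff_const
      have h2 := h ⟨φ, hφ⟩
      rw [inner_embed, setIntegral_eq_integral_of_forall_compl_eq_zero] at h2
      · rw [← h2]
        refine integral_congr_ae (Filter.Eventually.of_forall fun x => ?_)
        simp [φ, EuclideanSpace.inner_single_left]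
      · intro x hx
        have : φ x = 0 := hφ0 x (image_eq_zero_of_notMem_tsupport fun h => hx (hgS h))
        change inner ℂ (φ x) _ = 0
        rw [this, inner_zero_left]
  refine L2.ext ?_
  refine Filter.EventuallyEq.trans ?_ (AEEqFun.coeFn_zero (β := C3)).symm
  filter_upwards [ae_restrict_of_ae (ae_all_iff.2 key), ae_restrict_mem hS.measurableSet, W.posDef]
    with x h1 h2 h3
  have h4 : op (W.mat x) (u.field x) = 0 := by ext i; exact h1 i h2
  have h5 : op (W.mat x)⁻¹ (op (W.mat x) (u.field x)) = u.field x :=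
    DFunLike.congr_fun (op_inv_mul h3) _
  rw [← h5, h4, map_zero]; rfl

end Weight

/-! ### The Maxwell operator on test fields and its adjoint -/

section Maxwell

open scoped LinearPMap

variable {S : Set R3} (ε μ : Weight S)

theorem maxwell_isFormalAdjoint : (maxwell ε μ).IsFormalAdjoint (maxwell ε μ) := by
  rintro ⟨_, ⟨p, rfl⟩⟩ ⟨_, ⟨q, rfl⟩⟩
  rw [maxwell_apply, maxwell_apply, WithLp.prod_inner_apply, WithLp.prod_inner_apply]
  have e : ∀ (W : Weight S) (φ ψ : testFields (interior S)),
      inner ℂ (W.embed φ) (W.invCurl ψ) = inner ℂ (W.invCurl φ) (W.embed ψ) := fun W φ ψ => by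
    rw [← inner_conj_symm, Weight.inner_invCurl_embed, Weight.inner_invCurl_embed,
      integral_inner_curl ψ.2.1 ψ.2.2.1 φ.2.1, ← integral_conj]
    simp only [inner_conj_symm]
  have e' : ∀ (φ ψ : testFields (interior S)),
      inner ℂ (ε.invCurl φ) (ε.embed ψ) = inner ℂ (μ.invCurl φ) (μ.embed ψ) := fun φ ψ => by
    rw [Weight.inner_invCurl_embed, Weight.inner_invCurl_embed]
  have e1 : ∀ r : TestPairs S, (maxwellExpr ε μ r).fst = Complex.I • ε.invCurl r.2 := fun _ => rfl
  have e2 : ∀ r : TestPairs S, (maxwellExpr ε μ r).snd = Complex.I • -μ.invCurl r.1 := fun _ => rfl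
  have e3 : ∀ r : TestPairs S, (embedPair ε μ r).fst = ε.embed r.1 := fun _ => rfl
  have e4 : ∀ r : TestPairs S, (embedPair ε μ r).snd = μ.embed r.2 := fun _ => rfl
  change inner ℂ (maxwellExpr ε μ p).fst (embedPair ε μ q).fst +
    inner ℂ (maxwellExpr ε μ p).snd (embedPair ε μ q).snd =
    inner ℂ (embedPair ε μ p).fst (maxwellExpr ε μ q).fst +
    inner ℂ (embedPair ε μ p).snd (maxwellExpr ε μ q).snd
  rw [e1, e2, e3, e4, e1, e2, e3, e4]
  simp only [inner_smul_left, inner_smul_right, inner_neg_left, inner_neg_right, e, e',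
    Complex.conj_I]
  ring

theorem dense_maxwell_domain (hS : IsOpen S) :
    Dense ((maxwell ε μ).domain : Set (Energy ε μ)) := by
  rw [Submodule.dense_iff_topologicalClosure_eq_top, Submodule.topologicalClosure_eq_top_iff,
    Submodule.eq_bot_iff]
  intro w hw
  have h : ∀ r : TestPairs S, inner ℂ (ε.embed r.1) w.fst + inner ℂ (μ.embed r.2) w.snd = 0 := by
    intro r
    have h0 := (Submodule.mem_orthogonal _ _).1 hw (embedPair ε μ r)
      (LinearMap.mem_range_self (embedPair ε μ) r)
    rw [WithLp.prod_inner_apply] at h0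
    exact h0
  have h1 : w.fst = 0 := Weight.eq_zero_of_inner_embed hS fun φ => by
    have h0 := h (φ, 0)
    rwa [map_zero, inner_zero_left, add_zero] at h0
  have h2 : w.snd = 0 := Weight.eq_zero_of_inner_embed hS fun φ => by
    have h0 := h (0, φ)
    rwa [map_zero, inner_zero_left, zero_add] at h0
  have h3 : w = WithLp.toLp 2 (w.fst, w.snd) := rfl
  rw [h3, h1, h2]
  rfl

/-- If `a† (E, H) = i s (E, H)`, then `∇ × H = s ε E` and `∇ × E = -s μ H` weakly. -/
theorem hasWeakCurl_of_adjoint_maxwell (hS : IsOpen S) {s : ℂ} (u : (maxwell ε μ)†.domain)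
    (hu : (maxwell ε μ)† u = (Complex.I * s) • (u : Energy ε μ)) :
    HasWeakCurl S (u : Energy ε μ).snd.field
        (fun x => s • op (ε.mat x) ((u : Energy ε μ).fst.field x)) ∧
      HasWeakCurl S (u : Energy ε μ).fst.field
        (fun x => -s • op (μ.mat x) ((u : Energy ε μ).snd.field x)) := by
  have h : ∀ r : TestPairs S,
      inner ℂ (Complex.I • ε.invCurl r.2) (u : Energy ε μ).fst +
        inner ℂ (Complex.I • -μ.invCurl r.1) (u : Energy ε μ).snd =
      Complex.I * s * (inner ℂ (ε.embed r.1) (u : Energy ε μ).fst +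
        inner ℂ (μ.embed r.2) (u : Energy ε μ).snd) := fun r => by
    have h1 := (LinearPMap.adjoint_isFormalAdjoint (dense_maxwell_domain ε μ hS)).symm
      ⟨embedPair ε μ r, LinearMap.mem_range_self _ r⟩ u
    rw [maxwell_apply, hu, inner_smul_right] at h1
    exact h1
  rw [HasWeakCurl, HasWeakCurl]
  constructor
  · intro φ hφ
    rw [← hS.interior_eq] at hφ
    have h1 := h (⟨φ, hφ⟩, 0)
    simp only [map_zero, smul_zero, inner_zero_left, zero_add, add_zero, inner_smul_left,
      inner_neg_left, Weight.inner_invCurl, Weight.inner_embed, Complex.conj_I] at h1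
    simp only [inner_smul_right, integral_const_mul]
    refine mul_left_cancel₀ Complex.I_ne_zero ?_
    linear_combination h1
  · intro φ hφ
    rw [← hS.interior_eq] at hφ
    have h1 := h (0, ⟨φ, hφ⟩)
    simp only [map_zero, neg_zero, smul_zero, inner_zero_left, zero_add, add_zero, inner_smul_left,
      Weight.inner_invCurl, Weight.inner_embed, Complex.conj_I] at h1
    simp only [inner_smul_right, integral_const_mul]
    refine mul_left_cancel₀ Complex.I_ne_zero ?_
    linear_combination -h1

end Maxwell

/-! ### Pulling back fields as differential forms of degree one -/

section Pullback

/-- The Jacobian matrix `∂ h^l / ∂ x^m`. -/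
def jac (h : R3 → R3) (x : R3) : Matrix (Fin 3) (Fin 3) ℝ :=
  Matrix.of fun l m => fderiv ℝ h x (EuclideanSpace.single m 1) l

/-- The action of a real matrix on `ℂ³`. -/
abbrev rop (A : Matrix (Fin 3) (Fin 3) ℝ) : C3 →L[ℂ] C3 := op (A.map Complex.ofReal)

theorem rop_apply (A : Matrix (Fin 3) (Fin 3) ℝ) (v : C3) (i : Fin 3) :
    rop A v i = (A i 0 : ℂ) * v 0 + (A i 1 : ℂ) * v 1 + (A i 2 : ℂ) * v 2 := by
  simp [Matrix.mulVec, dotProduct, Fin.sum_univ_three]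

theorem rop_mul (A B : Matrix (Fin 3) (Fin 3) ℝ) (v : C3) : rop (A * B) v = rop A (rop B v) := by
  have : (A * B).map Complex.ofReal = A.map Complex.ofReal * B.map Complex.ofReal :=
    Matrix.map_mul (f := Complex.ofRealHom)
  rw [rop, this, op, map_mul]
  rfl

theorem rop_one (v : C3) : rop 1 v = v := by
  ext i; rw [rop_apply]; fin_cases i <;> simp [Matrix.one_apply]

theorem rop_smul (r : ℝ) (A : Matrix (Fin 3) (Fin 3) ℝ) (v : C3) : rop (r • A) v = r • rop A v := by
  ext i; rw [rop_apply, PiLp.smul_apply, rop_apply]; simp; ring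

theorem inner_rop_left (A : Matrix (Fin 3) (Fin 3) ℝ) (v w : C3) :
    inner ℂ (rop A v) w = inner ℂ v (rop A.transpose w) := by
  simp only [inner_C3, rop_apply, Matrix.transpose_apply, map_add, map_mul, Complex.conj_ofReal]
  ring

/-- The pull-back of the field `ψ`, regarded as a one-form, under the map `h`. -/
def pullback (h : R3 → R3) (ψ : R3 → C3) (x : R3) : C3 := rop (jac h x).transpose (ψ (h x))

theorem pullback_apply (h : R3 → R3) (ψ : R3 → C3) (x : R3) (l : Fin 3) :
    pullback h ψ x l = (jac h x 0 l : ℂ) * ψ (h x) 0 + (jac h x 1 l : ℂ) * ψ (h x) 1 +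
      (jac h x 2 l : ℂ) * ψ (h x) 2 := by
  rw [pullback, rop_apply]; rfl

theorem jac_eq_of_eventuallyEq {h k : R3 → R3} {x : R3} (e : h =ᶠ[nhds x] k) :
    jac h x = jac k x := by
  rw [jac, jac, e.fderiv_eq]

theorem pullback_eventuallyEq {h k : R3 → R3} {x : R3} (e : h =ᶠ[nhds x] k) (ψ : R3 → C3) :
    pullback h ψ =ᶠ[nhds x] pullback k ψ := by
  filter_upwards [e.eventually_nhds] with y hy
  rw [pullback, pullback, jac_eq_of_eventuallyEq hy, hy.self_of_nhds]

theorem partialDeriv_eq_of_eventuallyEq {φ ψ : R3 → C3} {x : R3} (e : φ =ᶠ[nhds x] ψ)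
    (k l : Fin 3) : partialDeriv φ k l x = partialDeriv ψ k l x := by
  rw [partialDeriv, partialDeriv, e.fderiv_eq]

theorem curl_eq_of_eventuallyEq {φ ψ : R3 → C3} {x : R3} (e : φ =ᶠ[nhds x] ψ) :
    curl φ x = curl ψ x := by
  simp only [curl, partialDeriv_eq_of_eventuallyEq e]

variable {h : R3 → R3} {ψ : R3 → C3} {x : R3}

theorem contDiffAt_jac (hh : ContDiffAt ℝ 2 h x) (l m : Fin 3) :
    ContDiffAt ℝ 1 (fun y => (jac h y l m : ℂ)) x := by
  have h1 : ContDiffAt ℝ 1 (fun y => fderiv ℝ h y (EuclideanSpace.single m 1)) x :=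
    (hh.fderiv_right (m := 1) (by norm_num)).clm_apply contDiffAt_const
  have h2 : ContDiffAt ℝ 1 (fun y => jac h y l m) x := (contDiffAt_piLp 2).1 h1 l
  exact Complex.ofRealCLM.contDiff.contDiffAt.comp x h2

theorem contDiffAt_pullback (hh : ContDiffAt ℝ 2 h x) (hψ : ContDiff ℝ 1 ψ) :
    ContDiffAt ℝ 1 (pullback h ψ) x := by
  rw [contDiffAt_piLp]
  intro l
  simp only [pullback_apply]
  have h1 : ContDiffAt ℝ 1 (fun y => ψ (h y)) x :=
    hψ.contDiffAt.comp x (hh.of_le (by norm_num))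
  have h2 := fun m => (contDiffAt_piLp 2).1 h1 m
  have h3 := fun m => contDiffAt_jac hh m l
  exact (((h3 0).mul (h2 0)).add ((h3 1).mul (h2 1))).add ((h3 2).mul (h2 2))

theorem fderiv_single_eq (k : Fin 3) : fderiv ℝ h x (EuclideanSpace.single k 1) =
    jac h x 0 k • EuclideanSpace.single 0 1 + jac h x 1 k • EuclideanSpace.single 1 1 +
      jac h x 2 k • EuclideanSpace.single 2 1 := by
  ext i
  fin_cases i <;> simp [jac]

theorem hasFDerivAt_coord {φ : R3 → C3} (hφ : DifferentiableAt ℝ φ x) (l : Fin 3) :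
    HasFDerivAt (fun y => φ y l)
      (((EuclideanSpace.proj l : C3 →L[ℂ] ℂ).restrictScalars ℝ) ∘L fderiv ℝ φ x) x :=
  ((EuclideanSpace.proj l : C3 →L[ℂ] ℂ).restrictScalars ℝ).hasFDerivAt.comp x hφ.hasFDerivAt

theorem hasFDerivAt_jac (hh : ContDiffAt ℝ 2 h x) (l m : Fin 3) :
    HasFDerivAt (fun y => (jac h y l m : ℂ))
      (Complex.ofRealCLM ∘L (EuclideanSpace.proj l : R3 →L[ℝ] ℝ) ∘L
        (fderiv ℝ (fderiv ℝ h) x).flip (EuclideanSpace.single m 1)) x := by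
  have h0 : DifferentiableAt ℝ (fderiv ℝ h) x :=
    (hh.fderiv_right (m := 1) (by norm_num)).differentiableAt one_ne_zero
  have h1 : HasFDerivAt (fun y => fderiv ℝ h y (EuclideanSpace.single m 1))
      ((fderiv ℝ (fderiv ℝ h) x).flip (EuclideanSpace.single m 1)) x := by
    have := h0.hasFDerivAt.clm_apply (hasFDerivAt_const (EuclideanSpace.single m (1 : ℝ)) x)
    simpa using this
  exact Complex.ofRealCLM.hasFDerivAt.comp x
    ((EuclideanSpace.proj l : R3 →L[ℝ] ℝ).hasFDerivAt.comp x h1)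

/-- The product rule for a pull-back. The terms with second derivatives of `h` are symmetric in `k`
and `l`, so that they cancel in the curl. -/
theorem partialDeriv_pullback (hh : ContDiffAt ℝ 2 h x) (hψ : ContDiff ℝ 1 ψ) (k l : Fin 3) :
    partialDeriv (pullback h ψ) k l x =
      ∑ m, ((fderiv ℝ (fderiv ℝ h) x (EuclideanSpace.single k 1) (EuclideanSpace.single l 1) m : ℝ)
          * ψ (h x) m +
        jac h x m l * ∑ n, (jac h x n k : ℂ) * partialDeriv ψ n m (h x)) := by
  have hc : DifferentiableAt ℝ (fun y => ψ (h y)) x :=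
    (hψ.differentiable one_ne_zero _).comp x (hh.differentiableAt (by norm_num))
  have hc' : fderiv ℝ (fun y => ψ (h y)) x = (fderiv ℝ ψ (h x)).comp (fderiv ℝ h x) :=
    fderiv_comp x (hψ.differentiable one_ne_zero _) (hh.differentiableAt (by norm_num))
  have h1 := hasFDerivAt_coord ((contDiffAt_pullback hh hψ).differentiableAt one_ne_zero) l
  have h2 := fun m => (hasFDerivAt_jac hh m l).mul (hasFDerivAt_coord hc m)
  have h3 := ((h2 0).add (h2 1)).add (h2 2)
  have h4 : (fun y => pullback h ψ y l) = fun y => (jac h y 0 l : ℂ) * ψ (h y) 0 +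
      (jac h y 1 l : ℂ) * ψ (h y) 1 + (jac h y 2 l : ℂ) * ψ (h y) 2 :=
    funext fun y => pullback_apply h ψ y l
  rw [h4] at h1
  have h5 := DFunLike.congr_fun (h1.unique h3) (EuclideanSpace.single k 1)
  have h6 : ∀ m, fderiv ℝ ψ (h x) (fderiv ℝ h x (EuclideanSpace.single k 1)) m =
      ∑ n, (jac h x n k : ℂ) * partialDeriv ψ n m (h x) := fun m => by
    rw [fderiv_single_eq, map_add, map_add, map_smul, map_smul, map_smul, Fin.sum_univ_three]
    simp [partialDeriv]
  rw [Fin.sum_univ_three, ← h6, ← h6, ← h6]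
  refine Eq.trans h5 ?_
  simp [hc']
  ring

/-- The pull-back of one-forms commutes with the exterior derivative; on the curl, a two-form, it
acts through the adjugate of the Jacobian matrix. -/
theorem curl_pullback (hh : ContDiffAt ℝ 2 h x) (hψ : ContDiff ℝ 1 ψ) :
    curl (pullback h ψ) x = rop (jac h x).adjugate (curl ψ (h x)) := by
  have hs : ∀ k l m, fderiv ℝ (fderiv ℝ h) x (EuclideanSpace.single k 1)
      (EuclideanSpace.single l 1) m = fderiv ℝ (fderiv ℝ h) x (EuclideanSpace.single l 1)
      (EuclideanSpace.single k 1) m := fun k l m => by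
    rw [(hh.isSymmSndFDerivAt (by simp)).eq]
  ext i
  rw [rop_apply]
  simp only [curl, partialDeriv_pullback hh hψ, Fin.sum_univ_three]
  fin_cases i
  · simp [Matrix.adjugate_fin_three]
    rw [hs 2 1 0, hs 2 1 1, hs 2 1 2]
    ring
  · simp [Matrix.adjugate_fin_three]
    rw [hs 2 0 0, hs 2 0 1, hs 2 0 2]
    ring
  · simp [Matrix.adjugate_fin_three]
    rw [hs 1 0 0, hs 1 0 1, hs 1 0 2]
    ring

theorem exists_bound_rop (D : ℝ) : ∃ C, 0 ≤ C ∧ ∀ A : Matrix (Fin 3) (Fin 3) ℝ,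
    (∀ i k, |A i k| ≤ D) → ∀ v, ‖rop A.transpose v‖ ≤ C * ‖v‖ ∧ ‖rop A.adjugate v‖ ≤ C * ‖v‖ := by
  let f : (Fin 3 → Fin 3 → ℝ) → Matrix (Fin 3) (Fin 3) ℝ := Matrix.of
  have hK : IsCompact (Set.pi univ fun _ : Fin 3 => Set.pi univ fun _ : Fin 3 => Icc (-D) D) :=
    isCompact_univ_pi fun _ => isCompact_univ_pi fun _ => isCompact_Icc
  have hrop : Continuous rop := by
    have : rop = fun A => ∑ i, ∑ j, (A i j) • op (Matrix.single i j 1) := by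
      funext A
      refine ContinuousLinearMap.ext fun v => ?_
      ext k
      rw [rop_apply]
      simp [Fin.sum_univ_three, Matrix.mulVec, dotProduct, Matrix.single_apply, ite_and]
      fin_cases k <;> simp
    rw [this]
    refine continuous_finsetSum _ fun i _ => continuous_finsetSum _ fun j _ => ?_
    exact (continuous_id.matrix_elem i j).smul continuous_const
  have hf : Continuous f := continuous_id
  obtain ⟨C₁, h₁⟩ := hK.exists_bound_of_continuousOn
    (hrop.comp hf.matrix_transpose).continuousOn
  obtain ⟨C₂, h₂⟩ := hK.exists_bound_of_continuousOn
    (hrop.comp hf.matrix_adjugate).continuousOn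
  refine ⟨max 0 (max C₁ C₂), le_max_left _ _, fun A hA v => ?_⟩
  have hA' : (A : Fin 3 → Fin 3 → ℝ) ∈
      Set.pi univ fun _ : Fin 3 => Set.pi univ fun _ : Fin 3 => Icc (-D) D :=
    fun i _ k _ => abs_le.1 (hA i k)
  constructor
  · refine ((rop A.transpose).le_opNorm v).trans ?_
    gcongr
    exact (h₁ _ hA').trans ((le_max_left _ _).trans (le_max_right _ _))
  · refine ((rop A.adjugate).le_opNorm v).trans ?_
    gcongr
    exact (h₂ _ hA').trans ((le_max_right _ _).trans (le_max_right _ _))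

end Pullback

/-! ### Regularity of the cloaking transformation and of its inverse -/

theorem det_fderiv (h : R3 → R3) (x : R3) : (fderiv ℝ h x).det = (jac h x).det := by
  rw [ContinuousLinearMap.det, ← LinearMap.det_toMatrix (EuclideanSpace.basisFun (Fin 3) ℝ).toBasis]
  congr 1

theorem jac_id (x : R3) : jac (fun y => y) x = 1 := by
  ext i k
  simp [jac, Matrix.one_apply]

theorem jac_comp {h k : R3 → R3} {x : R3} (hh : DifferentiableAt ℝ h (k x))
    (hk : DifferentiableAt ℝ k x) : jac (fun y => h (k y)) x = jac h (k x) * jac k x := by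
  ext i l
  have h1 : fderiv ℝ (fun y => h (k y)) x = (fderiv ℝ h (k x)).comp (fderiv ℝ k x) :=
    fderiv_comp x hh hk
  rw [Matrix.mul_apply, Fin.sum_univ_three]
  change fderiv ℝ (fun y => h (k y)) x (EuclideanSpace.single l 1) i = _
  rw [h1, ContinuousLinearMap.comp_apply, fderiv_single_eq, map_add, map_add, map_smul, map_smul,
    map_smul]
  simp [jac]
  ring

namespace IsRadial

variable {A : Matrix (Fin 3) (Fin 3) ℝ} {D : ℝ}

theorem det_pos (h : IsRadial A D) (hD : 1 ≤ D) : 0 < A.det :=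
  lt_of_lt_of_le (by positivity) (h.det_bounds hD).1

theorem inv (h : IsRadial A D) (hD : 1 ≤ D) : IsRadial A⁻¹ D := by
  obtain ⟨α, γ, n, hn, h1, h2, h3, h4, h5⟩ := h
  have hD0 : 0 < D⁻¹ := by positivity
  have hα : 0 < α := hD0.trans_le h1
  have hγ : 0 < γ := hD0.trans_le h3
  have hinv : A⁻¹ = Matrix.of fun i k =>
      (if i = k then α⁻¹ else 0) + (γ⁻¹ - α⁻¹) * n i * n k := by
    refine Matrix.inv_eq_right_inv ?_
    have e : α * (γ⁻¹ - α⁻¹) + (γ - α) * α⁻¹ + (γ - α) * (γ⁻¹ - α⁻¹) = 0 := by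
      field_simp
      ring
    ext i k
    rw [Matrix.mul_apply, Fin.sum_univ_three]
    simp only [h5, Matrix.of_apply, Matrix.one_apply]
    have hα' : α * α⁻¹ = 1 := mul_inv_cancel₀ hα.ne'
    generalize γ⁻¹ = γ' at *
    generalize α⁻¹ = α' at *
    fin_cases i <;> fin_cases k <;> simp
    · linear_combination hα' + (n 0 * n 0) * e + (γ - α) * (γ' - α') * (n 0 * n 0) * hn
    · linear_combination (n 0 * n 1) * e + (γ - α) * (γ' - α') * (n 0 * n 1) * hn
    · linear_combination (n 0 * n 2) * e + (γ - α) * (γ' - α') * (n 0 * n 2) * hn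
    · linear_combination (n 1 * n 0) * e + (γ - α) * (γ' - α') * (n 1 * n 0) * hn
    · linear_combination hα' + (n 1 * n 1) * e + (γ - α) * (γ' - α') * (n 1 * n 1) * hn
    · linear_combination (n 1 * n 2) * e + (γ - α) * (γ' - α') * (n 1 * n 2) * hn
    · linear_combination (n 2 * n 0) * e + (γ - α) * (γ' - α') * (n 2 * n 0) * hn
    · linear_combination (n 2 * n 1) * e + (γ - α) * (γ' - α') * (n 2 * n 1) * hn
    · linear_combination hα' + (n 2 * n 2) * e + (γ - α) * (γ' - α') * (n 2 * n 2) * hn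
  refine ⟨α⁻¹, γ⁻¹, n, hn, ?_, ?_, ?_, ?_, fun i k => by rw [hinv]; rfl⟩
  · gcongr
  · rw [inv_le_comm₀ hα (by positivity)]; exact h1
  · gcongr
  · rw [inv_le_comm₀ hγ (by positivity)]; exact h3

theorem abs_le (h : IsRadial A D) (hD : 1 ≤ D) (i k : Fin 3) : |A i k| ≤ 2 * D := by
  obtain ⟨α, γ, n, hn, h1, h2, h3, h4, h5⟩ := h
  have hD0 : 0 < D⁻¹ := by positivity
  have hα : 0 < α := hD0.trans_le h1
  have hγ : 0 < γ := hD0.trans_le h3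
  have hsq : ∀ i, n i ^ 2 ≤ 1 := fun i => by
    have e := And.intro (sq_nonneg (n 0)) (And.intro (sq_nonneg (n 1)) (sq_nonneg (n 2)))
    fin_cases i
    · change n 0 ^ 2 ≤ 1; linarith
    · change n 1 ^ 2 ≤ 1; linarith
    · change n 2 ^ 2 ≤ 1; linarith
  have hprod : |n i * n k| ≤ 1 := by
    rw [abs_mul]
    exact mul_le_one₀ (abs_le_one_iff_mul_self_le_one.2 (by nlinarith [hsq i])) (abs_nonneg _)
      (abs_le_one_iff_mul_self_le_one.2 (by nlinarith [hsq k]))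
  rw [h5, mul_assoc]
  refine (abs_add_le _ _).trans ?_
  have e1 : |if i = k then α else 0| ≤ D := by
    split_ifs
    · rwa [abs_of_pos hα]
    · rw [abs_zero]; linarith
  have e2 : |(γ - α) * (n i * n k)| ≤ D := by
    rw [abs_mul]
    refine (mul_le_of_le_one_right (abs_nonneg _) hprod).trans ?_
    rw [_root_.abs_le]
    constructor <;> linarith
  linarith

end IsRadial

namespace CloakGeometry

variable {N : ℕ} (G : CloakGeometry N)

theorem isOpen_Ω₀ : IsOpen G.Ω₀ := by
  have : G.Ω₀ = (⋃ j, {G.c j})ᶜ := by ext; simp [Ω₀, eq_comm]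
  rw [this]
  exact (isClosed_iUnion_of_finite fun _ => isClosed_singleton).isOpen_compl

theorem inv_map {y : R3} (hy : y ∈ G.Ω₀) : G.inv (G.map y) = y :=
  G.injOn_map (G.inv_mem (G.map_mem_Ω hy)) hy (G.map_inv (G.map_mem_Ω hy))

theorem map_mem_sphere_iff {j : Fin N} {y : R3} (hy : y ∈ G.Ω₀) :
    G.map y ∈ Metric.sphere (G.c j) (G.b j) ↔ y ∈ Metric.sphere (G.c j) (G.b j) := by
  constructor
  · intro h
    have h1 := (G.map_mem_ball_iff hy).1 (Metric.sphere_subset_closedBall h)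
    have h2 := G.norm_mem hy h1
    rw [mem_sphere_iff_norm, G.norm_map hy h1] at h
    rw [mem_sphere_iff_norm]
    refine (G.cloaking j).strictMonoOn.injOn (Ioc_subset_Icc_self h2)
      (right_mem_Icc.2 (G.b_pos j).le) ?_
    rw [h, (G.cloaking j).map_b]
  · intro h
    rw [mem_sphere_iff_norm, G.norm_map hy (Metric.sphere_subset_closedBall h),
      mem_sphere_iff_norm.1 h, (G.cloaking j).map_b]

theorem inv_mem_sphere_iff {j : Fin N} {x : R3} (hx : x ∈ G.Ω) :
    G.inv x ∈ Metric.sphere (G.c j) (G.b j) ↔ x ∈ Metric.sphere (G.c j) (G.b j) := by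
  rw [← G.map_mem_sphere_iff (G.inv_mem hx), G.map_inv hx]

/-- The domain of smoothness of the transformation: the points of `Ω₀` off the spheres
`|y - c j| = b j`. -/
def regular : Set R3 := {y | y ∈ G.Ω₀ ∧ ∀ j, y ∉ Metric.sphere (G.c j) (G.b j)}

theorem isOpen_regular : IsOpen G.regular := by
  have : G.regular = G.Ω₀ ∩ (⋃ j, Metric.sphere (G.c j) (G.b j))ᶜ := by ext; simp [regular]
  rw [this]
  exact G.isOpen_Ω₀.inter
    (isClosed_iUnion_of_finite fun _ => Metric.isClosed_sphere).isOpen_compl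

theorem inv_mem_regular {x : R3} (hx : x ∈ G.Ω) (hxs : ∀ j, x ∉ Metric.sphere (G.c j) (G.b j)) :
    G.inv x ∈ G.regular :=
  ⟨G.inv_mem hx, fun j h => hxs j ((G.inv_mem_sphere_iff hx).1 h)⟩

theorem det_jacobian_pos {y : R3} (hy : y ∈ G.regular) : 0 < (G.jacobian y).det := by
  obtain ⟨D, hD, h⟩ := G.exists_radial (isCompact_singleton (x := G.map y))
    (by simpa using G.map_mem_Ω hy.1)
  have h1 := h _ rfl fun j hj => hy.2 j ((G.map_mem_sphere_iff hy.1).1 hj)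
  rw [G.inv_map hy.1] at h1
  exact h1.det_pos hD

theorem contDiffAt_map {y : R3} (hy : y ∈ G.regular) : ContDiffAt ℝ 2 G.map y := by
  by_cases hex : ∃ j, y ∈ Metric.closedBall (G.c j) (G.b j)
  · obtain ⟨j, hj⟩ := hex
    have hb : y ∈ Metric.ball (G.c j) (G.b j) :=
      lt_of_le_of_ne hj fun h => hy.2 j h
    have heq : G.map =ᶠ[nhds y]
        fun z => G.c j + (G.g j ‖z - G.c j‖ / ‖z - G.c j‖) • (z - G.c j) := by
      filter_upwards [Metric.isOpen_ball.mem_nhds hb] with z hz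
      exact G.map_of_mem (Metric.ball_subset_closedBall hz)
    refine ContDiffAt.congr_of_eventuallyEq ?_ heq
    have hρ := G.norm_mem hy.1 hj
    have hρb : ‖y - G.c j‖ < G.b j := by rwa [Metric.mem_ball, dist_eq_norm] at hb
    have hg : ContDiffAt ℝ 2 (G.g j) ‖y - G.c j‖ :=
      (G.cloaking j).contDiffOn.contDiffAt (Icc_mem_nhds hρ.1 hρb)
    have hs : ContDiffAt ℝ 2 (fun z : R3 => z - G.c j) y := contDiffAt_id.sub contDiffAt_const
    have hn : ContDiffAt ℝ 2 (fun z : R3 => ‖z - G.c j‖) y :=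
      hs.norm ℝ (sub_ne_zero.2 (hy.1 j))
    exact contDiffAt_const.add
      (((hg.comp y hn : ContDiffAt ℝ 2 (fun z => G.g j ‖z - G.c j‖) y).div hn hρ.1.ne').smul hs)
  · have hopen : IsOpen (⋃ j, Metric.closedBall (G.c j) (G.b j))ᶜ :=
      (isClosed_iUnion_of_finite fun _ => Metric.isClosed_closedBall).isOpen_compl
    have heq : G.map =ᶠ[nhds y] id := by
      filter_upwards [hopen.mem_nhds (by simpa using hex)] with z hz
      exact G.map_of_notMem (by simpa using hz)
    exact contDiffAt_id.congr_of_eventuallyEq heq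

theorem contDiffAt_inv_map {y : R3} (hy : y ∈ G.regular) : ContDiffAt ℝ 2 G.inv (G.map y) := by
  have h1 := G.contDiffAt_map hy
  have h2 : (fderiv ℝ G.map y).det ≠ 0 := by
    rw [det_fderiv]; exact (G.det_jacobian_pos hy).ne'
  have h3 : HasFDerivAt G.map
      (((fderiv ℝ G.map y).toContinuousLinearEquivOfDetNeZero h2 : R3 ≃L[ℝ] R3) : R3 →L[ℝ] R3) y := by
    rw [ContinuousLinearMap.coe_toContinuousLinearEquivOfDetNeZero]
    exact (h1.differentiableAt (by norm_num)).hasFDerivAt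
  refine (h1.to_localInverse h3 (by norm_num)).congr_of_eventuallyEq ?_
  refine HasStrictFDerivAt.localInverse_unique _ ?_
  filter_upwards [G.isOpen_Ω₀.mem_nhds hy.1] with z hz
  exact G.inv_map hz

theorem contDiffAt_inv {x : R3} (hx : x ∈ G.Ω) (hxs : ∀ j, x ∉ Metric.sphere (G.c j) (G.b j)) :
    ContDiffAt ℝ 2 G.inv x := by
  have := G.contDiffAt_inv_map (G.inv_mem_regular hx hxs)
  rwa [G.map_inv hx] at this

theorem jac_inv_map {y : R3} (hy : y ∈ G.regular) : jac G.inv (G.map y) = (G.jacobian y)⁻¹ := by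
  have h := jac_comp ((G.contDiffAt_inv_map hy).differentiableAt (by norm_num))
    ((G.contDiffAt_map hy).differentiableAt (by norm_num))
  have heq : (fun z => G.inv (G.map z)) =ᶠ[nhds y] fun z => z := by
    filter_upwards [G.isOpen_Ω₀.mem_nhds hy.1] with z hz
    exact G.inv_map hz
  rw [jac_eq_of_eventuallyEq heq, jac_id] at h
  exact (Matrix.inv_eq_left_inv h.symm).symm

theorem inv_of_notMem {x : R3} (h : ∀ j, x ∉ Metric.closedBall (G.c j) (G.b j)) : G.inv x = x := by
  have hx : x ∈ G.Ω₀ := fun j hj => h j (hj ▸ Metric.mem_closedBall_self (G.b_pos j).le)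
  have := G.inv_map hx
  rwa [G.map_of_notMem h] at this

/-- The entries of the Jacobian matrix of the inverse transformation are bounded on compact subsets
of `Ω`. -/
theorem exists_bound_jac_inv {Q : Set R3} (hQ : IsCompact Q) (hQΩ : Q ⊆ G.Ω) :
    ∃ D : ℝ, 0 ≤ D ∧ ∀ x ∈ Q, (∀ j, x ∉ Metric.sphere (G.c j) (G.b j)) →
      ∀ i k, |jac G.inv x i k| ≤ D := by
  obtain ⟨D, hD, h⟩ := G.exists_radial hQ hQΩ
  refine ⟨2 * D, by linarith, fun x hx hxs i k => ?_⟩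
  have h1 := G.jac_inv_map (G.inv_mem_regular (hQΩ hx) hxs)
  rw [G.map_inv (hQΩ hx)] at h1
  rw [h1]
  exact ((h x hx hxs).inv hD).abs_le hD i k

/-- The inverse transformation moves a point of the ball `|x - c j| ≤ b j` by at most a multiple of its
distance to the sphere. -/
theorem exists_norm_inv_sub_le (j : Fin N) : ∃ C : ℝ, 0 ≤ C ∧ ∀ x ∈ G.Ω,
    x ∈ Metric.closedBall (G.c j) (G.b j) → ‖G.inv x - x‖ ≤ C * (G.b j - ‖x - G.c j‖) := by
  have hg := G.cloaking j
  obtain ⟨D, hD, h⟩ := exists_bound_of_pos isCompact_Icc (hg.continuousOn_deriv (G.b_pos j))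
    hg.deriv_pos
  refine ⟨D + 1, by linarith, fun x hx hxb => ?_⟩
  have hy := G.inv_mem hx
  have hyb := (G.map_mem_ball_iff (j := j) hy).1 ((G.map_inv hx).symm ▸ hxb)
  have hρ := G.norm_mem hy hyb
  have hn := G.norm_map hy hyb
  have hm := G.map_of_mem hyb
  rw [G.map_inv hx] at hn hm
  set y := G.inv x with hydef
  set ρ := ‖y - G.c j‖ with hρdef
  have hle : D⁻¹ * (G.b j - ρ) ≤ G.g j (G.b j) - G.g j ρ := by
    refine (convex_Icc 0 (G.b j)).mul_sub_le_image_sub_of_le_deriv hg.continuousOn ?_ ?_ ρ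
      (Ioc_subset_Icc_self hρ) _ (right_mem_Icc.2 (G.b_pos j).le) hρ.2
    · rw [interior_Icc]
      exact fun r hr => (hg.hasDerivAt hr).differentiableAt.differentiableWithinAt
    · rw [interior_Icc]
      intro r hr
      rw [(hg.hasDerivAt hr).deriv]
      exact (h r (Ioo_subset_Icc_self hr)).1
  rw [hg.map_b, ← hn] at hle
  have hle' : G.b j - ρ ≤ D * (G.b j - ‖x - G.c j‖) := by
    rwa [inv_mul_le_iff₀ (by linarith)] at hle
  have hsub : y - x = (1 - G.g j ρ / ρ) • (y - G.c j) := by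
    rw [sub_smul, one_smul, show (G.g j ρ / ρ) • (y - G.c j) = x - G.c j from
      eq_sub_of_add_eq' hm.symm]
    abel
  have hnorm : ‖y - x‖ = |ρ - ‖x - G.c j‖| := by
    rw [hsub, norm_smul, Real.norm_eq_abs, ← hρdef, hn]
    conv_lhs => rw [← abs_of_pos hρ.1, ← abs_mul]
    rw [sub_mul, one_mul, abs_of_pos hρ.1, div_mul_cancel₀ _ hρ.1.ne']
  have hxb' : ‖x - G.c j‖ ≤ G.b j := by rwa [Metric.mem_closedBall, dist_eq_norm] at hxb
  rw [hnorm, abs_le]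
  have hρ2 := hρ.2
  constructor <;> nlinarith

end CloakGeometry

/-! ### Smooth approximations of the inverse transformation -/

theorem exists_lipschitzWith_smoothTransition : ∃ L, LipschitzWith L Real.smoothTransition := by
  have hc : ContDiff ℝ 1 Real.smoothTransition := Real.smoothTransition.contDiff
  obtain ⟨L, hL⟩ := isCompact_Icc (a := (0 : ℝ)) (b := 1) |>.exists_bound_of_continuousOn
    (hc.continuous_deriv le_rfl).continuousOn
  refine ⟨Real.toNNReal L,
    lipschitzWith_of_nnnorm_deriv_le (hc.differentiable one_ne_zero) fun x => ?_⟩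
  rw [← NNReal.coe_le_coe, coe_nnnorm, Real.coe_toNNReal']
  by_cases h0 : x < 0
  · have : Real.smoothTransition =ᶠ[nhds x] fun _ => 0 := by
      filter_upwards [Iio_mem_nhds h0] with y hy
      exact Real.smoothTransition.zero_of_nonpos (le_of_lt hy)
    rw [this.deriv_eq]
    simp
  by_cases h1 : 1 < x
  · have : Real.smoothTransition =ᶠ[nhds x] fun _ => 1 := by
      filter_upwards [Ioi_mem_nhds h1] with y hy
      exact Real.smoothTransition.one_of_one_le (le_of_lt hy)
    rw [this.deriv_eq]
    simp
  exact (hL x ⟨not_lt.1 h0, not_lt.1 h1⟩).trans (le_max_left _ _)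

namespace CloakGeometry

open Filter Topology

variable {N : ℕ} (G : CloakGeometry N)

/-- A smooth function that is `1` where `|x - c j| ≤ b j - 2 δ` and `0` where
`b j - δ ≤ |x - c j|`. -/
def cutoff (δ : ℝ) (j : Fin N) (x : R3) : ℝ :=
  Real.smoothTransition ((G.b j - δ - ‖x - G.c j‖) / δ)

/-- The inverse transformation, replaced by the identity in a layer of thickness `δ` inside each
sphere `|x - c j| = b j`, with a smooth transition in the next layer of thickness `δ`. -/
def smoothInv (δ : ℝ) (x : R3) : R3 := x + ∑ j, G.cutoff δ j x • (G.inv x - x)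

variable {δ : ℝ} {j : Fin N} {x : R3}

theorem cutoff_eq_zero (hδ : 0 < δ) (h : G.b j - δ ≤ ‖x - G.c j‖) : G.cutoff δ j x = 0 :=
  Real.smoothTransition.zero_of_nonpos (div_nonpos_of_nonpos_of_nonneg (by linarith) hδ.le)

theorem cutoff_eq_one (hδ : 0 < δ) (h : ‖x - G.c j‖ ≤ G.b j - 2 * δ) : G.cutoff δ j x = 1 :=
  Real.smoothTransition.one_of_one_le ((one_le_div hδ).2 (by linarith))

theorem smoothInv_of_mem (hδ : 0 < δ) (h : x ∈ Metric.closedBall (G.c j) (G.b j)) :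
    G.smoothInv δ x = x + G.cutoff δ j x • (G.inv x - x) := by
  rw [smoothInv, Finset.sum_eq_single j]
  · intro l _ hl
    have h1 : x ∉ Metric.closedBall (G.c l) (G.b l) := fun h1 => hl (G.eq_of_mem_ball h1 h)
    rw [Metric.mem_closedBall, dist_eq_norm, not_le] at h1
    rw [G.cutoff_eq_zero hδ (by linarith), zero_smul]
  · exact fun h => absurd (Finset.mem_univ j) h

theorem smoothInv_of_forall_le (hδ : 0 < δ) (h : ∀ j, G.b j - δ ≤ ‖x - G.c j‖) :
    G.smoothInv δ x = x := by
  rw [smoothInv, Finset.sum_eq_zero, add_zero]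
  exact fun j _ => by rw [G.cutoff_eq_zero hδ (h j), zero_smul]

theorem smoothInv_eventuallyEq_id (hδ : 0 < δ) (h : ∀ j, G.b j - δ < ‖x - G.c j‖) :
    G.smoothInv δ =ᶠ[𝓝 x] fun y => y := by
  have : ∀ᶠ y in 𝓝 x, ∀ j, G.b j - δ < ‖y - G.c j‖ :=
    eventually_all.2 fun j =>
      (by fun_prop : Continuous fun y : R3 => ‖y - G.c j‖).continuousAt.eventually
      (lt_mem_nhds (h j))
  filter_upwards [this] with y hy
  exact G.smoothInv_of_forall_le hδ fun j => (hy j).le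

theorem smoothInv_eventuallyEq_of_mem (hδ : 0 < δ) (h : x ∈ Metric.ball (G.c j) (G.b j)) :
    G.smoothInv δ =ᶠ[𝓝 x] fun y => y + G.cutoff δ j y • (G.inv y - y) := by
  filter_upwards [Metric.isOpen_ball.mem_nhds h] with y hy
  exact G.smoothInv_of_mem hδ (Metric.ball_subset_closedBall hy)

theorem notMem_sphere_of_mem_ball (h : x ∈ Metric.ball (G.c j) (G.b j)) (l : Fin N) :
    x ∉ Metric.sphere (G.c l) (G.b l) := fun h1 => by
  have := G.eq_of_mem_ball (Metric.ball_subset_closedBall h) (Metric.sphere_subset_closedBall h1)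
  subst this
  rw [Metric.mem_ball] at h
  exact h.ne h1

theorem contDiffAt_cutoff (hx : x ∈ G.Ω) (δ : ℝ) (j : Fin N) :
    ContDiffAt ℝ 2 (G.cutoff δ j) x := by
  have hn : ContDiffAt ℝ 2 (fun z : R3 => ‖z - G.c j‖) x :=
    (contDiffAt_id.sub contDiffAt_const).norm ℝ
      (norm_pos_iff.1 ((G.a_pos j).trans (G.mem_Ω_iff.1 hx j)))
  exact (Real.smoothTransition.contDiffAt (n := 2)).comp x
    ((contDiffAt_const.sub hn).div_const δ)

theorem contDiffAt_smoothInv (hδ : 0 < δ) (hx : x ∈ G.Ω) : ContDiffAt ℝ 2 (G.smoothInv δ) x := by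
  by_cases h : ∃ j, x ∈ Metric.ball (G.c j) (G.b j)
  · obtain ⟨j, hj⟩ := h
    refine ContDiffAt.congr_of_eventuallyEq ?_ (G.smoothInv_eventuallyEq_of_mem hδ hj)
    exact contDiffAt_id.add ((G.contDiffAt_cutoff hx δ j).smul
      ((G.contDiffAt_inv hx (G.notMem_sphere_of_mem_ball hj)).sub contDiffAt_id))
  · refine contDiffAt_id.congr_of_eventuallyEq (G.smoothInv_eventuallyEq_id hδ fun j => ?_)
    have h1 := not_exists.1 h j
    rw [Metric.mem_ball, dist_eq_norm, not_lt] at h1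
    linarith

theorem exists_norm_fderiv_cutoff_le :
    ∃ L : ℝ, 0 ≤ L ∧ ∀ (δ : ℝ) (j : Fin N) (x : R3), 0 < δ →
      ‖fderiv ℝ (G.cutoff δ j) x‖ ≤ L * δ⁻¹ := by
  obtain ⟨L, hL⟩ := exists_lipschitzWith_smoothTransition
  refine ⟨L, L.2, fun δ j x hδ => ?_⟩
  have h1 : LipschitzWith (Real.toNNReal δ⁻¹)
      fun z : R3 => (G.b j - δ - ‖z - G.c j‖) / δ := by
    refine LipschitzWith.of_dist_le_mul fun y z => ?_
    rw [Real.coe_toNNReal _ (by positivity), Real.dist_eq, ← sub_div, abs_div, abs_of_pos hδ,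
      div_eq_inv_mul, dist_eq_norm]
    gcongr
    rw [sub_sub_sub_cancel_left, abs_sub_comm]
    refine (abs_norm_sub_norm_le _ _).trans ?_
    rw [sub_sub_sub_cancel_right]
  have h2 := norm_fderiv_le_of_lipschitz ℝ (x₀ := x) (hL.comp h1)
  rwa [NNReal.coe_mul, Real.coe_toNNReal _ (by positivity)] at h2

theorem fderiv_cutoff_eq_zero (hδ : 0 < δ) (h : ‖x - G.c j‖ < G.b j - 2 * δ) :
    fderiv ℝ (G.cutoff δ j) x = 0 := by
  have : G.cutoff δ j =ᶠ[𝓝 x] fun _ => 1 := by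
    filter_upwards [(by fun_prop : Continuous fun y : R3 => ‖y - G.c j‖).continuousAt.eventually
      (gt_mem_nhds h)] with y hy
    exact G.cutoff_eq_one hδ (le_of_lt hy)
  rw [this.fderiv_eq]
  simp

/-- The Jacobian matrices of the smooth approximations are bounded on compact subsets of `Ω`,
uniformly in `δ`. The gradient of the cutoff is of order `δ⁻¹`, but where it does not vanish the
transformation differs from the identity by a quantity of order `δ`. -/
theorem exists_bound_jac_smoothInv {Q : Set R3} (hQ : IsCompact Q) (hQΩ : Q ⊆ G.Ω) :
    ∃ D : ℝ, ∀ δ : ℝ, 0 < δ → ∀ x ∈ Q, ∀ i k, |jac (G.smoothInv δ) x i k| ≤ D := by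
  obtain ⟨D, hD, h₁⟩ := G.exists_bound_jac_inv hQ hQΩ
  obtain ⟨L, hL, h₂⟩ := G.exists_norm_fderiv_cutoff_le
  choose C hC h₃ using G.exists_norm_inv_sub_le
  have hsum : ∀ j, C j ≤ ∑ l, C l := fun j =>
    Finset.single_le_sum (f := C) (fun i _ => hC i) (Finset.mem_univ j)
  have hsum0 : 0 ≤ ∑ l, C l := Finset.sum_nonneg fun i _ => hC i
  have hone : ∀ i k : Fin 3, |(1 : Matrix (Fin 3) (Fin 3) ℝ) i k| ≤ 1 := fun i k => by
    rw [Matrix.one_apply]; split_ifs <;> simp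
  refine ⟨1 + (D + 1) + 2 * L * ∑ l, C l, fun δ hδ x hx i k => ?_⟩
  have hxΩ := hQΩ hx
  by_cases h : ∃ j, x ∈ Metric.ball (G.c j) (G.b j)
  · obtain ⟨j, hj⟩ := h
    have hns := G.notMem_sphere_of_mem_ball hj
    have hτ := ((G.contDiffAt_cutoff hxΩ δ j).differentiableAt (by norm_num)).hasFDerivAt
    have hi := ((G.contDiffAt_inv hxΩ hns).differentiableAt (by norm_num)).hasFDerivAt
    have hf := (hasFDerivAt_id x).add (hτ.smul (hi.sub (hasFDerivAt_id x)))
    have hjac : jac (G.smoothInv δ) x i k = (1 : Matrix (Fin 3) (Fin 3) ℝ) i k +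
        (G.cutoff δ j x * (jac G.inv x i k - (1 : Matrix (Fin 3) (Fin 3) ℝ) i k) +
        fderiv ℝ (G.cutoff δ j) x (EuclideanSpace.single k 1) * (G.inv x - x) i) := by
      rw [jac_eq_of_eventuallyEq (G.smoothInv_eventuallyEq_of_mem hδ hj), jac, Matrix.of_apply,
        HasFDerivAt.fderiv (f := fun y => y + G.cutoff δ j y • (G.inv y - y)) hf]
      simp [jac, Matrix.one_apply]
    have b1 : |G.cutoff δ j x * (jac G.inv x i k - (1 : Matrix (Fin 3) (Fin 3) ℝ) i k)| ≤ D + 1 := by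
      rw [abs_mul]
      refine (mul_le_of_le_one_left (abs_nonneg _) ?_).trans ((abs_sub _ _).trans
        (add_le_add (h₁ x hx hns i k) (hone i k)))
      rw [cutoff, abs_of_nonneg (Real.smoothTransition.nonneg _)]
      exact Real.smoothTransition.le_one _
    have b2 : |fderiv ℝ (G.cutoff δ j) x (EuclideanSpace.single k 1) * (G.inv x - x) i| ≤
        2 * L * ∑ l, C l := by
      by_cases hlt : ‖x - G.c j‖ < G.b j - 2 * δ
      · rw [G.fderiv_cutoff_eq_zero hδ hlt, zero_apply, zero_mul, abs_zero]
        positivity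
      · rw [abs_mul]
        have c1 : |fderiv ℝ (G.cutoff δ j) x (EuclideanSpace.single k 1)| ≤ L * δ⁻¹ := by
          refine ((fderiv ℝ (G.cutoff δ j) x).le_opNorm _).trans ?_
          simpa using h₂ δ j x hδ
        have c2 : |(G.inv x - x) i| ≤ (∑ l, C l) * (2 * δ) := by
          refine (PiLp.norm_apply_le (G.inv x - x) i).trans
            ((h₃ j x hxΩ (Metric.ball_subset_closedBall hj)).trans ?_)
          have : ‖x - G.c j‖ < G.b j := by rwa [Metric.mem_ball, dist_eq_norm] at hj
          exact mul_le_mul (hsum j) (by linarith) (by linarith) hsum0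
        refine (mul_le_mul c1 c2 (abs_nonneg _) (by positivity)).trans (le_of_eq ?_)
        field_simp
    rw [hjac]
    refine (abs_add_le _ _).trans ?_
    have := (abs_add_le _ _).trans (add_le_add b1 b2)
    linarith [hone i k]
  · have hid := G.smoothInv_eventuallyEq_id hδ (x := x) fun j => by
      have h1 := not_exists.1 h j
      rw [Metric.mem_ball, dist_eq_norm, not_lt] at h1
      linarith
    rw [jac_eq_of_eventuallyEq hid, jac_id]
    have : 0 ≤ 2 * L * ∑ l, C l := by positivity
    linarith [hone i k]

theorem eventually_smoothInv_eventuallyEq (hxs : ∀ j, x ∉ Metric.sphere (G.c j) (G.b j)) :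
    ∀ᶠ δ in 𝓝[>] (0 : ℝ), G.smoothInv δ =ᶠ[𝓝 x] G.inv := by
  have hpos : ∀ᶠ δ in 𝓝[>] (0 : ℝ), 0 < δ := eventually_mem_nhdsWithin
  by_cases h : ∃ j, x ∈ Metric.ball (G.c j) (G.b j)
  · obtain ⟨j, hj⟩ := h
    have hj' : 0 < (G.b j - ‖x - G.c j‖) / 2 := by
      rw [Metric.mem_ball, dist_eq_norm] at hj
      linarith
    filter_upwards [hpos, nhdsWithin_le_nhds (gt_mem_nhds hj')] with δ hδ hδ'
    have h1 : ‖x - G.c j‖ < G.b j - 2 * δ := by linarith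
    filter_upwards [G.smoothInv_eventuallyEq_of_mem hδ hj,
      (by fun_prop : Continuous fun y : R3 => ‖y - G.c j‖).continuousAt.eventually
      (gt_mem_nhds h1)] with y hy hy'
    rw [hy, G.cutoff_eq_one hδ (le_of_lt hy'), one_smul, add_sub_cancel]
  · have h1 : ∀ j, x ∉ Metric.closedBall (G.c j) (G.b j) := fun j hj =>
      h ⟨j, lt_of_le_of_ne hj fun h' => hxs j h'⟩
    filter_upwards [hpos] with δ hδ
    have hopen : IsOpen (⋃ j, Metric.closedBall (G.c j) (G.b j))ᶜ :=
      (isClosed_iUnion_of_finite fun _ => Metric.isClosed_closedBall).isOpen_compl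
    filter_upwards [hopen.mem_nhds (by simpa using h1), G.smoothInv_eventuallyEq_id hδ (x := x)
      fun j => by
        have h2 := h1 j
        rw [Metric.mem_closedBall, dist_eq_norm, not_le] at h2
        linarith] with y hy hy'
    rw [hy', G.inv_of_notMem (by simpa using hy)]

theorem continuousOn_map : ContinuousOn G.map G.Ω₀ := by
  -- truncating `‖y - c j‖` at `b j` gives one formula for the map, without case distinction
  let e : Fin N → R3 → ℝ := fun j y => min ‖y - G.c j‖ (G.b j)
  have heq : G.map = fun y => y + ∑ j,
      ((G.g j (e j y) - e j y) / ‖y - G.c j‖) • (y - G.c j) := by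
    funext y
    by_cases hex : ∃ l, y ∈ Metric.closedBall (G.c l) (G.b l)
    · obtain ⟨l, hl⟩ := hex
      have he : e l y = ‖y - G.c l‖ := by
        rw [Metric.mem_closedBall, dist_eq_norm] at hl
        exact min_eq_left hl
      rw [Finset.sum_eq_single l, G.map_of_mem hl, he]
      · rcases eq_or_ne y (G.c l) with h0 | h0
        · simp [h0]
        · have : ‖y - G.c l‖ ≠ 0 := norm_ne_zero_iff.2 (sub_ne_zero.2 h0)
          rw [sub_div, div_self this, sub_smul, one_smul]
          abel
      · intro j _ hj
        have h1 : y ∉ Metric.closedBall (G.c j) (G.b j) := fun h => hj (G.eq_of_mem_ball h hl)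
        rw [Metric.mem_closedBall, dist_eq_norm, not_le] at h1
        have he' : e j y = G.b j := min_eq_right h1.le
        rw [he', (G.cloaking j).map_b, sub_self, zero_div, zero_smul]
      · exact fun h => absurd (Finset.mem_univ l) h
    · have h1 := not_exists.1 hex
      rw [G.map_of_notMem h1, Finset.sum_eq_zero, add_zero]
      intro j _
      have h2 := h1 j
      rw [Metric.mem_closedBall, dist_eq_norm, not_le] at h2
      have he' : e j y = G.b j := min_eq_right h2.le
      rw [he', (G.cloaking j).map_b, sub_self, zero_div, zero_smul]
  rw [heq]
  refine continuousOn_id.add (continuousOn_finsetSum _ fun j _ => ?_)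
  have he : Continuous (e j) := by fun_prop
  have hg : Continuous fun y => G.g j (e j y) := by
    rw [← continuousOn_univ]
    exact (G.cloaking j).continuousOn.comp he.continuousOn fun y _ =>
      ⟨le_min (norm_nonneg _) (G.b_pos j).le, min_le_right _ _⟩
  refine ContinuousOn.smul (ContinuousOn.div (hg.sub he).continuousOn (by fun_prop) fun y hy => ?_)
    (by fun_prop)
  exact norm_ne_zero_iff.2 (sub_ne_zero.2 (hy j))

/-- The preimages of a compact subset of `Ω₀` under the smooth approximations of the inverse
transformation lie in a common compact subset of `Ω`, for small `δ`. -/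
theorem exists_compact_smoothInv {Q : Set R3} (hQ : IsCompact Q) (hQΩ : Q ⊆ G.Ω₀) :
    ∃ Q' : Set R3, IsCompact Q' ∧ Q' ⊆ G.Ω ∧ ∀ᶠ δ in 𝓝[>] (0 : ℝ),
      ∀ x ∈ G.Ω, G.smoothInv δ x ∈ Q → x ∈ Q' := by
  let layer : Fin N → Set R3 := fun j =>
    Metric.closedBall (G.c j) (G.b j) \ Metric.ball (G.c j) ((G.a j + G.b j) / 2)
  have hab : ∀ j, G.a j < (G.a j + G.b j) / 2 := fun j => by linarith [G.a_lt_b j]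
  refine ⟨G.map '' Q ∪ ⋃ j, layer j, ?_, ?_, ?_⟩
  · refine (hQ.image_of_continuousOn (G.continuousOn_map.mono hQΩ)).union
      (isCompact_iUnion fun j => ?_)
    exact (isCompact_closedBall _ _).diff Metric.isOpen_ball
  · rintro x (⟨y, hy, rfl⟩ | hx)
    · exact G.map_mem_Ω (hQΩ hy)
    · obtain ⟨j, hj⟩ := mem_iUnion.1 hx
      have h1 := hj.2
      rw [Metric.mem_ball, dist_eq_norm, not_lt] at h1
      rw [G.mem_Ω_iff]
      intro l
      rcases eq_or_ne l j with rfl | hl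
      · exact (hab l).trans_le h1
      · have h2 : x ∉ Metric.closedBall (G.c l) (G.b l) := fun h => hl (G.eq_of_mem_ball h hj.1)
        rw [Metric.mem_closedBall, dist_eq_norm, not_le] at h2
        exact (G.a_lt_b l).trans h2
  · have hsmall : ∀ᶠ δ in 𝓝[>] (0 : ℝ), ∀ j, δ < (G.b j - G.a j) / 4 :=
      eventually_all.2 fun j => nhdsWithin_le_nhds (gt_mem_nhds (by linarith [G.a_lt_b j]))
    filter_upwards [hsmall, eventually_mem_nhdsWithin] with δ hδ' hδ x hx hxQ
    by_cases h : ∃ j, x ∈ Metric.closedBall (G.c j) (G.b j)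
    · obtain ⟨j, hj⟩ := h
      by_cases hl : x ∈ layer j
      · exact Or.inr (mem_iUnion.2 ⟨j, hl⟩)
      · have h1 : x ∈ Metric.ball (G.c j) ((G.a j + G.b j) / 2) := by
          by_contra h1; exact hl ⟨hj, h1⟩
        rw [Metric.mem_ball, dist_eq_norm] at h1
        rw [G.smoothInv_of_mem hδ hj, G.cutoff_eq_one hδ (by linarith [hδ' j]), one_smul,
          add_sub_cancel] at hxQ
        exact Or.inl ⟨_, hxQ, G.map_inv hx⟩
    · have h1 := not_exists.1 h
      rw [G.smoothInv_of_forall_le hδ fun j => by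
        have h2 := h1 j
        rw [Metric.mem_closedBall, dist_eq_norm, not_le] at h2
        have : (0 : ℝ) < δ := hδ
        linarith] at hxQ
      exact Or.inl ⟨x, hxQ, G.map_of_notMem h1⟩

end CloakGeometry

/-! ### Change of variables in weak equations -/

open Filter Topology

/-- Dominated convergence for fields `P δ` that are bounded, supported in a fixed compact set, and at
almost every point eventually equal to their limit. -/
theorem tendsto_setIntegral_inner {O Q : Set R3} (hO : MeasurableSet O) (hQ : IsCompact Q)
    (hQO : Q ⊆ O) {W : R3 → C3} (hW : LocallyIntegrableOn W O) {l : Filter ℝ}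
    [l.IsCountablyGenerated] {P : ℝ → R3 → C3} {P₀ : R3 → C3} {C : ℝ}
    (hP : ∀ᶠ δ in l, Continuous (P δ))
    (hb : ∀ᶠ δ in l, ∀ x ∈ O, ‖P δ x‖ ≤ Q.indicator (fun _ => C) x)
    (hlim : ∀ᵐ x ∂(volume.restrict O), ∀ᶠ δ in l, P δ x = P₀ x) :
    Tendsto (fun δ => ∫ x in O, inner ℂ (P δ x) (W x)) l
      (𝓝 (∫ x in O, inner ℂ (P₀ x) (W x))) := by
  have hWm : AEStronglyMeasurable W (volume.restrict O) := hW.aestronglyMeasurable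
  refine tendsto_integral_filter_of_dominated_convergence
    (fun x => Q.indicator (fun x => C * ‖W x‖) x) ?_ ?_ ?_ ?_
  · filter_upwards [hP] with δ h
    exact h.aestronglyMeasurable.inner hWm
  · filter_upwards [hb] with δ h
    filter_upwards [ae_restrict_mem hO] with x hx
    refine (norm_inner_le_norm _ _).trans ((mul_le_mul_of_nonneg_right (h x hx)
      (norm_nonneg _)).trans (le_of_eq ?_))
    by_cases hxQ : x ∈ Q <;> simp [hxQ]
  · refine Integrable.integrableOn ?_
    rw [integrable_indicator_iff hQ.measurableSet]
    exact (hW.integrableOn_compact_subset hQO hQ).norm.const_mul C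
  · filter_upwards [hlim] with x hx
    refine tendsto_const_nhds.congr' ?_
    filter_upwards [hx] with δ h
    rw [h]

namespace CloakGeometry

variable {N : ℕ} (G : CloakGeometry N)

theorem regular_ae_eq_univ : G.regular =ᵐ[volume] (univ : Set R3) := by
  rw [eventuallyEq_univ]
  have h : ∀ᵐ y ∂(volume : Measure R3), ∀ j, y ≠ G.c j :=
    ae_all_iff.2 fun j => measure_eq_zero_iff_ae_notMem.1 (measure_singleton (G.c j))
  filter_upwards [h, G.ae_regular] with y h1 h2
  exact ⟨h1, h2⟩

theorem Ω₀_ae_eq_univ : G.Ω₀ =ᵐ[volume] (univ : Set R3) := by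
  have h := G.regular_ae_eq_univ
  rw [eventuallyEq_univ] at h ⊢
  filter_upwards [h] with y hy
  exact hy.1

theorem image_regular_ae_eq : G.map '' G.regular =ᵐ[volume] G.Ω := by
  rw [eventuallyEq_set]
  filter_upwards [G.ae_regular] with x hx
  constructor
  · rintro ⟨y, hy, rfl⟩
    exact G.map_mem_Ω hy.1
  · exact fun h => ⟨_, G.inv_mem_regular h hx, G.map_inv h⟩

theorem hasFDerivWithinAt_map {y : R3} (hy : y ∈ G.regular) :
    HasFDerivWithinAt G.map (fderiv ℝ G.map y) G.regular y :=
  ((G.contDiffAt_map hy).differentiableAt (by norm_num)).hasFDerivAt.hasFDerivWithinAt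

theorem abs_det_fderiv_map {y : R3} (hy : y ∈ G.regular) :
    |(fderiv ℝ G.map y).det| = (G.jacobian y).det := by
  rw [det_fderiv]
  exact abs_of_pos (G.det_jacobian_pos hy)

variable {E : Type*} [NormedAddCommGroup E] [NormedSpace ℝ E]

/-- The substitution `x = f y`. The integral on the right runs over all of `ℝ³`, since the points
where `f` is not smooth form a null set. -/
theorem setIntegral_Ω (F : R3 → E) :
    ∫ x in G.Ω, F x = ∫ y, (G.jacobian y).det • F (G.map y) := by
  rw [← setIntegral_congr_set G.image_regular_ae_eq,
    integral_image_eq_integral_abs_det_fderiv_smul volume G.isOpen_regular.measurableSet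
      (fun y hy => G.hasFDerivWithinAt_map hy) (G.injOn_map.mono fun y hy => hy.1),
    ← setIntegral_univ (f := fun y => (G.jacobian y).det • F (G.map y)),
    ← setIntegral_congr_set G.regular_ae_eq_univ]
  exact setIntegral_congr_fun G.isOpen_regular.measurableSet fun y hy => by
    simp only [G.abs_det_fderiv_map hy]

theorem integrableOn_Ω_iff (F : R3 → E) :
    IntegrableOn F G.Ω ↔ Integrable fun y => (G.jacobian y).det • F (G.map y) := by
  rw [← integrableOn_congr_set_ae G.image_regular_ae_eq,
    integrableOn_image_iff_integrableOn_abs_det_fderiv_smul volume G.isOpen_regular.measurableSet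
      (fun y hy => G.hasFDerivWithinAt_map hy) (G.injOn_map.mono fun y hy => hy.1),
    ← integrableOn_univ, ← integrableOn_congr_set_ae G.regular_ae_eq_univ]
  exact integrableOn_congr_fun (fun y hy => by simp only [G.abs_det_fderiv_map hy])
    G.isOpen_regular.measurableSet

/-- Test fields pulled back under the smooth approximations of the inverse transformation. -/
theorem indicator_pullback_mem_testFields {δ : ℝ} (hδ : 0 < δ) {ψ : R3 → C3}
    (hψ : ContDiff ℝ 1 ψ) {Q : Set R3} (hQ : IsCompact Q) (hQΩ : Q ⊆ G.Ω)
    (h : ∀ x ∈ G.Ω, G.smoothInv δ x ∈ tsupport ψ → x ∈ Q) :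
    G.Ω.indicator (pullback (G.smoothInv δ) ψ) ∈ testFields G.Ω := by
  have h0 : ∀ x, x ∉ Q → G.Ω.indicator (pullback (G.smoothInv δ) ψ) x = 0 := fun x hx => by
    by_cases hxΩ : x ∈ G.Ω
    · rw [indicator_of_mem hxΩ, pullback,
        image_eq_zero_of_notMem_tsupport fun h' => hx (h x hxΩ h'), map_zero]
    · exact indicator_of_notMem hxΩ _
  have hs : tsupport (G.Ω.indicator (pullback (G.smoothInv δ) ψ)) ⊆ Q :=
    closure_minimal (fun x hx => by_contra fun hxQ => hx (h0 x hxQ)) hQ.isClosed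
  refine ⟨contDiff_iff_contDiffAt.2 fun x => ?_, hQ.of_isClosed_subset isClosed_closure hs,
    hs.trans hQΩ⟩
  by_cases hx : x ∈ G.Ω
  · refine (contDiffAt_pullback (G.contDiffAt_smoothInv hδ hx) hψ).congr_of_eventuallyEq ?_
    filter_upwards [G.isOpen_Ω.mem_nhds hx] with z hz
    exact indicator_of_mem hz _
  · refine (contDiffAt_const (c := (0 : C3))).congr_of_eventuallyEq ?_
    filter_upwards [hQ.isClosed.isOpen_compl.mem_nhds fun h' => hx (hQΩ h')] with z hz
    exact h0 z hz

theorem curl_indicator_pullback {δ : ℝ} (hδ : 0 < δ) {ψ : R3 → C3} (hψ : ContDiff ℝ 1 ψ) {x : R3}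
    (hx : x ∈ G.Ω) : curl (G.Ω.indicator (pullback (G.smoothInv δ) ψ)) x =
      rop (jac (G.smoothInv δ) x).adjugate (curl ψ (G.smoothInv δ x)) := by
  rw [← curl_pullback (G.contDiffAt_smoothInv hδ hx) hψ]
  refine curl_eq_of_eventuallyEq ?_
  filter_upwards [G.isOpen_Ω.mem_nhds hx] with z hz
  exact indicator_of_mem hz _

end CloakGeometry

theorem det_smul_inner_adjugate_inv {A : Matrix (Fin 3) (Fin 3) ℝ} (hA : 0 < A.det) (v w : C3) :
    A.det • inner ℂ (rop A⁻¹.adjugate v) w = inner ℂ v (rop A.transpose w) := by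
  have hu : IsUnit A.det := hA.ne'.isUnit
  have h1 : A⁻¹.adjugate = A.det⁻¹ • A := by
    have h2 := congrArg (· * A) (Matrix.adjugate_mul A⁻¹)
    change A⁻¹.adjugate * A⁻¹ * A = A⁻¹.det • 1 * A at h2
    rwa [mul_assoc, Matrix.nonsing_inv_mul A hu, mul_one, Matrix.smul_mul, one_mul,
      Matrix.det_nonsing_inv, Ring.inverse_eq_inv'] at h2
  rw [h1, rop_smul, ← inner_rop_left, ← Complex.coe_smul, ← Complex.coe_smul, inner_smul_left,
    Complex.conj_ofReal, smul_eq_mul, ← mul_assoc, ← Complex.ofReal_mul, mul_inv_cancel₀ hA.ne',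
    Complex.ofReal_one, one_mul]

theorem det_smul_inner_transpose_inv {A : Matrix (Fin 3) (Fin 3) ℝ} (hA : 0 < A.det) (v w : C3) :
    A.det • inner ℂ (rop A⁻¹.transpose v) w = inner ℂ v (rop A.adjugate w) := by
  have h1 : A⁻¹ = A.det⁻¹ • A.adjugate := by rw [Matrix.inv_def, Ring.inverse_eq_inv']
  rw [inner_rop_left, Matrix.transpose_transpose, h1, rop_smul, ← Complex.coe_smul,
    ← Complex.coe_smul, inner_smul_right, smul_eq_mul, ← mul_assoc, ← Complex.ofReal_mul,
    mul_inv_cancel₀ hA.ne', Complex.ofReal_one, one_mul]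

open CloakGeometry in
/-- Weak curl equations are invariant under the cloaking transformation, although it is not
differentiable at the spheres `|y - c j| = b j`: the pull-backs of a test field under the smooth
approximations `smoothInv δ` of the inverse are test fields, and they converge with their curls,
boundedly and almost everywhere, as `δ → 0`. -/
theorem HasWeakCurl.comp_map {N : ℕ} (G : CloakGeometry N) {U V : R3 → C3}
    (hU : LocallyIntegrableOn U G.Ω) (hV : LocallyIntegrableOn V G.Ω) (h : HasWeakCurl G.Ω U V) :
    HasWeakCurl G.Ω₀ (fun y => rop (G.jacobian y).transpose (U (G.map y)))
      (fun y => rop (G.jacobian y).adjugate (V (G.map y))) := by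
  intro ψ hψ
  obtain ⟨Q, hQ, hQΩ, hev⟩ := G.exists_compact_smoothInv hψ.2.1 hψ.2.2
  obtain ⟨D, hD⟩ := G.exists_bound_jac_smoothInv hQ hQΩ
  obtain ⟨C, hC0, hC⟩ := exists_bound_rop D
  obtain ⟨C₁, hC₁⟩ := hψ.2.1.exists_bound_of_continuous hψ.1.continuous
  obtain ⟨C₂, hC₂⟩ := (HasCompactSupport.of_support_subset_isCompact hψ.2.1
    (f := curl ψ) fun x hx => by_contra fun h' => hx (curl_eq_zero h')).exists_bound_of_continuous
    (continuous_curl hψ)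
  have hpos : ∀ᶠ δ in 𝓝[>] (0 : ℝ), 0 < δ := eventually_mem_nhdsWithin
  have hae : ∀ᵐ x ∂(volume.restrict G.Ω), ∀ j, x ∉ Metric.sphere (G.c j) (G.b j) :=
    ae_restrict_of_ae G.ae_regular
  have hmemΩ : ∀ᵐ x ∂(volume.restrict G.Ω), x ∈ G.Ω := ae_restrict_mem G.isOpen_Ω.measurableSet
  have l₁ : Tendsto (fun δ => ∫ x in G.Ω,
      inner ℂ (curl (G.Ω.indicator (pullback (G.smoothInv δ) ψ)) x) (U x)) (𝓝[>] 0)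
      (𝓝 (∫ x in G.Ω, inner ℂ (rop (jac G.inv x).adjugate (curl ψ (G.inv x))) (U x))) := by
    refine tendsto_setIntegral_inner G.isOpen_Ω.measurableSet hQ hQΩ hU (C := C * C₂) ?_ ?_ ?_
    · filter_upwards [hpos, hev] with δ hδ hδ'
      exact continuous_curl (G.indicator_pullback_mem_testFields hδ hψ.1 hQ hQΩ hδ')
    · filter_upwards [hpos, hev] with δ hδ hδ' x hx
      rw [G.curl_indicator_pullback hδ hψ.1 hx]
      by_cases hxQ : x ∈ Q
      · rw [indicator_of_mem hxQ]
        exact (hC _ (hD δ hδ x hxQ) _).2.trans (mul_le_mul_of_nonneg_left (hC₂ _) hC0)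
      · rw [curl_eq_zero fun h' => hxQ (hδ' x hx h'), map_zero, norm_zero,
          indicator_of_notMem hxQ]
    · filter_upwards [hae, hmemΩ] with x hx hxΩ
      filter_upwards [hpos, G.eventually_smoothInv_eventuallyEq hx] with δ hδ hδ'
      rw [G.curl_indicator_pullback hδ hψ.1 hxΩ, jac_eq_of_eventuallyEq hδ', hδ'.self_of_nhds]
  have l₂ : Tendsto (fun δ => ∫ x in G.Ω,
      inner ℂ (G.Ω.indicator (pullback (G.smoothInv δ) ψ) x) (V x)) (𝓝[>] 0)
      (𝓝 (∫ x in G.Ω, inner ℂ (pullback G.inv ψ x) (V x))) := by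
    refine tendsto_setIntegral_inner G.isOpen_Ω.measurableSet hQ hQΩ hV (C := C * C₁) ?_ ?_ ?_
    · filter_upwards [hpos, hev] with δ hδ hδ'
      exact (G.indicator_pullback_mem_testFields hδ hψ.1 hQ hQΩ hδ').1.continuous
    · filter_upwards [hpos, hev] with δ hδ hδ' x hx
      rw [indicator_of_mem hx, pullback]
      by_cases hxQ : x ∈ Q
      · rw [indicator_of_mem hxQ]
        exact (hC _ (hD δ hδ x hxQ) _).1.trans (mul_le_mul_of_nonneg_left (hC₁ _) hC0)
      · rw [image_eq_zero_of_notMem_tsupport fun h' => hxQ (hδ' x hx h'), map_zero, norm_zero,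
          indicator_of_notMem hxQ]
    · filter_upwards [hae, hmemΩ] with x hx hxΩ
      filter_upwards [G.eventually_smoothInv_eventuallyEq hx] with δ hδ'
      rw [indicator_of_mem hxΩ, (pullback_eventuallyEq hδ' ψ).self_of_nhds]
  have key := tendsto_nhds_unique (l₁.congr' ?_) l₂
  · rw [G.setIntegral_Ω, G.setIntegral_Ω] at key
    rw [setIntegral_congr_set G.Ω₀_ae_eq_univ, setIntegral_congr_set G.Ω₀_ae_eq_univ,
      setIntegral_univ, setIntegral_univ]
    have hreg : ∀ᵐ y ∂(volume : Measure R3), y ∈ G.regular := eventuallyEq_univ.1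
      G.regular_ae_eq_univ
    refine (integral_congr_ae ?_).trans (key.trans (integral_congr_ae ?_))
    · filter_upwards [hreg] with y hy
      rw [G.jac_inv_map hy, G.inv_map hy.1, det_smul_inner_adjugate_inv (G.det_jacobian_pos hy)]
    · filter_upwards [hreg] with y hy
      rw [pullback, G.jac_inv_map hy, G.inv_map hy.1,
        det_smul_inner_transpose_inv (G.det_jacobian_pos hy)]
  · filter_upwards [hpos, hev] with δ hδ hδ'
    exact h _ (G.indicator_pullback_mem_testFields hδ hψ.1 hQ hQΩ hδ')

/-! ### Localization, and removal of isolated points -/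

open Filter Topology

/-- A smooth bump function on `ℝ³` that is `1` on the unit ball and supported in the ball of
radius `2`. -/
def unitBump : ContDiffBump (0 : R3) := ⟨1, 2, one_pos, one_lt_two⟩

/-- A smooth bump function that is `1` on the ball of center `c` and radius `r` and supported in the
ball of radius `2 r`. -/
def scaledBump (c : R3) (r : ℝ) (x : R3) : ℝ := unitBump (r⁻¹ • (x - c))

section Bump

variable {c : R3} {r : ℝ} {x : R3}

theorem contDiff_scaledBump (c : R3) (r : ℝ) : ContDiff ℝ 1 (scaledBump c r) :=
  unitBump.contDiff.comp (by fun_prop : ContDiff ℝ 1 fun x : R3 => r⁻¹ • (x - c))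

theorem scaledBump_nonneg : 0 ≤ scaledBump c r x := unitBump.nonneg

theorem scaledBump_le_one : scaledBump c r x ≤ 1 := unitBump.le_one

theorem scaledBump_eq_one (hr : 0 < r) (h : ‖x - c‖ ≤ r) : scaledBump c r x = 1 := by
  refine unitBump.one_of_mem_closedBall ?_
  rw [mem_closedBall_zero_iff, norm_smul, norm_inv, Real.norm_of_nonneg hr.le]
  exact inv_mul_le_one_of_le₀ h hr.le

theorem scaledBump_eq_zero (hr : 0 < r) (h : 2 * r ≤ ‖x - c‖) : scaledBump c r x = 0 := by
  refine unitBump.zero_of_le_dist ?_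
  rw [dist_zero_right, norm_smul, norm_inv, Real.norm_of_nonneg hr.le, le_inv_mul_iff₀ hr, mul_comm]
  exact h

theorem tsupport_scaledBump_subset (hr : 0 < r) :
    tsupport (scaledBump c r) ⊆ Metric.closedBall c (2 * r) := by
  refine closure_minimal (fun x hx => ?_) Metric.isClosed_closedBall
  rw [Metric.mem_closedBall, dist_eq_norm]
  exact le_of_not_gt fun h => hx (scaledBump_eq_zero hr h.le)

theorem hasCompactSupport_scaledBump (hr : 0 < r) : HasCompactSupport (scaledBump c r) :=
  (isCompact_closedBall c (2 * r)).of_isClosed_subset isClosed_closure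
    (tsupport_scaledBump_subset hr)

theorem exists_norm_fderiv_scaledBump_le : ∃ M : ℝ, 0 ≤ M ∧ ∀ (c : R3) (r : ℝ), 0 < r → ∀ x,
    ‖fderiv ℝ (scaledBump c r) x‖ ≤ M * r⁻¹ := by
  have hc : ContDiff ℝ 1 unitBump := unitBump.contDiff
  obtain ⟨M, hM⟩ := (unitBump.hasCompactSupport.fderiv ℝ).exists_bound_of_continuous
    (hc.continuous_fderiv one_ne_zero)
  refine ⟨M, (norm_nonneg _).trans (hM 0), fun c r hr x => ?_⟩
  have h1 : HasFDerivAt (fun y : R3 => r⁻¹ • (y - c)) (r⁻¹ • ContinuousLinearMap.id ℝ R3) x :=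
    ((hasFDerivAt_id x).sub_const c).const_smul r⁻¹
  have h2 := ((hc.differentiable one_ne_zero) (r⁻¹ • (x - c))).hasFDerivAt.comp x h1
  rw [HasFDerivAt.fderiv (f := scaledBump c r) h2]
  refine (ContinuousLinearMap.opNorm_comp_le _ _).trans ?_
  refine mul_le_mul (hM _) ?_ (norm_nonneg _) ((norm_nonneg _).trans (hM 0))
  rw [norm_smul, norm_inv, Real.norm_of_nonneg hr.le]
  exact mul_le_of_le_one_right (by positivity) ContinuousLinearMap.norm_id_le

end Bump

theorem norm_C3_le (v : C3) : ‖v‖ ≤ ‖v 0‖ + ‖v 1‖ + ‖v 2‖ := by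
  rw [EuclideanSpace.norm_eq, Fin.sum_univ_three]
  refine Real.sqrt_le_iff.2 ⟨by positivity, ?_⟩
  have h0 := norm_nonneg (v 0)
  have h1 := norm_nonneg (v 1)
  have h2 := norm_nonneg (v 2)
  nlinarith [mul_nonneg h0 h1, mul_nonneg h0 h2, mul_nonneg h1 h2]

section Localize

variable {χ : R3 → ℝ} {ψ : R3 → C3} {x : R3}

theorem partialDeriv_smul (hχ : DifferentiableAt ℝ χ x) (hψ : DifferentiableAt ℝ ψ x)
    (k l : Fin 3) : partialDeriv (fun y => χ y • ψ y) k l x =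
      χ x * partialDeriv ψ k l x + fderiv ℝ χ x (EuclideanSpace.single k 1) * ψ x l := by
  rw [partialDeriv, fderiv_fun_smul hχ hψ]
  simp [partialDeriv]

/-- `∇ × (χ ψ) = χ ∇ × ψ + ∇χ × ψ`, with an estimate of the last term. -/
theorem norm_curl_smul_sub_le (hχ : DifferentiableAt ℝ χ x) (hψ : DifferentiableAt ℝ ψ x) :
    ‖curl (fun y => χ y • ψ y) x - χ x • curl ψ x‖ ≤ 6 * (‖fderiv ℝ χ x‖ * ‖ψ x‖) := by
  have h1 : ∀ k l, ‖(fderiv ℝ χ x (EuclideanSpace.single k 1) : ℂ) * ψ x l‖ ≤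
      ‖fderiv ℝ χ x‖ * ‖ψ x‖ := fun k l => by
    rw [norm_mul]
    refine mul_le_mul ?_ (PiLp.norm_apply_le _ _) (norm_nonneg _) (norm_nonneg _)
    rw [Complex.norm_real]
    simpa using (fderiv ℝ χ x).le_opNorm (EuclideanSpace.single k 1)
  have h2 : ∀ k l m n, ‖(fderiv ℝ χ x (EuclideanSpace.single k 1) : ℂ) * ψ x l -
      (fderiv ℝ χ x (EuclideanSpace.single m 1) : ℂ) * ψ x n‖ ≤ 2 * (‖fderiv ℝ χ x‖ * ‖ψ x‖) :=
    fun k l m n => (norm_sub_le _ _).trans (by linarith [h1 k l, h1 m n])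
  refine (norm_C3_le _).trans ?_
  have e0 : (curl (fun y => χ y • ψ y) x - χ x • curl ψ x) 0 =
      (fderiv ℝ χ x (EuclideanSpace.single 1 1) : ℂ) * ψ x 2 -
      (fderiv ℝ χ x (EuclideanSpace.single 2 1) : ℂ) * ψ x 1 := by
    simp [curl, partialDeriv_smul hχ hψ]; ring
  have e1 : (curl (fun y => χ y • ψ y) x - χ x • curl ψ x) 1 =
      (fderiv ℝ χ x (EuclideanSpace.single 2 1) : ℂ) * ψ x 0 -
      (fderiv ℝ χ x (EuclideanSpace.single 0 1) : ℂ) * ψ x 2 := by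
    simp [curl, partialDeriv_smul hχ hψ]; ring
  have e2 : (curl (fun y => χ y • ψ y) x - χ x • curl ψ x) 2 =
      (fderiv ℝ χ x (EuclideanSpace.single 0 1) : ℂ) * ψ x 1 -
      (fderiv ℝ χ x (EuclideanSpace.single 1 1) : ℂ) * ψ x 0 := by
    simp [curl, partialDeriv_smul hχ hψ]; ring
  rw [e0, e1, e2]
  linarith [h2 1 2 2 1, h2 2 0 0 2, h2 0 1 1 0]

theorem smul_mem_testFields {O O' : Set R3} (hχ : ContDiff ℝ 1 χ) (hψ : ψ ∈ testFields O)
    (h : tsupport χ ∩ O ⊆ O') : (fun y => χ y • ψ y) ∈ testFields O' :=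
  have h1 : ContDiff ℝ 1 (fun y => χ y • ψ y) := hχ.smul hψ.1
  have h2 : HasCompactSupport (fun y => χ y • ψ y) := hψ.2.1.smul_left (f := χ)
  ⟨h1, h2, fun _ hx =>
    h ⟨tsupport_smul_subset_left χ ψ hx, hψ.2.2 (tsupport_smul_subset_right χ ψ hx)⟩⟩

end Localize

theorem integrable_inner_of_memLp {φ U : R3 → C3} (hφ : Continuous φ) (hc : HasCompactSupport φ)
    (hU : MemLp U 2) : Integrable fun x => inner ℂ (φ x) (U x) :=
  (((hφ.memLp_of_hasCompactSupport (p := 2) hc).norm.integrable_mul hU.norm).mono'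
    (hφ.aestronglyMeasurable.inner hU.1)
    (Filter.Eventually.of_forall fun _ => norm_inner_le_norm _ _))

theorem tendsto_volume_closedBall_nhds_zero (c : R3) :
    Tendsto (fun δ => volume (Metric.closedBall c (2 * δ))) (𝓝[>] (0 : ℝ)) (𝓝 0) := by
  have h := tendsto_measure_biInter_gt (μ := (volume : Measure R3))
    (s := fun δ : ℝ => Metric.closedBall c (2 * δ)) (a := 0)
    (fun δ _ => Metric.isClosed_closedBall.measurableSet.nullMeasurableSet)
    (fun i j _ hij => Metric.closedBall_subset_closedBall (by linarith))
    ⟨1, one_pos, measure_closedBall_lt_top.ne⟩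
  have h2 : ⋂ δ > (0 : ℝ), Metric.closedBall c (2 * δ) = {c} := by
    ext y
    simp only [mem_iInter, Metric.mem_closedBall, mem_singleton_iff]
    refine ⟨fun hy => ?_, fun hy δ hδ => by rw [hy, dist_self]; linarith [hδ.lt]⟩
    refine dist_le_zero.1 (le_of_forall_pos_le_add fun ε hε => ?_)
    have := hy (ε / 2) (by positivity)
    linarith
  rw [h2, measure_singleton] at h
  exact h

/-- The localization of a test field at a point contributes arbitrarily little to a weak equation
between square integrable fields: a point of `ℝ³` has zero capacity. -/
theorem tendsto_weakCurl_scaledBump {U V : R3 → C3} (hU : MemLp U 2) (hV : MemLp V 2) (c : R3)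
    {ψ : R3 → C3} (hψ : ψ ∈ testFields univ) :
    Tendsto (fun δ => ∫ x, (inner ℂ (curl (fun y => scaledBump c δ y • ψ y) x) (U x) -
      inner ℂ (scaledBump c δ x • ψ x) (V x))) (𝓝[>] (0 : ℝ)) (𝓝 0) := by
  obtain ⟨M, hM0, hM⟩ := exists_norm_fderiv_scaledBump_le
  obtain ⟨C₁, hC₁⟩ := hψ.2.1.exists_bound_of_continuous hψ.1.continuous
  obtain ⟨C₂, hC₂⟩ := (HasCompactSupport.of_support_subset_isCompact hψ.2.1
    (f := curl ψ) fun x hx => by_contra fun h' => hx (curl_eq_zero h')).exists_bound_of_continuous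
    (continuous_curl hψ)
  have hC₁0 : 0 ≤ C₁ := (norm_nonneg _).trans (hC₁ 0)
  have hC₂0 : 0 ≤ C₂ := (norm_nonneg _).trans (hC₂ 0)
  have hU2 : Integrable fun x => ‖U x‖ ^ 2 := hU.integrable_norm_pow two_ne_zero
  have hV2 : Integrable fun x => ‖V x‖ ^ 2 := hV.integrable_norm_pow two_ne_zero
  set K := C₂ + 6 * (M * C₁) with hK
  have hK0 : 0 ≤ K := by positivity
  have hvol := tendsto_volume_closedBall_nhds_zero c
  set v₁ := volume.real (Metric.closedBall (0 : R3) 1) with hv₁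
  -- the volume of the support is of order `δ³`, and the curl of the test field of order `δ⁻¹`
  have hbound : ∀ᶠ δ in 𝓝[>] (0 : ℝ),
      ‖∫ x, (inner ℂ (curl (fun y => scaledBump c δ y • ψ y) x) (U x) -
        inner ℂ (scaledBump c δ x • ψ x) (V x))‖ ≤
      8 * v₁ * (K ^ 2 + C₁ ^ 2) * δ + ((∫ x in Metric.closedBall c (2 * δ), ‖U x‖ ^ 2) +
        ∫ x in Metric.closedBall c (2 * δ), ‖V x‖ ^ 2) := by
    filter_upwards [eventually_mem_nhdsWithin, nhdsWithin_le_nhds (gt_mem_nhds one_pos)]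
      with δ hδ hδ1
    replace hδ : 0 < δ := hδ
    have hχ := contDiff_scaledBump c δ
    have hinv : 1 ≤ δ⁻¹ := one_le_inv_iff₀.2 ⟨hδ, hδ1.le⟩
    have hcurl : ∀ x, ‖curl (fun y => scaledBump c δ y • ψ y) x‖ ≤ K * δ⁻¹ := fun x => by
      have h1 := norm_curl_smul_sub_le (hχ.differentiable one_ne_zero x)
        (hψ.1.differentiable one_ne_zero x)
      have h2 : ‖scaledBump c δ x • curl ψ x‖ ≤ C₂ := by
        rw [norm_smul, Real.norm_of_nonneg scaledBump_nonneg]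
        exact (mul_le_of_le_one_left (norm_nonneg _) scaledBump_le_one).trans (hC₂ x)
      have h3 : ‖fderiv ℝ (scaledBump c δ) x‖ * ‖ψ x‖ ≤ M * δ⁻¹ * C₁ :=
        mul_le_mul (hM c δ hδ x) (hC₁ x) (norm_nonneg _) (by positivity)
      have h4 := norm_le_norm_sub_add (curl (fun y => scaledBump c δ y • ψ y) x)
        (scaledBump c δ x • curl ψ x)
      have h5 : C₂ ≤ C₂ * δ⁻¹ := le_mul_of_one_le_right hC₂0 hinv
      calc _ ≤ 6 * (M * δ⁻¹ * C₁) + C₂ * δ⁻¹ := by linarith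
        _ = K * δ⁻¹ := by rw [hK]; ring
    have hpt : ∀ x, ‖inner ℂ (curl (fun y => scaledBump c δ y • ψ y) x) (U x) -
        inner ℂ (scaledBump c δ x • ψ x) (V x)‖ ≤ (Metric.closedBall c (2 * δ)).indicator
        (fun x => (K * δ⁻¹) ^ 2 + C₁ ^ 2 + (‖U x‖ ^ 2 + ‖V x‖ ^ 2)) x := fun x => by
      by_cases hx : x ∈ Metric.closedBall c (2 * δ)
      · rw [indicator_of_mem hx]
        have h1 : ‖scaledBump c δ x • ψ x‖ ≤ C₁ := by
          rw [norm_smul, Real.norm_of_nonneg scaledBump_nonneg]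
          exact (mul_le_of_le_one_left (norm_nonneg _) scaledBump_le_one).trans (hC₁ x)
        have h2 := (norm_inner_le_norm (𝕜 := ℂ) _ _).trans
          (mul_le_mul_of_nonneg_right (hcurl x) (norm_nonneg (U x)))
        have h3 := (norm_inner_le_norm (𝕜 := ℂ) _ _).trans
          (mul_le_mul_of_nonneg_right h1 (norm_nonneg (V x)))
        refine (norm_sub_le _ _).trans ((add_le_add h2 h3).trans ?_)
        nlinarith [sq_nonneg (K * δ⁻¹ - ‖U x‖), sq_nonneg (C₁ - ‖V x‖),
          sq_nonneg (K * δ⁻¹ + ‖U x‖), sq_nonneg (C₁ + ‖V x‖)]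
      · have h1 : x ∉ tsupport fun y => scaledBump c δ y • ψ y := fun h =>
          hx (tsupport_scaledBump_subset hδ (tsupport_smul_subset_left _ _ h))
        rw [indicator_of_notMem hx, curl_eq_zero h1,
          show scaledBump c δ x • ψ x = 0 from image_eq_zero_of_notMem_tsupport
            (f := fun y => scaledBump c δ y • ψ y) h1]
        simp
    have hi : IntegrableOn (fun x => ‖U x‖ ^ 2 + ‖V x‖ ^ 2) (Metric.closedBall c (2 * δ)) :=
      (hU2.add hV2).integrableOn
    have hconst : IntegrableOn (fun _ => (K * δ⁻¹) ^ 2 + C₁ ^ 2) (Metric.closedBall c (2 * δ)) :=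
      integrableOn_const measure_closedBall_lt_top.ne
    have hsum : IntegrableOn (fun x => (K * δ⁻¹) ^ 2 + C₁ ^ 2 + (‖U x‖ ^ 2 + ‖V x‖ ^ 2))
        (Metric.closedBall c (2 * δ)) := hconst.add hi
    refine (norm_integral_le_of_norm_le
      ((integrable_indicator_iff Metric.isClosed_closedBall.measurableSet).2 hsum)
      (Eventually.of_forall hpt)).trans ?_
    rw [integral_indicator Metric.isClosed_closedBall.measurableSet,
      integral_add hconst hi, integral_add hU2.integrableOn hV2.integrableOn, setIntegral_const]
    refine add_le_add ?_ le_rfl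
    have hvolδ : volume.real (Metric.closedBall c (2 * δ)) = (2 * δ) ^ 3 * v₁ := by
      rw [hv₁, Measure.real, Measure.addHaar_closedBall' volume c (by positivity),
        ENNReal.toReal_mul, ENNReal.toReal_ofReal (by positivity), finrank_euclideanSpace_fin]
      rfl
    have hv0 : 0 ≤ v₁ := measureReal_nonneg
    rw [hvolδ, smul_eq_mul]
    have e : (2 * δ) ^ 3 * v₁ * ((K * δ⁻¹) ^ 2 + C₁ ^ 2) =
        8 * v₁ * δ * (K ^ 2 + C₁ ^ 2 * δ ^ 2) := by
      field_simp
      ring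
    rw [e]
    have : δ ^ 2 ≤ 1 := pow_le_one₀ hδ.le hδ1.le
    have h6 : C₁ ^ 2 * δ ^ 2 ≤ C₁ ^ 2 := mul_le_of_le_one_right (sq_nonneg _) this
    calc 8 * v₁ * δ * (K ^ 2 + C₁ ^ 2 * δ ^ 2) ≤ 8 * v₁ * δ * (K ^ 2 + C₁ ^ 2) := by gcongr
      _ = _ := by ring
  refine squeeze_zero_norm' hbound ?_
  have t1 : Tendsto (fun δ : ℝ => 8 * v₁ * (K ^ 2 + C₁ ^ 2) * δ) (𝓝[>] 0) (𝓝 0) := by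
    have : Tendsto (fun δ : ℝ => 8 * v₁ * (K ^ 2 + C₁ ^ 2) * δ) (𝓝 0)
        (𝓝 (8 * v₁ * (K ^ 2 + C₁ ^ 2) * 0)) := tendsto_id.const_mul _
    rw [mul_zero] at this
    exact this.mono_left nhdsWithin_le_nhds
  have t2 := hU2.tendsto_setIntegral_nhds_zero hvol
  have t3 := hV2.tendsto_setIntegral_nhds_zero hvol
  simpa using t1.add (t2.add t3)

/-- The points `c j` are removable for a weak curl equation between square integrable fields. -/
theorem CloakGeometry.hasWeakCurl_univ {N : ℕ} (G : CloakGeometry N) {U V : R3 → C3}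
    (hU : MemLp U 2) (hV : MemLp V 2) (h : HasWeakCurl G.Ω₀ U V) : HasWeakCurl univ U V := by
  intro ψ hψ
  set T : (R3 → C3) → ℂ := fun φ => ∫ x, (inner ℂ (curl φ x) (U x) - inner ℂ (φ x) (V x)) with hT
  have hint : ∀ φ ∈ testFields univ,
      Integrable fun x => inner ℂ (curl φ x) (U x) - inner ℂ (φ x) (V x) := fun φ hφ =>
    (integrable_inner_of_memLp (continuous_curl hφ)
      (HasCompactSupport.of_support_subset_isCompact hφ.2.1 fun x hx =>
        by_contra fun h' => hx (curl_eq_zero h')) hU).sub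
      (integrable_inner_of_memLp hφ.1.continuous hφ.2.1 hV)
  have hTΩ : ∀ φ ∈ testFields G.Ω₀, T φ = 0 := fun φ hφ => by
    have h1 := h φ hφ
    rw [setIntegral_congr_set G.Ω₀_ae_eq_univ, setIntegral_congr_set G.Ω₀_ae_eq_univ,
      setIntegral_univ, setIntegral_univ] at h1
    change ∫ x, (inner ℂ (curl φ x) (U x) - inner ℂ (φ x) (V x)) = 0
    rw [integral_sub (integrable_inner_of_memLp (continuous_curl hφ)
      (HasCompactSupport.of_support_subset_isCompact hφ.2.1 fun x hx =>
        by_contra fun h' => hx (curl_eq_zero h')) hU)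
      (integrable_inner_of_memLp hφ.1.continuous hφ.2.1 hV), h1, sub_self]
  have hTadd : ∀ φ₁ ∈ testFields univ, ∀ φ₂ ∈ testFields univ, T (φ₁ + φ₂) = T φ₁ + T φ₂ := by
    intro φ₁ h₁ φ₂ h₂
    simp only [hT]
    rw [← integral_add (hint φ₁ h₁) (hint φ₂ h₂), curl_add h₁ h₂]
    refine integral_congr_ae (Eventually.of_forall fun x => ?_)
    simp only [Pi.add_apply, inner_add_left]
    ring
  have hTsum : ∀ (s : Finset (Fin N)) (φ : Fin N → R3 → C3), (∀ j, φ j ∈ testFields univ) →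
      T (∑ j ∈ s, φ j) = ∑ j ∈ s, T (φ j) := by
    intro s φ hφ
    induction s using Finset.cons_induction with
    | empty =>
      rw [Finset.sum_empty, Finset.sum_empty]
      exact hTΩ 0 (Submodule.zero_mem _)
    | cons j s hj ih =>
      rw [Finset.sum_cons, Finset.sum_cons, hTadd _ (hφ j) _ (Submodule.sum_mem _ fun l _ => hφ l),
        ih]
  -- away from the points, the test field may be replaced by a sum of localizations at the points
  have hloc : ∀ᶠ δ in 𝓝[>] (0 : ℝ),
      ∑ j, T (fun y => scaledBump (G.c j) δ y • ψ y) = T ψ := by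
    have hsmall : ∀ᶠ δ in 𝓝[>] (0 : ℝ), ∀ j, 3 * δ < G.b j :=
      eventually_all.2 fun j => nhdsWithin_le_nhds
        (((continuous_const.mul continuous_id).tendsto' (0 : ℝ) 0 (mul_zero 3)).eventually
          (gt_mem_nhds (G.b_pos j)))
    filter_upwards [hsmall, eventually_mem_nhdsWithin] with δ hδ' hδ
    replace hδ : 0 < δ := hδ
    have hmem : ∀ j, (fun y => scaledBump (G.c j) δ y • ψ y) ∈ testFields univ := fun j =>
      smul_mem_testFields (contDiff_scaledBump _ _) hψ (subset_univ _)
    have hsum := Submodule.sum_mem (testFields univ) fun j (_ : j ∈ Finset.univ) => hmem j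
    set σ := ∑ j, fun y => scaledBump (G.c j) δ y • ψ y with hσ
    have hσψ : ∀ x, (∃ j, ‖x - G.c j‖ < δ) → σ x = ψ x := by
      rintro x ⟨j, hj⟩
      rw [hσ, Finset.sum_apply, Finset.sum_eq_single j, scaledBump_eq_one hδ hj.le, one_smul]
      · intro l _ hl
        rw [scaledBump_eq_zero hδ, zero_smul]
        by_contra hlt
        refine hl (G.eq_of_mem_ball (y := x) ?_ ?_)
        · rw [Metric.mem_closedBall, dist_eq_norm]; linarith [hδ' l]
        · rw [Metric.mem_closedBall, dist_eq_norm]; linarith [hδ' j]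
      · exact fun h => absurd (Finset.mem_univ j) h
    have hrem : ψ - σ ∈ testFields G.Ω₀ := by
      have h1 := Submodule.sub_mem _ hψ hsum
      refine ⟨h1.1, h1.2.1, fun x hx j hj => ?_⟩
      have h0 : ψ - σ =ᶠ[𝓝 x] 0 := by
        filter_upwards [Metric.ball_mem_nhds x hδ] with z hz
        have hz' : ‖z - G.c j‖ < δ := by rw [← hj, ← dist_eq_norm]; exact hz
        rw [Pi.sub_apply, hσψ z ⟨j, hz'⟩, sub_self, Pi.zero_apply]
      exact notMem_tsupport_iff_eventuallyEq.2 h0 hx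
    rw [← hTsum _ _ hmem, ← hσ]
    have h2 := hTadd _ (Submodule.sub_mem _ hψ hsum) _ hsum
    rw [sub_add_cancel, hTΩ _ hrem, zero_add] at h2
    exact h2.symm
  have hlim : Tendsto (fun δ => ∑ j, T (fun y => scaledBump (G.c j) δ y • ψ y)) (𝓝[>] (0 : ℝ))
      (𝓝 (∑ _j : Fin N, 0)) :=
    tendsto_finsetSum _ fun j _ => tendsto_weakCurl_scaledBump hU hV (G.c j) hψ
  rw [Finset.sum_const_zero] at hlim
  have h0 : T ψ = 0 := tendsto_nhds_unique (tendsto_const_nhds.congr' (hloc.mono fun _ h => h.symm))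
    hlim
  rw [setIntegral_univ, setIntegral_univ, ← sub_eq_zero, ← integral_sub
    (integrable_inner_of_memLp (continuous_curl hψ)
      (HasCompactSupport.of_support_subset_isCompact hψ.2.1 fun x hx =>
        by_contra fun h' => hx (curl_eq_zero h')) hU)
    (integrable_inner_of_memLp hψ.1.continuous hψ.2.1 hV)]
  exact h0

/-! ### Mollification of weak curls -/

section Mollify

open Filter Topology

/-- The convolution of a field with a real function `η`, which is a smoothing of the field when `η`
is smooth with compact support. -/
def mollify (η : R3 → ℝ) (U : R3 → C3) : R3 → C3 :=
  MeasureTheory.convolution η U (ContinuousLinearMap.lsmul ℝ ℝ) volume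

variable {η : R3 → ℝ} {U V : R3 → C3}

theorem mollify_apply (η : R3 → ℝ) (U : R3 → C3) (z : R3) :
    mollify η U z = ∫ y, η (z - y) • U y :=
  convolution_lsmul_swap

theorem contDiff_mollify (hη : ContDiff ℝ 1 η) (hc : HasCompactSupport η)
    (hU : LocallyIntegrable U) : ContDiff ℝ 1 (mollify η U) :=
  hc.contDiff_convolution_left (n := 1) _ hη hU

theorem integrable_mollify_integrand (hη : Continuous η) (hc : HasCompactSupport η)
    (hU : LocallyIntegrable U) (z : R3) : Integrable fun y => η (z - y) • U y :=
  (hc.convolutionExists_left (ContinuousLinearMap.lsmul ℝ ℝ) hη hU z).integrable_swap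

theorem partialDeriv_mollify (hη : ContDiff ℝ 1 η) (hc : HasCompactSupport η)
    (hU : LocallyIntegrable U) (k l : Fin 3) (z : R3) :
    partialDeriv (mollify η U) k l z =
      ∫ y, (fderiv ℝ η (z - y) (EuclideanSpace.single k 1) : ℂ) * U y l := by
  have h := hc.hasFDerivAt_convolution_left (ContinuousLinearMap.lsmul ℝ ℝ) hη hU z
  have hi := ((hc.fderiv ℝ).convolutionExists_left
    ((ContinuousLinearMap.lsmul ℝ ℝ : ℝ →L[ℝ] C3 →L[ℝ] C3).precompL R3)
    (hη.continuous_fderiv one_ne_zero) hU z).integrable_swap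
  have hi2 := (ContinuousLinearMap.apply ℝ C3 (EuclideanSpace.single k 1 : R3)).integrable_comp hi
  rw [partialDeriv, mollify, h.fderiv, convolution_eq_swap,
    ContinuousLinearMap.integral_apply hi]
  refine (((EuclideanSpace.proj l : C3 →L[ℂ] ℂ).integral_comp_comm hi2).symm).trans ?_
  refine integral_congr_ae (Eventually.of_forall fun y => ?_)
  simp [ContinuousLinearMap.precompL_apply]

theorem integrable_partialDeriv_mollify_integrand (hη : ContDiff ℝ 1 η) (hc : HasCompactSupport η)
    (hU : LocallyIntegrable U) (k l : Fin 3) (z : R3) :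
    Integrable fun y => (fderiv ℝ η (z - y) (EuclideanSpace.single k 1) : ℂ) * U y l := by
  have hi := integrable_mollify_integrand (η := fun y => fderiv ℝ η y (EuclideanSpace.single k 1))
    ((hη.continuous_fderiv one_ne_zero).clm_apply continuous_const)
    (hc.fderiv_apply ℝ (EuclideanSpace.single k 1)) hU z
  refine ((EuclideanSpace.proj l : C3 →L[ℂ] ℂ).integrable_comp hi).congr
    (Eventually.of_forall fun y => ?_)
  simp

/-- The test field `y ↦ η (z - y) e_i`. -/
def mollifierField (η : R3 → ℝ) (z : R3) (i : Fin 3) (y : R3) : C3 :=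
  η (z - y) • EuclideanSpace.single i 1

theorem mollifierField_mem (hη : ContDiff ℝ 1 η) (hc : HasCompactSupport η) (z : R3) (i : Fin 3) :
    mollifierField η z i ∈ testFields univ := by
  have h : HasCompactSupport fun y => η (z - y) :=
    hc.comp_homeomorph (Homeomorph.subLeft z)
  exact ⟨(hη.comp (contDiff_const.sub contDiff_id)).smul contDiff_const,
    h.smul_right, subset_univ _⟩

theorem partialDeriv_mollifierField (hη : ContDiff ℝ 1 η) (z : R3) (i k l : Fin 3) (y : R3) :
    partialDeriv (mollifierField η z i) k l y =
      -(fderiv ℝ η (z - y) (EuclideanSpace.single k 1) : ℂ) *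
        (EuclideanSpace.single i 1 : C3) l := by
  have h1 : HasFDerivAt (fun y : R3 => z - y) (-ContinuousLinearMap.id ℝ R3) y :=
    (hasFDerivAt_id y).const_sub z
  have h2 := ((hη.differentiable one_ne_zero) (z - y)).hasFDerivAt.comp y h1
  have h3 := h2.smul_const (EuclideanSpace.single i 1 : C3)
  rw [partialDeriv, HasFDerivAt.fderiv (f := mollifierField η z i) h3]
  rw [neg_mul]
  simp

/-- Mollification turns a weak curl into a curl. -/
theorem curl_mollify (hη : ContDiff ℝ 1 η) (hc : HasCompactSupport η)
    (hU : LocallyIntegrable U) (hV : LocallyIntegrable V) (h : HasWeakCurl univ U V) (z : R3) :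
    curl (mollify η U) z = mollify η V z := by
  have key : ∀ i, ∫ y, inner ℂ (curl (mollifierField η z i) y) (U y) = mollify η V z i := by
    intro i
    have h1 := h _ (mollifierField_mem hη hc z i)
    rw [setIntegral_univ, setIntegral_univ] at h1
    rw [h1, mollify_apply]
    refine Eq.trans ?_ ((EuclideanSpace.proj i : C3 →L[ℂ] ℂ).integral_comp_comm
      (integrable_mollify_integrand hη.continuous hc hV z))
    refine integral_congr_ae (Eventually.of_forall fun y => ?_)
    simp [mollifierField, EuclideanSpace.inner_single_left]
  have hi := integrable_partialDeriv_mollify_integrand hη hc hU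
  have hp := partialDeriv_mollify hη hc hU
  ext i
  rw [← key i]
  fin_cases i
  · change partialDeriv _ 1 2 z - partialDeriv _ 2 1 z = _
    rw [hp, hp, ← integral_sub (hi 1 2 z) (hi 2 1 z)]
    refine integral_congr_ae (Eventually.of_forall fun y => ?_)
    simp [inner_C3, curl, partialDeriv_mollifierField hη]
    ring
  · change partialDeriv _ 2 0 z - partialDeriv _ 0 2 z = _
    rw [hp, hp, ← integral_sub (hi 2 0 z) (hi 0 2 z)]
    refine integral_congr_ae (Eventually.of_forall fun y => ?_)
    simp [inner_C3, curl, partialDeriv_mollifierField hη]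
    ring
  · change partialDeriv _ 0 1 z - partialDeriv _ 1 0 z = _
    rw [hp, hp, ← integral_sub (hi 0 1 z) (hi 1 0 z)]
    refine integral_congr_ae (Eventually.of_forall fun y => ?_)
    simp [inner_C3, curl, partialDeriv_mollifierField hη]
    ring

/-- The Cauchy–Schwarz inequality with a weight `w`: the quadratic polynomial
`t ↦ ∫ w (t - u) ^ 2` has no two distinct real roots. -/
theorem sq_integral_mul_le {w u : R3 → ℝ} (hw : ∀ x, 0 ≤ w x) (h0 : Integrable w)
    (h1 : Integrable fun x => w x * u x) (h2 : Integrable fun x => w x * u x ^ 2) :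
    (∫ x, w x * u x) ^ 2 ≤ (∫ x, w x) * ∫ x, w x * u x ^ 2 := by
  have hq : ∀ t : ℝ, 0 ≤ (∫ x, w x) * (t * t) + (-2 * ∫ x, w x * u x) * t +
      ∫ x, w x * u x ^ 2 := by
    intro t
    have h3 : 0 ≤ ∫ x, (w x * (t * t) + (-2 * t) * (w x * u x) + w x * u x ^ 2) :=
      integral_nonneg fun x => by
        have := mul_nonneg (hw x) (sq_nonneg (t - u x))
        change 0 ≤ w x * (t * t) + (-2 * t) * (w x * u x) + w x * u x ^ 2
        nlinarith
    have h4 : Integrable fun x => w x * (t * t) + (-2 * t) * (w x * u x) :=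
      (h0.mul_const _).add (h1.const_mul _)
    rw [integral_add h4 h2, integral_add (h0.mul_const _) (h1.const_mul _), integral_mul_const,
      integral_const_mul] at h3
    linarith
  have h5 := discrim_le_zero hq
  rw [discrim] at h5
  linarith

/-- The case `L¹ ⋆ L² ⊆ L²` of Young's inequality. -/
theorem memLp_mollify (hη : ContDiff ℝ 1 η) (hc : HasCompactSupport η) (hU : MemLp U 2) :
    MemLp (mollify η U) 2 := by
  have hUl : LocallyIntegrable U := hU.locallyIntegrable one_le_two
  rw [memLp_two_iff_integrable_sq_norm (contDiff_mollify hη hc hUl).continuous.aestronglyMeasurable]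
  have hηi : Integrable fun y => ‖η y‖ := (hη.continuous.integrable_of_hasCompactSupport hc).norm
  have hU2 : Integrable fun x => ‖U x‖ ^ 2 := hU.integrable_norm_pow two_ne_zero
  have hconv : Integrable fun z => ∫ y, ‖η (z - y)‖ * ‖U y‖ ^ 2 := by
    refine (hηi.integrable_convolution (ContinuousLinearMap.lsmul ℝ ℝ) hU2).congr
      (Eventually.of_forall fun z => ?_)
    exact convolution_lsmul_swap
  refine (hconv.const_mul (∫ y, ‖η y‖)).mono'
    ((contDiff_mollify hη hc hUl).continuous.norm.pow 2).aestronglyMeasurable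
    (Eventually.of_forall fun z => ?_)
  rw [Real.norm_of_nonneg (sq_nonneg _), mollify_apply]
  have i0 : Integrable fun y => ‖η (z - y)‖ := hηi.comp_sub_left z
  have i1 : Integrable fun y => ‖η (z - y)‖ * ‖U y‖ := by
    simpa only [norm_smul] using (integrable_mollify_integrand hη.continuous hc hUl z).norm
  have i2 : Integrable fun y => ‖η (z - y)‖ * ‖U y‖ ^ 2 :=
    (hc.norm.convolutionExists_left (ContinuousLinearMap.lsmul ℝ ℝ) hη.continuous.norm
      hU2.locallyIntegrable z).integrable_swap
  have h1 : ‖∫ y, η (z - y) • U y‖ ≤ ∫ y, ‖η (z - y)‖ * ‖U y‖ := by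
    simpa only [norm_smul] using norm_integral_le_integral_norm fun y => η (z - y) • U y
  refine (pow_le_pow_left₀ (norm_nonneg _) h1 2).trans ?_
  refine (sq_integral_mul_le (fun y => norm_nonneg _) i0 i1 i2).trans_eq ?_
  rw [integral_sub_left_eq_self (fun y => ‖η y‖)]

theorem mollify_comp (T : C3 →L[ℂ] C3) (hη : Continuous η) (hc : HasCompactSupport η)
    (hU : LocallyIntegrable U) (z : R3) :
    mollify η (fun y => T (U y)) z = T (mollify η U z) := by
  rw [mollify_apply, mollify_apply, ← T.integral_comp_comm (integrable_mollify_integrand hη hc hU z)]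
  simp

/-- A locally integrable field whose mollifications vanish is zero. -/
theorem ae_eq_zero_of_mollify (hU : LocallyIntegrable U)
    (h : ∀ η : R3 → ℝ, ContDiff ℝ 1 η → HasCompactSupport η → mollify η U 0 = 0) :
    U =ᵐ[volume] 0 := by
  refine ae_eq_zero_of_integral_contDiff_smul_eq_zero hU fun g hg hgc => ?_
  -- the value at `0` of the convolution with the reflected function is `∫ g • U`
  have h1 := h (fun x => g (-x)) ((hg.of_le (mod_cast le_top)).comp contDiff_neg)
    (hgc.comp_homeomorph (Homeomorph.neg R3))
  simpa [mollify_apply] using h1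

end Mollify

/-! ### Uniqueness in a homogeneous medium -/

section Homogeneous

open Filter Topology

variable {E H : R3 → C3} {M₁ M₂ : Mat3} {s : ℝ}

/-- The energy identity `s ∫ (⟨E, M₁ E⟩ + ⟨H, M₂ H⟩) = 0`, localized at the scale `R`: the gradient of
the cutoff contributes `O (R⁻¹)`. Both densities enter with the same sign, because `s` is real. -/
theorem exists_integral_bump_mul_le (hM₁ : M₁.PosDef) (hM₂ : M₂.PosDef) (hs : s ≠ 0)
    (hE : ContDiff ℝ 1 E) (hH : ContDiff ℝ 1 H) (hE2 : MemLp E 2) (hH2 : MemLp H 2)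
    (h₁ : ∀ x, curl H x = (s : ℂ) • op M₁ (E x)) (h₂ : ∀ x, curl E x = -(s : ℂ) • op M₂ (H x)) :
    ∃ C : ℝ, ∀ R : ℝ, 0 < R → ∫ x, scaledBump 0 R x * (‖E x‖ ^ 2 + ‖H x‖ ^ 2) ≤ C * R⁻¹ := by
  obtain ⟨M, hM0, hM⟩ := exists_norm_fderiv_scaledBump_le
  obtain ⟨m₁, _, hm₁, -, hb₁⟩ := exists_bound_density hM₁
  obtain ⟨m₂, _, hm₂, -, hb₂⟩ := exists_bound_density hM₂
  set m := min m₁ m₂ with hm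
  have hm0 : 0 < m := lt_min hm₁ hm₂
  have hEH : Integrable fun x => ‖E x‖ * ‖H x‖ := hE2.norm.integrable_mul hH2.norm
  set B := ∫ x, ‖E x‖ * ‖H x‖ with hB
  refine ⟨(m * |s|)⁻¹ * (6 * M * B), fun R hR => ?_⟩
  set χ := scaledBump (0 : R3) R with hχ
  have hχ1 : ContDiff ℝ 1 χ := contDiff_scaledBump 0 R
  have hχc : HasCompactSupport χ := hasCompactSupport_scaledBump hR
  have hχE : ContDiff ℝ 1 fun x => χ x • E x := hχ1.smul hE
  have hχEc : HasCompactSupport fun x => χ x • E x := hχc.smul_right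
  have hint : ∀ {f : R3 → ℂ}, Continuous f → Integrable fun x => (χ x : ℂ) * f x := fun hf =>
    ((Complex.continuous_ofReal.comp hχ1.continuous).mul hf).integrable_of_hasCompactSupport
      (hχc.mono fun x hx h0 => hx (by simp [h0]))
  have c₁ : Continuous fun x => density M₁ (E x) (E x) := by
    simp only [density_eq_inner]
    exact hE.continuous.inner ((op M₁).continuous.comp hE.continuous)
  have c₂ : Continuous fun x => density M₂ (H x) (H x) := by
    simp only [density_eq_inner]
    exact hH.continuous.inner ((op M₂).continuous.comp hH.continuous)
  have hiD : Integrable fun x => (χ x : ℂ) * (density M₁ (E x) (E x) + density M₂ (H x) (H x)) :=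
    hint (c₁.add c₂)
  have e1 : ∀ x, inner ℂ (χ x • E x) (curl H x) =
      (s : ℂ) * ((χ x : ℂ) * density M₁ (E x) (E x)) := fun x => by
    rw [h₁, inner_smul_right, density_eq_inner, RCLike.real_smul_eq_coe_smul (K := ℂ),
      inner_smul_left]
    simp
  have e2 : ∀ x, inner ℂ (χ x • curl E x) (H x) =
      -((s : ℂ) * ((χ x : ℂ) * density M₂ (H x) (H x))) := fun x => by
    rw [h₂, density_eq_inner, RCLike.real_smul_eq_coe_smul (K := ℂ), inner_smul_left,
      inner_smul_left, Weight.inner_op_left hM₂]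
    simp
    ring
  have hparts := integral_inner_curl hχE hχEc hH
  have herr : (s : ℂ) * ∫ x, (χ x : ℂ) * (density M₁ (E x) (E x) + density M₂ (H x) (H x)) =
      ∫ x, inner ℂ (curl (fun y => χ y • E y) x - χ x • curl E x) (H x) := by
    have i2 : Integrable fun x => inner ℂ (χ x • curl E x) (H x) := by
      simp only [e2]
      exact ((hint c₂).const_mul _).neg
    have i1 : Integrable fun x => inner ℂ (curl (fun y => χ y • E y) x) (H x) :=
      integrable_inner_of_memLp (continuous_curl_of_contDiff hχE)
        (HasCompactSupport.of_support_subset_isCompact hχEc fun x hx =>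
          by_contra fun h' => hx (curl_eq_zero h')) hH2
    simp only [inner_sub_left]
    rw [integral_sub i1 i2, hparts]
    simp only [e1, e2]
    rw [integral_neg, sub_neg_eq_add, ← integral_add ((hint c₁).const_mul _)
      ((hint c₂).const_mul _), ← integral_const_mul]
    simp only [mul_add]
  have hle : ‖∫ x, inner ℂ (curl (fun y => χ y • E y) x - χ x • curl E x) (H x)‖ ≤
      6 * M * R⁻¹ * B := by
    rw [hB, ← integral_const_mul]
    refine norm_integral_le_of_norm_le (hEH.const_mul _) (Eventually.of_forall fun x => ?_)
    refine (norm_inner_le_norm _ _).trans ?_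
    have h3 := norm_curl_smul_sub_le (hχ1.differentiable one_ne_zero x)
      (hE.differentiable one_ne_zero x)
    have h4 := mul_le_mul_of_nonneg_right (hM 0 R hR x) (norm_nonneg (E x))
    calc _ ≤ 6 * (M * R⁻¹ * ‖E x‖) * ‖H x‖ :=
          mul_le_mul_of_nonneg_right (h3.trans (by linarith)) (norm_nonneg _)
      _ = _ := by ring
  have hlow : m * ∫ x, χ x * (‖E x‖ ^ 2 + ‖H x‖ ^ 2) ≤
      ‖∫ x, (χ x : ℂ) * (density M₁ (E x) (E x) + density M₂ (H x) (H x))‖ := by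
    refine le_trans ?_ (Complex.re_le_norm _)
    rw [← integral_const_mul, ← RCLike.re_eq_complex_re, ← integral_re hiD]
    refine integral_mono_of_nonneg (Eventually.of_forall fun x => ?_) hiD.re
      (Eventually.of_forall fun x => ?_)
    · have : 0 ≤ χ x := scaledBump_nonneg
      simp only [Pi.zero_apply]
      positivity
    · have h0 : 0 ≤ χ x := scaledBump_nonneg
      have h5 := (mul_le_mul_of_nonneg_right (min_le_left m₁ m₂) (sq_nonneg ‖E x‖)).trans
        (hb₁ (E x)).1
      have h6 := (mul_le_mul_of_nonneg_right (min_le_right m₁ m₂) (sq_nonneg ‖H x‖)).trans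
        (hb₂ (H x)).1
      have h7 := mul_le_mul_of_nonneg_left (add_le_add h5 h6) h0
      simp only [RCLike.re_eq_complex_re, Complex.re_ofReal_mul, Complex.add_re]
      rw [← hm] at h7
      linarith
  have hs0 : 0 < |s| := abs_pos.2 hs
  rw [mul_assoc, inv_mul_eq_div, le_div_iff₀ (by positivity)]
  rw [← herr, norm_mul, Complex.norm_real, Real.norm_eq_abs] at hle
  have := mul_le_mul_of_nonneg_left hlow hs0.le
  linarith

theorem eq_zero_of_contDiff (hM₁ : M₁.PosDef) (hM₂ : M₂.PosDef) (hs : s ≠ 0)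
    (hE : ContDiff ℝ 1 E) (hH : ContDiff ℝ 1 H) (hE2 : MemLp E 2) (hH2 : MemLp H 2)
    (h₁ : ∀ x, curl H x = (s : ℂ) • op M₁ (E x)) (h₂ : ∀ x, curl E x = -(s : ℂ) • op M₂ (H x))
    (x : R3) : E x = 0 ∧ H x = 0 := by
  obtain ⟨C, hC⟩ := exists_integral_bump_mul_le hM₁ hM₂ hs hE hH hE2 hH2 h₁ h₂
  have hi : Integrable fun x => ‖E x‖ ^ 2 + ‖H x‖ ^ 2 :=
    (hE2.integrable_norm_pow two_ne_zero).add (hH2.integrable_norm_pow two_ne_zero)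
  have hcont : Continuous fun x => ‖E x‖ ^ 2 + ‖H x‖ ^ 2 :=
    (hE.continuous.norm.pow 2).add (hH.continuous.norm.pow 2)
  have t1 : Tendsto (fun R : ℝ => ∫ x, scaledBump 0 R x * (‖E x‖ ^ 2 + ‖H x‖ ^ 2)) atTop
      (𝓝 (∫ x, (‖E x‖ ^ 2 + ‖H x‖ ^ 2))) := by
    refine tendsto_integral_filter_of_dominated_convergence _
      (Eventually.of_forall fun R =>
        ((contDiff_scaledBump 0 R).continuous.mul hcont).aestronglyMeasurable)
      (Eventually.of_forall fun R => Eventually.of_forall fun x => ?_) hi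
      (Eventually.of_forall fun x => ?_)
    · rw [norm_mul, Real.norm_of_nonneg scaledBump_nonneg,
        Real.norm_of_nonneg (by positivity : 0 ≤ ‖E x‖ ^ 2 + ‖H x‖ ^ 2)]
      exact mul_le_of_le_one_left (by positivity) scaledBump_le_one
    · refine tendsto_const_nhds.congr' ?_
      filter_upwards [eventually_ge_atTop ‖x‖, eventually_gt_atTop 0] with R hR hR0
      rw [scaledBump_eq_one hR0 (by simpa using hR), one_mul]
  have t2 : Tendsto (fun R : ℝ => C * R⁻¹) atTop (𝓝 0) := by
    simpa using tendsto_inv_atTop_zero.const_mul C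
  have h0 : ∫ x, (‖E x‖ ^ 2 + ‖H x‖ ^ 2) = 0 :=
    le_antisymm (le_of_tendsto_of_tendsto t1 t2 ((eventually_gt_atTop 0).mono hC))
      (integral_nonneg fun x => by positivity)
  rw [integral_eq_zero_iff_of_nonneg (fun x => by positivity) hi] at h0
  have h3 : ‖E x‖ ^ 2 + ‖H x‖ ^ 2 = 0 :=
    congrFun ((hcont.ae_eq_iff_eq volume continuous_const).1 h0) x
  have h4 := sq_nonneg ‖E x‖
  have h5 := sq_nonneg ‖H x‖
  exact ⟨norm_eq_zero.1 (pow_eq_zero_iff two_ne_zero |>.1 (by linarith)),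
    norm_eq_zero.1 (pow_eq_zero_iff two_ne_zero |>.1 (by linarith))⟩

/-- A homogeneous medium filling the whole space has no square integrable field with
`∇ × H = s ε E` and `∇ × E = -s μ H` for a nonzero real `s`. -/
theorem HasWeakCurl.ae_eq_zero (hM₁ : M₁.PosDef) (hM₂ : M₂.PosDef) (hs : s ≠ 0)
    (hE2 : MemLp E 2) (hH2 : MemLp H 2)
    (h₁ : HasWeakCurl univ H fun x => (s : ℂ) • op M₁ (E x))
    (h₂ : HasWeakCurl univ E fun x => -(s : ℂ) • op M₂ (H x)) :
    E =ᵐ[volume] 0 ∧ H =ᵐ[volume] 0 := by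
  have hE : LocallyIntegrable E := hE2.locallyIntegrable one_le_two
  have hH : LocallyIntegrable H := hH2.locallyIntegrable one_le_two
  have key : ∀ η : R3 → ℝ, ContDiff ℝ 1 η → HasCompactSupport η →
      mollify η E 0 = 0 ∧ mollify η H 0 = 0 := by
    intro η hη hc
    refine eq_zero_of_contDiff hM₁ hM₂ hs (contDiff_mollify hη hc hE) (contDiff_mollify hη hc hH)
      (memLp_mollify hη hc hE2) (memLp_mollify hη hc hH2) (fun x => ?_) (fun x => ?_) 0
    · have hV : LocallyIntegrable fun x => ((s : ℂ) • op M₁) (E x) :=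
        (((s : ℂ) • op M₁).comp_memLp' hE2).locallyIntegrable one_le_two
      rw [curl_mollify hη hc hH hV h₁]
      exact mollify_comp ((s : ℂ) • op M₁) hη.continuous hc hE x
    · have hV : LocallyIntegrable fun x => (-(s : ℂ) • op M₂) (H x) :=
        ((-(s : ℂ) • op M₂).comp_memLp' hH2).locallyIntegrable one_le_two
      rw [curl_mollify hη hc hE hV h₂]
      exact mollify_comp (-(s : ℂ) • op M₂) hη.continuous hc hH x
  exact ⟨ae_eq_zero_of_mollify hE fun η hη hc => (key η hη hc).1,
    ae_eq_zero_of_mollify hH fun η hη hc => (key η hη hc).2⟩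

end Homogeneous

/-! ### Finite-energy fields in the cloaking medium -/

namespace CloakGeometry

variable {N : ℕ} (G : CloakGeometry N) {M₀ : Mat3}

theorem ae_mem_regular : ∀ᵐ y ∂(volume : Measure R3), y ∈ G.regular :=
  Filter.eventuallyEq_univ.1 G.regular_ae_eq_univ

theorem op_transform_map {y : R3} (hy : y ∈ G.regular) (M₀ : Mat3) (v : C3) :
    op (G.transform M₀ (G.map y)) v =
      (G.jacobian y).det⁻¹ • rop (G.jacobian y) (op M₀ (rop (G.jacobian y).transpose v)) := by
  rw [transform, G.inv_map hy.1, ← Complex.coe_smul, op, map_smul, map_mul, map_mul,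
    ← Matrix.transpose_map]
  exact Complex.coe_smul _ _

theorem rop_adjugate_op_transform {y : R3} (hy : y ∈ G.regular) (M₀ : Mat3) (v : C3) :
    rop (G.jacobian y).adjugate (op (G.transform M₀ (G.map y)) v) =
      op M₀ (rop (G.jacobian y).transpose v) := by
  have hd := (G.det_jacobian_pos hy).ne'
  rw [G.op_transform_map hy, ← Complex.coe_smul, map_smul, ← rop_mul, Matrix.adjugate_mul, rop_smul,
    rop_one, Complex.coe_smul, smul_smul, inv_mul_cancel₀ hd, one_smul]

/-- The energy density of the medium in `Ω` becomes that of the homogeneous medium in the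
coordinates `y`. -/
theorem det_smul_density_transform {y : R3} (hy : y ∈ G.regular) (M₀ : Mat3) (v : C3) :
    (G.jacobian y).det • density (G.transform M₀ (G.map y)) v v =
      density M₀ (rop (G.jacobian y).transpose v) (rop (G.jacobian y).transpose v) := by
  have hd := (G.det_jacobian_pos hy).ne'
  rw [density_eq_inner, density_eq_inner, G.op_transform_map hy, inner_rop_left,
    Matrix.transpose_transpose, ← Complex.coe_smul, ← Complex.coe_smul, inner_smul_right,
    smul_eq_mul, ← mul_assoc, ← Complex.ofReal_mul, mul_inv_cancel₀ hd, Complex.ofReal_one, one_mul]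

theorem aestronglyMeasurable_pullback {U : R3 → C3} (hU : StronglyMeasurable U) :
    AEStronglyMeasurable (pullback G.map U) := by
  have h : AEMeasurable (fun y => rop (G.jacobian y).transpose)
      ((volume : Measure R3).restrict univ) := by
    refine aemeasurable_op fun i j => ?_
    exact (Complex.measurable_ofReal.comp (G.measurable_jacobian j i)).aemeasurable
  have h1 := Weight.aestronglyMeasurable_apply h
    (hU.comp_measurable G.measurable_map).aestronglyMeasurable
  rw [Measure.restrict_univ] at h1
  exact h1

variable {G}

section Field

variable {hM₀ : M₀.PosDef} (u : (G.exteriorWeight M₀ hM₀).L2)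

theorem integrable_density_pullback :
    Integrable fun y => density M₀ (pullback G.map u.field y) (pullback G.map u.field y) := by
  have h : IntegrableOn (fun x => density (G.transform M₀ x) (u.field x) (u.field x)) G.Ω := u.2
  rw [G.integrableOn_Ω_iff] at h
  refine h.congr ?_
  filter_upwards [G.ae_mem_regular] with y hy
  exact G.det_smul_density_transform hy M₀ _

/-- The pull-back of a field of finite energy is square integrable over `ℝ³`. -/
theorem memLp_pullback : MemLp (pullback G.map u.field) 2 := by
  obtain ⟨m, _, hm, -, hb⟩ := exists_bound_density hM₀
  have hmeas := G.aestronglyMeasurable_pullback (U := u.field) (AEEqFun.stronglyMeasurable u.1)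
  rw [memLp_two_iff_integrable_sq_norm hmeas]
  refine ((integrable_density_pullback u).re.const_mul m⁻¹).mono' (hmeas.norm.pow 2)
    (Filter.Eventually.of_forall fun y => ?_)
  rw [Real.norm_of_nonneg (sq_nonneg _), inv_mul_eq_div, le_div_iff₀ hm, mul_comm]
  exact (hb _).1

theorem eq_zero_of_pullback (h : pullback G.map u.field =ᵐ[volume] 0) : u = 0 := by
  rw [← inner_self_eq_zero (𝕜 := ℂ), Weight.L2.inner_apply, G.setIntegral_Ω]
  refine integral_eq_zero_of_ae ?_
  filter_upwards [h, G.ae_mem_regular] with y h1 hy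
  refine (G.det_smul_density_transform hy M₀ _).trans ?_
  rw [show rop (G.jacobian y).transpose (u.field (G.map y)) = 0 from h1, density_eq_inner,
    inner_zero_left]
  rfl

theorem locallyIntegrableOn_field : LocallyIntegrableOn u.field G.Ω :=
  Weight.locallyIntegrableOn_of_memLp G.isOpen_Ω fun _ hQ hQΩ =>
    Weight.memLp_field hQ (G.isOpen_Ω.interior_eq.symm ▸ hQΩ) u

theorem locallyIntegrableOn_op_field (s : ℂ) : LocallyIntegrableOn
    (fun x => s • op ((G.exteriorWeight M₀ hM₀).mat x) (u.field x)) G.Ω :=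
  Weight.locallyIntegrableOn_of_memLp G.isOpen_Ω fun _ hQ hQΩ =>
    (Weight.memLp_op_field hQ (G.isOpen_Ω.interior_eq.symm ▸ hQΩ) u).const_smul s

/-- A weak curl equation in the cloaking medium is one in the homogeneous medium for the
pull-backs. -/
theorem hasWeakCurl_pullback {U : R3 → C3} (hU : LocallyIntegrableOn U G.Ω)
    (hU2 : MemLp (pullback G.map U) 2)
    {s : ℂ} (h : HasWeakCurl G.Ω U fun x => s • op ((G.exteriorWeight M₀ hM₀).mat x) (u.field x)) :
    HasWeakCurl univ (pullback G.map U) fun y => s • op M₀ (pullback G.map u.field y) := by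
  refine G.hasWeakCurl_univ hU2 ((s • op M₀).comp_memLp' (memLp_pullback u)) fun φ hφ => ?_
  refine (h.comp_map G hU (locallyIntegrableOn_op_field u s) φ hφ).trans
    (integral_congr_ae (ae_restrict_of_ae ?_))
  filter_upwards [G.ae_mem_regular] with y hy
  rw [map_smul]
  exact congrArg (fun v => inner ℂ (φ y) (s • v)) (G.rop_adjugate_op_transform hy M₀ _)

end Field

end CloakGeometry

/-! ### Essential self-adjointness of the exterior Maxwell operator -/

namespace CloakedSystem

open scoped LinearPMap

variable {N : ℕ} (Y : CloakedSystem N)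

/-- The deficiency spaces of `a_Ω` are trivial. -/
theorem eq_zero_of_adjoint_aΩ {s : ℝ} (hs : s ≠ 0) (u : Y.aΩ†.domain)
    (hu : Y.aΩ† u = (Complex.I * s) • (u : Y.HΩ)) : (u : Y.HΩ) = 0 := by
  obtain ⟨h₁, h₂⟩ := hasWeakCurl_of_adjoint_maxwell Y.εΩ Y.μΩ Y.isOpen_Ω u hu
  have hE := CloakGeometry.memLp_pullback (u : Y.HΩ).fst
  have hH := CloakGeometry.memLp_pullback (u : Y.HΩ).snd
  obtain ⟨z₁, z₂⟩ := HasWeakCurl.ae_eq_zero Y.ε₀_posDef Y.μ₀_posDef hs hE hH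
    (CloakGeometry.hasWeakCurl_pullback _ (CloakGeometry.locallyIntegrableOn_field _) hH h₁)
    (CloakGeometry.hasWeakCurl_pullback _ (CloakGeometry.locallyIntegrableOn_field _) hE h₂)
  have h3 : (u : Y.HΩ) = WithLp.toLp 2 ((u : Y.HΩ).fst, (u : Y.HΩ).snd) := rfl
  rw [h3, CloakGeometry.eq_zero_of_pullback _ z₁, CloakGeometry.eq_zero_of_pullback _ z₂]
  rfl

theorem dense_aΩ_domain : Dense (Y.aΩ.domain : Set Y.HΩ) :=
  dense_maxwell_domain Y.εΩ Y.μΩ Y.isOpen_Ω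

theorem isFormalAdjoint_adjoint_aΩ : Y.aΩ†.IsFormalAdjoint Y.aΩ† := by
  refine adjoint_isFormalAdjoint_self Y.dense_aΩ_domain (maxwell_isFormalAdjoint Y.εΩ Y.μΩ)
    (fun u hu => Y.eq_zero_of_adjoint_aΩ one_ne_zero u ?_)
    (fun u hu => Y.eq_zero_of_adjoint_aΩ (neg_ne_zero.2 one_ne_zero) u ?_)
  · rw [hu, Complex.ofReal_one, mul_one]
  · rw [hu, Complex.ofReal_neg, Complex.ofReal_one, mul_neg_one]

end CloakedSystem

end Cloaking

end

open Cloaking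
theorem theorem2p5 {N : ℕ} (Y : CloakedSystem N) :
    ∃ AΩ : Y.HΩ →ₗ.[ℂ] Y.HΩ,
      (IsSelfAdjointExtension Y.aΩ AΩ ∧
        ∀ B : Y.HΩ →ₗ.[ℂ] Y.HΩ, IsSelfAdjointExtension Y.aΩ B → B = AΩ) ∧
      ∀ A : Y.H →ₗ.[ℂ] Y.H, IsSelfAdjointExtension Y.aFull A →
        ∃ AK : Y.HK →ₗ.[ℂ] Y.HK, IsSelfAdjointExtension Y.aK AK ∧ A = oplus AΩ AK := by
  have hd := Y.dense_aΩ_domain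
  have hs := Y.isFormalAdjoint_adjoint_aΩ
  exact ⟨Y.aΩ.adjoint,
    isSelfAdjointExtension_adjoint hd (maxwell_isFormalAdjoint Y.εΩ Y.μΩ) hs,
    fun A hA => exists_eq_oplus hd hs hA⟩
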